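/- Let $L\ge 1$, $p\in(0,1)$ and let $\alpha\in\mathcal M_L(\mathbb C)$ have spectral norm $<1$. Put $\rho=(1-\alpha\alpha^*)^{1/2}$, $\tilde\rho=(1-\alpha^*\alpha)^{1/2}$. Let $(\widetilde V^{(n)},d^{(n)},\theta^{(n)},\widetilde U^{(n)},D^{(n)},\Theta^{(n)})_{n\in\mathbb Z}$ be independent random variables, where $\widetilde U^{(n)},\widetilde V^{(n)}$ are Haar distributed on the unitary group $U(L)$, $d^{(n)},D^{(n)}$ are diagonal matrices whose $L$ diagonal entries are i.i.d. with values $1$ and $-1$ taken with probability $p$ and $1-p$, and $\theta^{(n)},\Theta^{(n)}$ are diagonal matrices whose $L$ diagonal entries are i.i.d. uniform on $[0,2\pi]$. Set $$U^{(n)}_\omega=e^{i\Theta^{(n)}}\widetilde U^{(n)}D^{(n)}(\widetilde U^{(n)})^*,\qquad V^{(n)}_\omega=\widetilde V^{(n)}d^{(n)}(\widetilde V^{(n)})^*e^{i\theta^{(n)}},\qquad S^{(n)}_\omega=\begin{pmatrix}\alpha&\rho U^{(n)}_\omega\\ V^{(n)}_\omega\tilde\rho&-V^{(n)}_\omega\alpha^*U^{(n)}_\omega\end{pmatrix}.$$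 Let $\mathbb U_\omega=\mathbb V_\omega\mathbb W_\omega$ on $\ell^2(\mathbb Z,\mathbb C^L)$, where $\mathbb V_\omega$ (resp. $\mathbb W_\omega$) is the direct sum of the $S^{(n)}_\omega$ with $n$ even (resp. odd), $S^{(n)}_\omega$ acting on the sites $n,n+1$. For $a<b$ in $\mathbb Z\cup\{\pm\infty\}$ and boundary conditions $U,V\in U(L)$, let $\mathbb U_\omega^{[a,b]}=\mathbb V_\omega^{[a,b]}\mathbb W_\omega^{[a,b]}$ on $\ell^2([a,b]\cap\mathbb Z,\mathbb C^L)$ be defined in the same way, except that $S^{(a-1)}_\omega$ is replaced by $U$ acting on the site $a$ (if $a>-\infty$) and $S^{(b)}_\omega$ by $V$ acting on the site $b$ (if $b<+\infty$); thus $\mathbb U_\omega^{[-\infty,+\infty]}=\mathbb U_\omega$. For $|z|\ne1$ let $G^{[a,b]}_\omega(z,k,l)\in\mathcal M_L(\mathbb C)$ be the $(k,l)$ block of $(\mathbb U_\omega^{[a,b]}-z)^{-1}$, and $G_\omega=G_\omega^{[-\infty,+\infty]}$. Let $\|\cdot\|$ be the matrix norm on $\mathcal M_L(\mathbb C)$ subordinate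 to some norm on $\mathbb C^L$, and for $\epsilon>0$ let $\mathbb S_\epsilon=\{z\in\mathbb C:1-\epsilon<|z|<1+\epsilon\}$. For every $s\in(0,\frac12)$ there is a constant $C(s)>0$ such that for every $\epsilon>0$, every $z\in\mathbb S_\epsilon$ with $|z|\neq1$, all $U,V\in U(L)$, all $a<b$ in $\mathbb Z\cup\{\pm\infty\}$ and all integers $k,l$ with $a<k,l<b$ and $|k-l|>4$, the two expectations below are finite and $$\Big(\mathbb E\,\big\|G^{[a,b]}_\omega(z,k,l)\big\|^s\Big)^2\le C(s)\;\mathbb E\,\big\|G^{[k,l]}_\omega(z,k,l)\big\|^{2s},$$ where $[k,l]$ stands for $[l,k]$ if $l<k$. In particular, for $a=-\infty$, $b=+\infty$, $\big(\mathbb E\|G_\omega(z,k,l)\|^s\big)^2\le C(s)\,\mathbb E\|G^{[k,l]}_\omega(z,k,l)\|^{2s}$. The constant depends only on $s$ and on the fixed data $L,p,\alpha,\|\cdot\|$. -/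

import Mathlib

namespace ScatteringZipper

open MeasureTheory Matrix

open scoped MatrixOrder

noncomputable section

/-! ### The probability space -/

/-- The unitary group `U(L)`. -/
abbrev UL (L : ℕ) : Type := Matrix.unitaryGroup (Fin L) ℂ

instance instMeasurableSpaceUL (L : ℕ) : MeasurableSpace (UL L) := borel (UL L)

instance instBorelSpaceUL (L : ℕ) : BorelSpace (UL L) := ⟨rfl⟩

instance instCompactSpaceUL (L : ℕ) : CompactSpace (UL L) := by
  have hc : IsCompact (Set.univ.pi fun _ : Fin L => Set.univ.pi fun _ : Fin L =>
      Metric.closedBall (0 : ℂ) 1) :=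
    isCompact_univ_pi fun _ => isCompact_univ_pi fun _ => isCompact_closedBall _ _
  have hcl : IsClosed ((Matrix.unitaryGroup (Fin L) ℂ : Set (Matrix (Fin L) (Fin L) ℂ))) :=
    isClosed_unitary
  refine isCompact_iff_compactSpace.mp (hc.of_isClosed_subset hcl ?_)
  intro A hA i _ j _
  simpa using entry_norm_bound_of_unitary hA i j

/-- The angles, i.e. the interval `[0, 2π]`. -/
abbrev Angle : Type := Set.Icc (0 : ℝ) (2 * Real.pi)

/-- `U(L) × {-1,1}^L × [0,2π]^L`. -/
abbrev PhaseData (L : ℕ) : Type := UL L × (Fin L → ℤˣ) × (Fin L → Angle)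

/-- The one-site sample space `(U(L) × {-1,1}^L × [0,2π]^L)^2`. The first factor carries
`(Ṽ, d, θ)`, the second one `(Ũ, D, Θ)`. -/
abbrev SiteData (L : ℕ) : Type := PhaseData L × PhaseData L

/-- The sample space: one `SiteData` for every integer. -/
abbrev Sample (L : ℕ) : Type := ℤ → SiteData L

/-- The normalized Haar measure on `U(L)`. -/
def haarUL (L : ℕ) : Measure (UL L) := Measure.haarMeasure ⊤

instance (L : ℕ) : IsProbabilityMeasure (haarUL L) := by
  constructor
  have h := Measure.haarMeasure_self (G := UL L) (K₀ := ⊤)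
  simpa [haarUL] using h

/-- The uniform law on `[0, 2π]`. -/
def uniformAngle : Measure Angle :=
  (ENNReal.ofReal (2 * Real.pi))⁻¹ • Measure.comap Subtype.val (volume : Measure ℝ)

instance : IsProbabilityMeasure uniformAngle := by
  constructor
  have h : (Measure.comap (Subtype.val : Angle → ℝ) (volume : Measure ℝ)) Set.univ
      = ENNReal.ofReal (2 * Real.pi) := by
    rw [(MeasurableEmbedding.subtype_coe measurableSet_Icc).comap_apply, Set.image_univ,
      Subtype.range_coe, Real.volume_Icc, sub_zero]
  rw [uniformAngle, Measure.smul_apply, h, smul_eq_mul]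
  exact ENNReal.inv_mul_cancel (by simpa using Real.pi_pos) ENNReal.ofReal_ne_top

/-- Haar ⊗ Bernoulli(p)^L ⊗ uniform^L. -/
def phaseLaw (L : ℕ) (p : unitInterval) : Measure (PhaseData L) :=
  (haarUL L).prod
    ((Measure.pi fun _ : Fin L => ProbabilityTheory.bernoulliMeasure (1 : ℤˣ) (-1) p).prod
      (Measure.pi fun _ : Fin L => uniformAngle))

instance (L : ℕ) (p : unitInterval) : IsProbabilityMeasure (phaseLaw L p) := by
  unfold phaseLaw; infer_instance

/-- The law of one site. -/
def siteLaw (L : ℕ) (p : unitInterval) : Measure (SiteData L) :=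
  (phaseLaw L p).prod (phaseLaw L p)

instance (L : ℕ) (p : unitInterval) : IsProbabilityMeasure (siteLaw L p) := by
  unfold siteLaw; infer_instance

/-- The product probability measure on the sample space. -/
def law (L : ℕ) (p : unitInterval) : Measure (Sample L) :=
  Measure.infinitePi fun _ : ℤ => siteLaw L p

instance (L : ℕ) (p : unitInterval) : IsProbabilityMeasure (law L p) := by
  unfold law; infer_instance

/-! ### The random phases and the scattering matrices -/

/-- The diagonal matrix with entries `exp (i θ_j)`. -/
def expDiag {L : ℕ} (θ : Fin L → Angle) : UL L :=
  ⟨diagonal fun j => Complex.exp (Complex.I * ((θ j : ℝ) : ℂ)), by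
    rw [mem_unitaryGroup_iff, star_eq_conjTranspose, diagonal_conjTranspose,
      diagonal_mul_diagonal, ← diagonal_one]
    congr 1
    funext j
    rw [Pi.star_apply, Complex.star_def, ← Complex.exp_conj, ← Complex.exp_add]
    simp⟩

/-- The diagonal matrix with entries `d_j ∈ {-1, 1}`. -/
def signDiag {L : ℕ} (d : Fin L → ℤˣ) : UL L :=
  ⟨diagonal fun j => (((d j : ℤˣ) : ℤ) : ℂ), by
    rw [mem_unitaryGroup_iff, star_eq_conjTranspose, diagonal_conjTranspose,
      diagonal_mul_diagonal, ← diagonal_one]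
    congr 1
    funext j
    rcases Int.units_eq_one_or (d j) with h | h <;> simp [h]⟩

/-- `V = Ṽ d Ṽ* exp(iθ)`. -/
def phaseV {L : ℕ} (x : SiteData L) : UL L :=
  x.1.1 * signDiag x.1.2.1 * star x.1.1 * expDiag x.1.2.2

/-- `U = exp(iΘ) Ũ D Ũ*`. -/
def phaseU {L : ℕ} (x : SiteData L) : UL L :=
  expDiag x.2.2.2 * (x.2.1 * signDiag x.2.2.1 * star x.2.1)

/-- `ρ(α) = (1 - α α*)^{1/2}`. -/
def rho {L : ℕ} (α : Matrix (Fin L) (Fin L) ℂ) : Matrix (Fin L) (Fin L) ℂ :=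
  CFC.sqrt (1 - α * αᴴ)

/-- `ρ̃(α) = (1 - α* α)^{1/2}`. -/
def rhoTilde {L : ℕ} (α : Matrix (Fin L) (Fin L) ℂ) : Matrix (Fin L) (Fin L) ℂ :=
  CFC.sqrt (1 - αᴴ * α)

/-- The scattering matrix `S(α, U, V)`. -/
def scat {L : ℕ} (α : Matrix (Fin L) (Fin L) ℂ) (U V : UL L) :
    Matrix (Fin L ⊕ Fin L) (Fin L ⊕ Fin L) ℂ :=
  fromBlocks α (rho α * U.1) (V.1 * rhoTilde α) (-(V.1 * αᴴ * U.1))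

/-! ### Zipper operators on intervals -/

/-- The spectral norm of a square matrix, i.e. the norm subordinate to the Euclidean norm. -/
def specNorm {L : ℕ} (A : Matrix (Fin L) (Fin L) ℂ) : ℝ :=
  ‖toEuclideanCLM (n := Fin L) (𝕜 := ℂ) A‖

/-- The Hilbert space `ℓ²(J, ℂ^L)`, for a set `J` of integers. -/
abbrev Ell2 (J : Set ℤ) (L : ℕ) : Type :=
  lp (fun _ : J => EuclideanSpace ℂ (Fin L)) 2

/-- Boundedness of the blocks of a family of scattering matrices. -/
def BddBlocks {L : ℕ} (S : ℤ → Matrix (Fin L ⊕ Fin L) (Fin L ⊕ Fin L) ℂ) : Prop :=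
  ∃ C : ℝ, ∀ n, specNorm (S n).toBlocks₁₁ ≤ C ∧ specNorm (S n).toBlocks₁₂ ≤ C ∧
    specNorm (S n).toBlocks₂₁ ≤ C ∧ specNorm (S n).toBlocks₂₂ ≤ C

/-- The direct sum over all `n` with `n ≡ e (mod 2)` of the matrices `S n`, where `S n` acts on
the two neighbouring sites `n` and `n + 1`, restricted to `J` as follows: if only the right site
`n + 1` of such a pair lies in `J`, then `S n` is replaced there by the boundary condition `Ub`;
if only the left site `n` lies in `J`, then `S n` is replaced there by `Vb`.
This is the action on an arbitrary family of vectors. -/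
def layerFun {L : ℕ} (S : ℤ → Matrix (Fin L ⊕ Fin L) (Fin L ⊕ Fin L) ℂ) (Ub Vb : UL L)
    (J : Set ℤ) (e : ℤ) (v : J → EuclideanSpace ℂ (Fin L)) (i : J) :
    EuclideanSpace ℂ (Fin L) :=
  open scoped Classical in
  if Even ((i : ℤ) - e) then
    if h : (i : ℤ) + 1 ∈ J then
      toEuclideanCLM (𝕜 := ℂ) (S i).toBlocks₁₁ (v i)
        + toEuclideanCLM (𝕜 := ℂ) (S i).toBlocks₁₂ (v ⟨(i : ℤ) + 1, h⟩)
    else toEuclideanCLM (𝕜 := ℂ) Vb.1 (v i)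
  else
    if h : (i : ℤ) - 1 ∈ J then
      toEuclideanCLM (𝕜 := ℂ) (S ((i : ℤ) - 1)).toBlocks₂₁ (v ⟨(i : ℤ) - 1, h⟩)
        + toEuclideanCLM (𝕜 := ℂ) (S ((i : ℤ) - 1)).toBlocks₂₂ (v i)
    else toEuclideanCLM (𝕜 := ℂ) Ub.1 (v i)

/-- The site that is paired with `i` in a layer (`i` itself if there is none in `J`). -/
def partner (J : Set ℤ) (e : ℤ) (i : J) : J :=
  open scoped Classical in
  if Even ((i : ℤ) - e) then
    if h : (i : ℤ) + 1 ∈ J then ⟨(i : ℤ) + 1, h⟩ else i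
  else
    if h : (i : ℤ) - 1 ∈ J then ⟨(i : ℤ) - 1, h⟩ else i

theorem partner_involutive (J : Set ℤ) (e : ℤ) : Function.Involutive (partner J e) := by
  intro i
  have h1 : Even ((i : ℤ) + 1 - e) ↔ ¬ Even ((i : ℤ) - e) := by
    rw [show (i : ℤ) + 1 - e = ((i : ℤ) - e) + 1 by ring, Int.even_add_one]
  have h2 : Even ((i : ℤ) - 1 - e) ↔ ¬ Even ((i : ℤ) - e) := by
    rw [show (i : ℤ) - 1 - e = ((i : ℤ) - e) - 1 by ring, Int.even_sub_one]
  by_cases he : Even ((i : ℤ) - e)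
  · by_cases h : (i : ℤ) + 1 ∈ J
    · simp [partner, he, h, h1]
    · simp [partner, he, h]
  · by_cases h : (i : ℤ) - 1 ∈ J
    · simp [partner, he, h, h2]
    · simp [partner, he, h]

theorem toEuclideanCLM_le {L : ℕ} {A : Matrix (Fin L) (Fin L) ℂ} {C : ℝ} (h : specNorm A ≤ C)
    (x : EuclideanSpace ℂ (Fin L)) : ‖toEuclideanCLM (𝕜 := ℂ) A x‖ ≤ C * ‖x‖ :=
  (ContinuousLinearMap.le_opNorm _ x).trans (mul_le_mul_of_nonneg_right h (norm_nonneg x))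

theorem specNorm_unitary_le {L : ℕ} (U : UL L) : specNorm U.1 ≤ 1 := by
  have h : toEuclideanCLM (n := Fin L) (𝕜 := ℂ) U.1 ∈ unitary _ :=
    Unitary.map_mem (toEuclideanCLM (n := Fin L) (𝕜 := ℂ)) U.2
  refine ContinuousLinearMap.opNorm_le_bound _ zero_le_one fun x => ?_
  rw [one_mul]
  exact (ContinuousLinearMap.norm_map_of_mem_unitary h x).le

theorem layerFun_bound {L : ℕ} {S : ℤ → Matrix (Fin L ⊕ Fin L) (Fin L ⊕ Fin L) ℂ}
    (hS : BddBlocks S) (Ub Vb : UL L) (J : Set ℤ) (e : ℤ) :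
    ∃ C : ℝ, 0 ≤ C ∧ ∀ (v : J → EuclideanSpace ℂ (Fin L)) (i : J),
      ‖layerFun S Ub Vb J e v i‖ ≤ C * (‖v i‖ + ‖v (partner J e i)‖) := by
  obtain ⟨C, hC⟩ := hS
  refine ⟨max C 1, le_trans zero_le_one (le_max_right _ _), fun v i => ?_⟩
  have hm : ∀ (U : UL L) (x : EuclideanSpace ℂ (Fin L)),
      ‖toEuclideanCLM (𝕜 := ℂ) U.1 x‖ ≤ max C 1 * ‖x‖ := fun U x =>
    toEuclideanCLM_le ((specNorm_unitary_le U).trans (le_max_right _ _)) x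
  have h0 : (0 : ℝ) ≤ max C 1 := le_trans zero_le_one (le_max_right _ _)
  unfold layerFun partner
  split_ifs with he h h
  · obtain ⟨a, b, -, -⟩ := hC i
    have ha := toEuclideanCLM_le (a.trans (le_max_left C 1)) (v i)
    have hb := toEuclideanCLM_le (b.trans (le_max_left C 1)) (v ⟨(i : ℤ) + 1, h⟩)
    refine (norm_add_le _ _).trans ?_
    rw [mul_add]
    exact add_le_add ha hb
  · refine (hm Vb (v i)).trans ?_
    nlinarith [norm_nonneg (v i)]
  · obtain ⟨-, -, a, b⟩ := hC ((i : ℤ) - 1)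
    have ha := toEuclideanCLM_le (a.trans (le_max_left C 1)) (v ⟨(i : ℤ) - 1, h⟩)
    have hb := toEuclideanCLM_le (b.trans (le_max_left C 1)) (v i)
    refine (norm_add_le _ _).trans ?_
    rw [mul_add, add_comm (max C 1 * ‖v i‖)]
    exact add_le_add ha hb
  · refine (hm Ub (v i)).trans ?_
    nlinarith [norm_nonneg (v i)]

theorem ell2_of_sq_le {L : ℕ} {J : Set ℤ} {C : ℝ} (h0 : 0 ≤ C) (σ : J ≃ J) (v : Ell2 J L)
    (w : J → EuclideanSpace ℂ (Fin L)) (hw : ∀ i, ‖w i‖ ≤ C * (‖v i‖ + ‖v (σ i)‖)) :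
    ∃ hv : Memℓp w 2, ‖(⟨w, hv⟩ : Ell2 J L)‖ ≤ 2 * C * ‖v‖ := by
  have hp : (0 : ℝ) < (2 : ENNReal).toReal := by norm_num
  have hv2 : Summable fun i => ‖v i‖ ^ 2 := by
    simpa using (lp.memℓp v).summable hp
  have hvs : Summable fun i => ‖v (σ i)‖ ^ 2 :=
    (σ.summable_iff (f := fun i => ‖v i‖ ^ 2)).mpr hv2
  have hts : ∑' i, ‖v (σ i)‖ ^ 2 = ∑' i, ‖v i‖ ^ 2 :=
    σ.tsum_eq (fun i => ‖v i‖ ^ 2)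
  have hle : ∀ i, ‖w i‖ ^ 2 ≤ 2 * C ^ 2 * (‖v i‖ ^ 2 + ‖v (σ i)‖ ^ 2) := fun i => by
    have h1 := pow_le_pow_left₀ (norm_nonneg _) (hw i) 2
    refine h1.trans ?_
    nlinarith [mul_nonneg (sq_nonneg C) (sq_nonneg (‖v i‖ - ‖v (σ i)‖))]
  have hsum : Summable fun i => 2 * C ^ 2 * (‖v i‖ ^ 2 + ‖v (σ i)‖ ^ 2) :=
    (hv2.add hvs).mul_left _
  have hs : Summable fun i => ‖w i‖ ^ 2 :=
    Summable.of_nonneg_of_le (fun i => by positivity) hle hsum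
  have hmem : Memℓp w 2 := memℓp_gen (by simpa using hs)
  refine ⟨hmem, ?_⟩
  have hnv : ‖v‖ ^ 2 = ∑' i, ‖v i‖ ^ 2 := by
    simpa using lp.norm_rpow_eq_tsum hp v
  have hnw : ‖(⟨w, hmem⟩ : Ell2 J L)‖ ^ 2 = ∑' i, ‖w i‖ ^ 2 := by
    simpa using lp.norm_rpow_eq_tsum hp (⟨w, hmem⟩ : Ell2 J L)
  refine le_of_sq_le_sq ?_ (by positivity)
  rw [hnw, mul_pow, hnv]
  calc ∑' i, ‖w i‖ ^ 2
      ≤ ∑' i, 2 * C ^ 2 * (‖v i‖ ^ 2 + ‖v (σ i)‖ ^ 2) := hs.tsum_le_tsum hle hsum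
    _ = (2 * C) ^ 2 * ∑' i, ‖v i‖ ^ 2 := by
      rw [tsum_mul_left, hv2.tsum_add hvs, hts]; ring

theorem layerFun_sq_bound {L : ℕ} {S : ℤ → Matrix (Fin L ⊕ Fin L) (Fin L ⊕ Fin L) ℂ}
    (hS : BddBlocks S) (Ub Vb : UL L) (J : Set ℤ) (e : ℤ) :
    ∃ C : ℝ, ∀ v : Ell2 J L, ∃ hv : Memℓp (layerFun S Ub Vb J e v) 2,
      ‖(⟨layerFun S Ub Vb J e v, hv⟩ : Ell2 J L)‖ ≤ C * ‖v‖ := by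
  obtain ⟨C, h0, hC⟩ := layerFun_bound hS Ub Vb J e
  exact ⟨2 * C, fun v => ell2_of_sq_le h0 (partner_involutive J e).toPerm v _ (hC v)⟩

/-- `layerFun` as a linear map on `ℓ²(J, ℂ^L)`. -/
def layerLin {L : ℕ} (S : ℤ → Matrix (Fin L ⊕ Fin L) (Fin L ⊕ Fin L) ℂ) (hS : BddBlocks S)
    (Ub Vb : UL L) (J : Set ℤ) (e : ℤ) : Ell2 J L →ₗ[ℂ] Ell2 J L where
  toFun v := ⟨layerFun S Ub Vb J e v, by
    obtain ⟨C, h⟩ := layerFun_sq_bound hS Ub Vb J e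
    exact (h v).1⟩
  map_add' v w := by
    ext1
    funext i
    simp only [lp.coeFn_add, Pi.add_apply, layerFun, map_add]
    split_ifs <;> abel
  map_smul' c v := by
    ext1
    funext i
    simp only [lp.coeFn_smul, Pi.smul_apply, layerFun, map_smul, RingHom.id_apply]
    split_ifs <;> simp

/-- `layerFun` as a bounded operator on `ℓ²(J, ℂ^L)`. -/
def layer {L : ℕ} (S : ℤ → Matrix (Fin L ⊕ Fin L) (Fin L ⊕ Fin L) ℂ) (hS : BddBlocks S)
    (Ub Vb : UL L) (J : Set ℤ) (e : ℤ) : Ell2 J L →L[ℂ] Ell2 J L :=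
  (layerLin S hS Ub Vb J e).mkContinuousOfExistsBound (by
    obtain ⟨C, h⟩ := layerFun_sq_bound hS Ub Vb J e
    exact ⟨C, fun v => (h v).2⟩)

/-- The scattering matrix `S^{(n)}_ω`. -/
def randomScat {L : ℕ} (α : Matrix (Fin L) (Fin L) ℂ) (ω : Sample L) (n : ℤ) :
    Matrix (Fin L ⊕ Fin L) (Fin L ⊕ Fin L) ℂ :=
  scat α (phaseU (ω n)) (phaseV (ω n))

theorem specNorm_mul_le {L : ℕ} (A B : Matrix (Fin L) (Fin L) ℂ) :
    specNorm (A * B) ≤ specNorm A * specNorm B := by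
  unfold specNorm
  rw [map_mul]
  exact norm_mul_le _ _

theorem bddBlocks_randomScat {L : ℕ} (α : Matrix (Fin L) (Fin L) ℂ) (ω : Sample L) :
    BddBlocks (randomScat α ω) := by
  have hnn : ∀ A : Matrix (Fin L) (Fin L) ℂ, 0 ≤ specNorm A := fun A => norm_nonneg _
  have hR : ∀ (A : Matrix (Fin L) (Fin L) ℂ) (U : UL L), specNorm (A * U.1) ≤ specNorm A :=
    fun A U => (specNorm_mul_le A U.1).trans
      (mul_le_of_le_one_right (hnn A) (specNorm_unitary_le U))
  have hL : ∀ (A : Matrix (Fin L) (Fin L) ℂ) (U : UL L), specNorm (U.1 * A) ≤ specNorm A :=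
    fun A U => (specNorm_mul_le U.1 A).trans
      (mul_le_of_le_one_left (hnn A) (specNorm_unitary_le U))
  have hneg : ∀ A : Matrix (Fin L) (Fin L) ℂ, specNorm (-A) = specNorm A := fun A => by
    unfold specNorm; rw [map_neg, norm_neg]
  refine ⟨specNorm α + specNorm (rho α) + specNorm (rhoTilde α) + specNorm αᴴ, fun n => ?_⟩
  simp only [randomScat, scat, toBlocks_fromBlocks₁₁, toBlocks_fromBlocks₁₂,
    toBlocks_fromBlocks₂₁, toBlocks_fromBlocks₂₂, hneg]
  have h2 := hR (rho α) (phaseU (ω n))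
  have h3 := hL (rhoTilde α) (phaseV (ω n))
  have h4 := (hR ((phaseV (ω n)).1 * αᴴ) (phaseU (ω n))).trans (hL αᴴ (phaseV (ω n)))
  have := hnn α
  have := hnn (rho α)
  have := hnn (rhoTilde α)
  have := hnn αᴴ
  refine ⟨?_, ?_, ?_, ?_⟩ <;> linarith

/-- The random scattering zipper `𝕌_ω^J = 𝕍_ω^J 𝕎_ω^J` on `ℓ²(J, ℂ^L)`, where `𝕍` is the layer
of the matrices `S^{(n)}_ω` with `n` even and `𝕎` the layer of those with `n` odd. For `J = ℤ`
there is no boundary and this is the operator `𝕌_ω`. -/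
def zipper {L : ℕ} (α : Matrix (Fin L) (Fin L) ℂ) (Ub Vb : UL L) (ω : Sample L) (J : Set ℤ) :
    Ell2 J L →L[ℂ] Ell2 J L :=
  (layer (randomScat α ω) (bddBlocks_randomScat α ω) Ub Vb J 0).comp
    (layer (randomScat α ω) (bddBlocks_randomScat α ω) Ub Vb J 1)

/-- The block `G_ω^J(z, k, l)` of the resolvent `(𝕌_ω^J - z)⁻¹`: its `(p, q)` entry is the
`(k, p)` coordinate of the image of the canonical basis vector `e_{l,q}`. -/
def green {L : ℕ} (α : Matrix (Fin L) (Fin L) ℂ) (Ub Vb : UL L) (ω : Sample L) (J : Set ℤ)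
    (z : ℂ) (k l : J) : Matrix (Fin L) (Fin L) ℂ :=
  Matrix.of fun p q =>
    open scoped Classical in
    (Ring.inverse (zipper α Ub Vb ω J - z • (1 : Ell2 J L →L[ℂ] Ell2 J L))
      (lp.single 2 l (EuclideanSpace.single q (1 : ℂ)))) k p

/-- The set of integers of the interval `[a, b]`, where `a` may be `-∞` and `b` may be `+∞`. -/
def interval (a : WithBot ℤ) (b : WithTop ℤ) : Set ℤ :=
  {n | a ≤ (n : WithBot ℤ) ∧ (n : WithTop ℤ) ≤ b}

/-- The whole lattice: the operator on `interval ⊥ ⊤` is the infinite-volume operator. -/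
theorem interval_bot_top : interval ⊥ ⊤ = Set.univ := by
  ext n
  simp [interval]

/-- The matrix norm subordinate to the norm `N` on `ℂ^L`. -/
def subordinateNorm {L : ℕ} (N : Seminorm ℂ (Fin L → ℂ)) (A : Matrix (Fin L) (Fin L) ℂ) : ℝ :=
  sSup {t : ℝ | ∃ v : Fin L → ℂ, N v ≤ 1 ∧ t = N (A *ᵥ v)}

/-- The annulus `𝕊_ε = {z : 1 - ε < |z| < 1 + ε}`. -/
def annulus (ε : ℝ) : Set ℂ := {z | 1 - ε < ‖z‖ ∧ ‖z‖ < 1 + ε}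

end

end ScatteringZipper

/-!
Fix a bond `(n, n + 1)` and cut the operator there. The scattering matrix at the bond acts on the
sites `n`, `n + 1` only, so the resolvent identity bounds a Green block across the bond by a Green
block of the decoupled operator times `1 + 2 ∑ ‖·‖`, the sum running over the four blocks of
`z (U - z)⁻¹` at the bond. Conservation of the energy flux through the bond and `‖α‖ < 1` reduce
the four blocks to a single diagonal one.

Adding an angle `η` to a uniform phase at one of the two sites does not change the law and leaves
the decoupled Green block alone. Up to a bounded term, and up to the reflection `z ↦ 1 / conj z`,
the quadratic form of the diagonal block at a vector `v` is the value of `w ↦ ⟪v, (1 - w K)⁻¹ v⟫`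
at `w = exp (i η)`, where `‖K‖ < 1`. On the unit disc this function is holomorphic with values in
the half-plane `Re > 0`, where `‖h‖ ^ s ≤ (cos (π s / 2))⁻¹ Re (h ^ s)` for `s < 1`, so that the
mean value property bounds its `s`-moment over the circle by its value at `w = 0`, independently of
everything else. Cutting at both ends of `[k, l]` gives the first-moment comparison of the two
Green blocks for every exponent `s < 1`, and Jensen's inequality the squared one.
-/

namespace ScatteringZipper

open MeasureTheory Matrix Metric
open scoped MatrixOrder InnerProduct InnerProductSpace

section CircleAverage

theorem cos_pi_mul_div_two_pos {s : ℝ} (hs : |s| < 1) : 0 < Real.cos (Real.pi * s / 2) := by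
  obtain ⟨hs₁, hs₂⟩ := abs_lt.mp hs
  exact Real.cos_pos_of_mem_Ioo ⟨by nlinarith [Real.pi_pos], by nlinarith [Real.pi_pos]⟩

theorem norm_rpow_le_re_cpow {w : ℂ} (hw : 0 < w.re) {s : ℝ} (hs : |s| < 1) :
    ‖w‖ ^ s ≤ (Real.cos (Real.pi * s / 2))⁻¹ * (w ^ (s : ℂ)).re := by
  have harg : |w.arg| ≤ Real.pi / 2 := (Complex.abs_arg_lt_pi_div_two_iff.mpr (Or.inl hw)).le
  have hcos : Real.cos (Real.pi * s / 2) ≤ Real.cos (w.arg * s) := by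
    rw [← Real.cos_abs (w.arg * s), ← Real.cos_abs (Real.pi * s / 2), abs_mul, abs_div, abs_mul,
      abs_of_pos Real.pi_pos, abs_two]
    apply Real.cos_le_cos_of_nonneg_of_le_pi (by positivity) <;>
      nlinarith [abs_nonneg s, Real.pi_pos]
  rw [inv_mul_eq_div, le_div_iff₀ (cos_pi_mul_div_two_pos hs), Complex.cpow_ofReal_re]
  gcongr

theorem circleIntegrable_norm_rpow {F : Type*} [NormedAddCommGroup F] {f : ℂ → F} {c : ℂ} {R : ℝ}
    (hf : ContinuousOn f (sphere c |R|)) {s : ℝ} (hs : 0 ≤ s) :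
    CircleIntegrable (fun w => ‖f w‖ ^ s) c R :=
  ContinuousOn.circleIntegrable' (hf.norm.rpow_const fun _ _ => Or.inr hs)

theorem circleAverage_norm_rpow_le {f : ℂ → ℂ} {c : ℂ} {R : ℝ} (hR : 0 < R)
    (hf : DiffContOnCl ℂ f (ball c R)) (hre : ∀ w ∈ closedBall c R, 0 < (f w).re)
    {s : ℝ} (hs0 : 0 ≤ s) (hs1 : s < 1) :
    Real.circleAverage (fun w => ‖f w‖ ^ s) c R ≤
      (Real.cos (Real.pi * s / 2))⁻¹ * ‖f c‖ ^ s := by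
  have hs : |s| < 1 := by rwa [abs_of_nonneg hs0]
  have hcont : ContinuousOn f (closedBall c R) := closure_ball c hR.ne' ▸ hf.continuousOn
  have hsphere : sphere c |R| ⊆ closedBall c R := by
    rw [abs_of_pos hR]
    exact sphere_subset_closedBall
  have hslit : ∀ w ∈ closedBall c R, f w ∈ Complex.slitPlane := fun w hw => Or.inl (hre w hw)
  have hpow_cont : ContinuousOn (fun w => f w ^ (s : ℂ)) (closedBall c R) :=
    hcont.cpow_const hslit
  have hpow : DiffContOnCl ℂ (fun w => f w ^ (s : ℂ)) (ball c |R|) := by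
    rw [abs_of_pos hR]
    exact ⟨hf.differentiableOn.cpow_const fun w hw => hslit w (ball_subset_closedBall hw),
      (closure_ball c hR.ne').symm ▸ hpow_cont⟩
  have hpow_int : CircleIntegrable (fun w => f w ^ (s : ℂ)) c R :=
    (hpow_cont.mono hsphere).circleIntegrable'
  calc Real.circleAverage (fun w => ‖f w‖ ^ s) c R
      ≤ Real.circleAverage
          (fun w => (Real.cos (Real.pi * s / 2))⁻¹ • (f w ^ (s : ℂ)).re) c R := by
        refine Real.circleAverage_mono (circleIntegrable_norm_rpow (hcont.mono hsphere) hs0)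
          (ContinuousOn.circleIntegrable' (continuousOn_const.mul
            (Complex.continuous_re.comp_continuousOn (hpow_cont.mono hsphere))))
          fun w hw => norm_rpow_le_re_cpow (hre w (hsphere hw)) hs
    _ = (Real.cos (Real.pi * s / 2))⁻¹ * (f c ^ (s : ℂ)).re := by
        rw [Real.circleAverage_fun_smul, smul_eq_mul, ← hpow.circleAverage]
        exact congrArg _ (Complex.reCLM.circleAverage_comp_comm hpow_int)
    _ ≤ (Real.cos (Real.pi * s / 2))⁻¹ * ‖f c‖ ^ s := by
        have := cos_pi_mul_div_two_pos hs
        gcongr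
        exact (Complex.re_le_norm _).trans_eq (Complex.norm_cpow_real _ _)

theorem circleAverage_norm_rpow_le_of_lt_re {f : ℂ → ℂ} {c : ℂ} {R : ℝ} (hR : 0 < R)
    (hf : DiffContOnCl ℂ f (ball c R)) {r : ℝ} (hr : 0 ≤ r)
    (hre : ∀ w ∈ closedBall c R, r < (f w).re) {s : ℝ} (hs0 : 0 ≤ s) (hs1 : s < 1) :
    Real.circleAverage (fun w => ‖f w‖ ^ s) c R ≤
      (Real.cos (Real.pi * s / 2))⁻¹ * ‖f c - r‖ ^ s + r ^ s := by
  have hsub : DiffContOnCl ℂ (fun w => f w - r) (ball c R) := hf.sub_const _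
  have hcont : ∀ {g : ℂ → ℂ}, DiffContOnCl ℂ g (ball c R) → ContinuousOn g (sphere c |R|) := by
    intro g hg
    rw [abs_of_pos hR]
    exact (closure_ball c hR.ne' ▸ hg.continuousOn).mono sphere_subset_closedBall
  have hint := circleIntegrable_norm_rpow (hcont hsub) hs0
  have htri : ∀ w, ‖f w‖ ^ s ≤ ‖f w - r‖ ^ s + r ^ s := fun w => by
    refine le_trans ?_ (Real.rpow_add_le_add_rpow (norm_nonneg _) hr hs0 hs1.le)
    gcongr
    simpa [abs_of_nonneg hr] using norm_add_le (f w - r) r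
  calc Real.circleAverage (fun w => ‖f w‖ ^ s) c R
      ≤ Real.circleAverage (fun w => ‖f w - r‖ ^ s + r ^ s) c R :=
        Real.circleAverage_mono (circleIntegrable_norm_rpow (hcont hf) hs0)
          (hint.add (circleIntegrable_const _ _ _)) fun w _ => htri w
    _ = Real.circleAverage (fun w => ‖f w - r‖ ^ s) c R + r ^ s := by
        rw [Real.circleAverage_fun_add hint (circleIntegrable_const _ _ _),
          Real.circleAverage_const]
    _ ≤ (Real.cos (Real.pi * s / 2))⁻¹ * ‖f c - r‖ ^ s + r ^ s := by
        gcongr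
        exact circleAverage_norm_rpow_le hR hsub (fun w hw => by simpa using hre w hw) hs0 hs1

theorem sum_rpow_le {ι : Type*} (t : Finset ι) {f : ι → ℝ} (hf : ∀ i ∈ t, 0 ≤ f i) {s : ℝ}
    (hs0 : 0 < s) (hs1 : s ≤ 1) : (∑ i ∈ t, f i) ^ s ≤ ∑ i ∈ t, f i ^ s := by
  classical
  induction t using Finset.induction_on with
  | empty => simp [hs0.ne']
  | insert a t ha ih =>
    rw [Finset.forall_mem_insert] at hf
    rw [Finset.sum_insert ha, Finset.sum_insert ha]
    exact (Real.rpow_add_le_add_rpow hf.1 (Finset.sum_nonneg hf.2) hs0.le hs1).trans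
      (by gcongr; exact ih hf.2)

end CircleAverage

section Rotation

variable {H E : Type*} [NormedAddCommGroup H] [InnerProductSpace ℂ H] [CompleteSpace H]
  [NormedAddCommGroup E] [InnerProductSpace ℂ E] [CompleteSpace E]

/-- The operator that multiplies the range of the isometry `ι` by `w` and fixes its orthogonal
complement. Isometries are encoded as bounded operators with `ι† ∘L ι = 1`. -/
noncomputable def rot (ι : E →L[ℂ] H) (w : ℂ) : H →L[ℂ] H := 1 + (w - 1) • (ι ∘L ι†)

theorem rot_apply (ι : E →L[ℂ] H) (w : ℂ) (x : H) :
    rot ι w x = x + (w - 1) • ι ((ι†) x) := by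
  simp [rot]

theorem rot_one (ι : E →L[ℂ] H) : rot ι 1 = 1 := by simp [rot]

theorem adjoint_apply_self {ι : E →L[ℂ] H} (hι : ι† ∘L ι = 1) (a : E) : (ι†) (ι a) = a := by
  simpa using DFunLike.congr_fun hι a

theorem adjoint_rot_apply {ι : E →L[ℂ] H} (hι : ι† ∘L ι = 1) (w : ℂ) (x : H) :
    (ι†) (rot ι w x) = w • (ι†) x := by
  rw [rot_apply, map_add, map_smul, adjoint_apply_self hι, sub_smul, one_smul]
  abel

theorem norm_isometry_apply {ι : E →L[ℂ] H} (hι : ι† ∘L ι = 1) (a : E) : ‖ι a‖ = ‖a‖ :=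
  (ContinuousLinearMap.norm_map_iff_adjoint_comp_self ι).mpr hι a

theorem norm_isometry_le_one {ι : E →L[ℂ] H} (hι : ι† ∘L ι = 1) : ‖ι‖ ≤ 1 :=
  ContinuousLinearMap.opNorm_le_bound _ zero_le_one fun a => by
    rw [norm_isometry_apply hι, one_mul]

theorem norm_adjoint_apply_le {ι : E →L[ℂ] H} (hι : ι† ∘L ι = 1) (x : H) : ‖(ι†) x‖ ≤ ‖x‖ := by
  refine (ContinuousLinearMap.le_of_opNorm_le _ ?_ x).trans_eq (one_mul _)
  rw [LinearIsometryEquiv.norm_map]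
  exact norm_isometry_le_one hι

theorem norm_rot_sq {ι : E →L[ℂ] H} (hι : ι† ∘L ι = 1) (w : ℂ) (x : H) :
    ‖rot ι w x‖ ^ 2 = ‖x - ι ((ι†) x)‖ ^ 2 + ‖w‖ ^ 2 * ‖(ι†) x‖ ^ 2 := by
  have hdecomp : rot ι w x = (x - ι ((ι†) x)) + w • ι ((ι†) x) := by
    rw [rot_apply, sub_smul, one_smul]; abel
  have horth : ⟪x - ι ((ι†) x), w • ι ((ι†) x)⟫_ℂ = 0 := by
    rw [inner_smul_right, ← ContinuousLinearMap.adjoint_inner_left, map_sub,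
      adjoint_apply_self hι]
    simp
  rw [hdecomp, sq, norm_add_sq_eq_norm_sq_add_norm_sq_of_inner_eq_zero _ _ horth, norm_smul,
    norm_isometry_apply hι]
  ring

theorem norm_rot_apply_le {ι : E →L[ℂ] H} (hι : ι† ∘L ι = 1) {w : ℂ} (hw : ‖w‖ ≤ 1) (x : H) :
    ‖rot ι w x‖ ≤ ‖x‖ := by
  have hone := norm_rot_sq hι 1 x
  rw [rot_one, norm_one, one_apply_eq_self] at hone
  refine le_of_sq_le_sq ?_ (norm_nonneg _)
  rw [norm_rot_sq hι, hone]
  gcongr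

theorem norm_rot_mul_le {ι : E →L[ℂ] H} (hι : ι† ∘L ι = 1) {w : ℂ} (hw : ‖w‖ ≤ 1)
    (K : H →L[ℂ] H) : ‖rot ι w * K‖ ≤ ‖K‖ :=
  ContinuousLinearMap.opNorm_le_bound _ (norm_nonneg _) fun x =>
    (norm_rot_apply_le hι hw _).trans (K.le_opNorm x)

theorem rot_mul_rot {ι : E →L[ℂ] H} (hι : ι† ∘L ι = 1) (w w' : ℂ) :
    rot ι w * rot ι w' = rot ι (w * w') := by
  ext x
  rw [mul_apply_eq_comp, rot_apply, adjoint_rot_apply hι, rot_apply, rot_apply,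
    map_smul]
  module

theorem star_rot (ι : E →L[ℂ] H) (w : ℂ) : star (rot ι w) = rot ι (star w) := by
  rw [rot, rot, star_add, star_one, star_smul, star_sub, star_one]
  congr 2
  rw [ContinuousLinearMap.star_eq_adjoint, ContinuousLinearMap.adjoint_comp,
    ContinuousLinearMap.adjoint_adjoint]

theorem rot_mem_unitary {ι : E →L[ℂ] H} (hι : ι† ∘L ι = 1) {w : ℂ} (hw : ‖w‖ = 1) :
    rot ι w ∈ unitary (H →L[ℂ] H) := by
  have hw' : w * star w = 1 := by
    rw [Complex.star_def, Complex.mul_conj, Complex.normSq_eq_norm_sq, hw]; simp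
  rw [Unitary.mem_iff, star_rot, rot_mul_rot hι, rot_mul_rot hι, mul_comm (star w), hw', rot_one]
  exact ⟨rfl, rfl⟩

theorem differentiable_rot (ι : E →L[ℂ] H) : Differentiable ℂ (rot ι) := by
  unfold rot
  fun_prop

end Rotation

section CircleInverse

variable {H E : Type*} [NormedAddCommGroup H] [InnerProductSpace ℂ H]

theorem inverse_one_sub_apply {A : H →L[ℂ] H} (hA : IsUnit (1 - A)) (v : H) :
    Ring.inverse (1 - A) v - A (Ring.inverse (1 - A) v) = v := by
  simpa using DFunLike.congr_fun (Ring.mul_inverse_cancel _ hA) v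

theorem re_inner_sub_add (x y : H) : (⟪x - y, x + y⟫_ℂ).re = ‖x‖ ^ 2 - ‖y‖ ^ 2 := by
  have hx : (⟪x, x⟫_ℂ).re = ‖x‖ ^ 2 := inner_self_eq_norm_sq (𝕜 := ℂ) x
  have hy : (⟪y, y⟫_ℂ).re = ‖y‖ ^ 2 := inner_self_eq_norm_sq (𝕜 := ℂ) y
  have hxy : (⟪y, x⟫_ℂ).re = (⟪x, y⟫_ℂ).re := by rw [← inner_conj_symm, Complex.conj_re]
  simp only [inner_sub_left, inner_add_right, Complex.add_re, Complex.sub_re, hx, hy, hxy]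
  ring

variable [CompleteSpace H] [NormedAddCommGroup E] [InnerProductSpace ℂ E] [CompleteSpace E]

theorem half_norm_sq_lt_re_inner_inverse {A : H →L[ℂ] H} (hA : ‖A‖ < 1) {v : H} (hv : v ≠ 0) :
    ‖v‖ ^ 2 / 2 < (⟪v, Ring.inverse (1 - A) v⟫_ℂ).re := by
  set x := Ring.inverse (1 - A) v
  have hxv : x - A x = v := inverse_one_sub_apply (isUnit_one_sub_of_norm_lt_one hA) v
  have hx : x ≠ 0 := by
    intro h
    exact hv (by simpa [h] using hxv.symm)
  have hcayley : 2 * (⟪v, x⟫_ℂ).re - ‖v‖ ^ 2 = (⟪x - A x, x + A x⟫_ℂ).re := by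
    have hv2 : (⟪v, v⟫_ℂ).re = ‖v‖ ^ 2 := inner_self_eq_norm_sq (𝕜 := ℂ) v
    rw [← hv2, show x + A x = (x + x) - v by rw [← hxv]; abel, hxv, inner_sub_right,
      inner_add_right, Complex.sub_re, Complex.add_re, two_mul]
  have hAx : ‖A x‖ ^ 2 < ‖x‖ ^ 2 := by
    have : ‖A x‖ < ‖x‖ :=
      (A.le_opNorm x).trans_lt (mul_lt_of_lt_one_left (norm_pos_iff.mpr hx) hA)
    gcongr
  rw [re_inner_sub_add] at hcayley
  linarith

theorem differentiableAt_inverse_one_sub_rot_mul {ι : E →L[ℂ] H} (hι : ι† ∘L ι = 1)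
    {K : H →L[ℂ] H} (hK : ‖K‖ < 1) {w : ℂ} (hw : ‖w‖ ≤ 1) :
    DifferentiableAt ℂ (fun w => Ring.inverse (1 - rot ι w * K)) w := by
  have hrot := differentiable_rot ι
  refine DifferentiableAt.inverse (by fun_prop) ?_
  exact isUnit_one_sub_of_norm_lt_one ((norm_rot_mul_le hι hw K).trans_lt hK)

theorem inner_inverse_one_sub_rot_zero_mul {ι : E →L[ℂ] H} (hι : ι† ∘L ι = 1) {K : H →L[ℂ] H}
    (hK : ‖K‖ < 1) (a : E) :
    ⟪ι a, Ring.inverse (1 - rot ι 0 * K) (ι a)⟫_ℂ = ((‖a‖ ^ 2 : ℝ) : ℂ) := by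
  have hunit : IsUnit (1 - rot ι 0 * K) :=
    isUnit_one_sub_of_norm_lt_one ((norm_rot_mul_le hι (by simp) K).trans_lt hK)
  have hrange := congrArg (ι†) (inverse_one_sub_apply hunit (ι a))
  rw [map_sub, mul_apply_eq_comp, adjoint_rot_apply hι, zero_smul, sub_zero,
    adjoint_apply_self hι] at hrange
  rw [← ContinuousLinearMap.adjoint_inner_right, hrange, inner_self_eq_norm_sq_to_K]
  norm_cast

theorem circleAverage_norm_inner_inverse_rpow_le {ι : E →L[ℂ] H} (hι : ι† ∘L ι = 1)
    {K : H →L[ℂ] H} (hK : ‖K‖ < 1) {s : ℝ} (hs0 : 0 < s) (hs1 : s < 1) (a : E) :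
    Real.circleAverage
      (fun w => ‖⟪ι a, Ring.inverse (1 - rot ι w * K) (ι a)⟫_ℂ‖ ^ s) 0 1 ≤
      ((Real.cos (Real.pi * s / 2))⁻¹ + 1) * (‖a‖ ^ 2 / 2) ^ s := by
  rcases eq_or_ne a 0 with rfl | ha
  · simp [hs0.ne', Real.circleAverage_const]
  have hιa : ι a ≠ 0 := by rwa [← norm_ne_zero_iff, norm_isometry_apply hι, norm_ne_zero_iff]
  have hdiff : DiffContOnCl ℂ (fun w => ⟪ι a, Ring.inverse (1 - rot ι w * K) (ι a)⟫_ℂ)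
      (ball 0 1) := by
    refine DifferentiableOn.diffContOnCl fun w hw => ?_
    rw [closure_ball _ one_ne_zero, mem_closedBall_zero_iff] at hw
    have hinv := (differentiableAt_inverse_one_sub_rot_mul hι hK hw).clm_apply
      (differentiableAt_const (ι a))
    exact ((innerSL ℂ (ι a)).differentiableAt.comp w hinv).differentiableWithinAt
  have hre : ∀ w ∈ closedBall (0 : ℂ) 1,
      ‖a‖ ^ 2 / 2 < (⟪ι a, Ring.inverse (1 - rot ι w * K) (ι a)⟫_ℂ).re := fun w hw => by
    rw [← norm_isometry_apply hι a]
    exact half_norm_sq_lt_re_inner_inverse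
      ((norm_rot_mul_le hι (by simpa using hw) K).trans_lt hK) hιa
  have hcenter : ‖⟪ι a, Ring.inverse (1 - rot ι 0 * K) (ι a)⟫_ℂ - ((‖a‖ ^ 2 / 2 : ℝ) : ℂ)‖
      = ‖a‖ ^ 2 / 2 := by
    rw [inner_inverse_one_sub_rot_zero_mul hι hK, ← Complex.ofReal_sub, sub_half,
      Complex.norm_real, Real.norm_of_nonneg (by positivity)]
  have hmain := circleAverage_norm_rpow_le_of_lt_re one_pos hdiff (by positivity) hre hs0.le hs1
  rw [hcenter] at hmain
  exact hmain.trans_eq (by ring)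

end CircleInverse

section Resolvent

variable {H E : Type*} [NormedAddCommGroup H] [InnerProductSpace ℂ H] [CompleteSpace H]
  [NormedAddCommGroup E] [InnerProductSpace ℂ E] [CompleteSpace E]

/-- The resolvent `(U - z)⁻¹`. -/
noncomputable def res (U : H →L[ℂ] H) (z : ℂ) : H →L[ℂ] H := Ring.inverse (U - z • 1)

variable {U : H →L[ℂ] H} {z : ℂ}

theorem norm_apply_of_mem_unitary (hU : U ∈ unitary (H →L[ℂ] H)) (x : H) : ‖U x‖ = ‖x‖ :=
  ContinuousLinearMap.norm_map_of_mem_unitary hU x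

theorem norm_le_one_of_mem_unitary (hU : U ∈ unitary (H →L[ℂ] H)) : ‖U‖ ≤ 1 :=
  ContinuousLinearMap.opNorm_le_bound _ zero_le_one fun x => by
    rw [norm_apply_of_mem_unitary hU, one_mul]

theorem norm_inv_star_ne_one (hz : ‖z‖ ≠ 1) : ‖(star z)⁻¹‖ ≠ 1 := by
  rwa [norm_inv, norm_star, ne_eq, inv_eq_one]

theorem isUnit_sub_smul (hU : U ∈ unitary (H →L[ℂ] H)) (hz : ‖z‖ ≠ 1) :
    IsUnit (U - z • 1) := by
  have hspec : z ∉ spectrum ℂ U := fun h => hz (by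
    simpa using spectrum.subset_circle_of_unitary hU h)
  have hunit := spectrum.notMem_iff.mp hspec
  rw [Algebra.algebraMap_eq_smul_one] at hunit
  simpa using hunit.neg

theorem res_mul (hU : U ∈ unitary (H →L[ℂ] H)) (hz : ‖z‖ ≠ 1) : res U z * (U - z • 1) = 1 :=
  Ring.inverse_mul_cancel _ (isUnit_sub_smul hU hz)

theorem mul_res (hU : U ∈ unitary (H →L[ℂ] H)) (hz : ‖z‖ ≠ 1) : (U - z • 1) * res U z = 1 :=
  Ring.mul_inverse_cancel _ (isUnit_sub_smul hU hz)

theorem eq_res_of_mul {R : H →L[ℂ] H} (hU : U ∈ unitary (H →L[ℂ] H)) (hz : ‖z‖ ≠ 1)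
    (h : (U - z • 1) * R = 1) : R = res U z := by
  rw [← one_mul R, ← res_mul hU hz, mul_assoc, h, mul_one]

theorem mul_res_eq (hU : U ∈ unitary (H →L[ℂ] H)) (hz : ‖z‖ ≠ 1) :
    U * res U z = 1 + z • res U z := by
  have h := mul_res hU hz
  rwa [sub_mul, smul_mul_assoc, one_mul, sub_eq_iff_eq_add] at h

theorem res_mul_eq (hU : U ∈ unitary (H →L[ℂ] H)) (hz : ‖z‖ ≠ 1) :
    res U z * U = 1 + z • res U z := by
  have h := res_mul hU hz
  rwa [mul_sub, mul_smul_comm, mul_one, sub_eq_iff_eq_add] at h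

theorem map_res_apply (hU : U ∈ unitary (H →L[ℂ] H)) (hz : ‖z‖ ≠ 1) (x : H) :
    U (res U z x) = z • res U z x + x := by
  simpa [add_comm] using DFunLike.congr_fun (mul_res_eq hU hz) x

theorem res_map_apply (hU : U ∈ unitary (H →L[ℂ] H)) (hz : ‖z‖ ≠ 1) (x : H) :
    res U z (U x) = z • res U z x + x := by
  simpa [add_comm] using DFunLike.congr_fun (res_mul_eq hU hz) x

theorem norm_res_apply_le (hU : U ∈ unitary (H →L[ℂ] H)) (hz : ‖z‖ ≠ 1) (x : H) :
    ‖res U z x‖ ≤ |‖z‖ - 1|⁻¹ * ‖x‖ := by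
  have hx : U (res U z x) - z • res U z x = x := sub_eq_iff_eq_add'.mpr (map_res_apply hU hz x)
  have hlower : |‖z‖ - 1| * ‖res U z x‖ ≤ ‖x‖ := by
    have h := abs_norm_sub_norm_le (U (res U z x)) (z • res U z x)
    rw [hx, norm_apply_of_mem_unitary hU, norm_smul, ← one_sub_mul, abs_mul, abs_norm] at h
    rwa [abs_sub_comm]
  have hpos : 0 < |‖z‖ - 1| := abs_pos.mpr (sub_ne_zero.mpr hz)
  rwa [inv_mul_eq_div, le_div_iff₀ hpos, mul_comm]

theorem star_res (hU : U ∈ unitary (H →L[ℂ] H)) (hz : ‖z‖ ≠ 1) :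
    star (res U z) = res (star U) (star z) := by
  refine eq_res_of_mul (Unitary.star_mem hU) (by rwa [norm_star]) ?_
  simpa using congrArg star (res_mul hU hz)

theorem one_add_smul_res (hU : U ∈ unitary (H →L[ℂ] H)) (hz : ‖z‖ ≠ 1) (hz0 : z ≠ 0) :
    1 + z • res U z = -star ((star z)⁻¹ • res U (star z)⁻¹) := by
  have hstar : star (star z)⁻¹ = z⁻¹ := by rw [star_inv₀, star_star]
  have hadj : star (res U (star z)⁻¹) * (star U - z⁻¹ • 1) = 1 := by
    simpa [hstar] using congrArg star (mul_res hU (norm_inv_star_ne_one hz))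
  have hmul : (star U - z⁻¹ • 1) * U = -(z⁻¹ • (U - z • 1)) := by
    rw [sub_mul, (Unitary.mem_iff.mp hU).1, smul_mul_assoc, one_mul, smul_sub, smul_smul,
      inv_mul_cancel₀ hz0, one_smul, neg_sub]
  have hreflect : star ((star z)⁻¹ • res U (star z)⁻¹) * (U - z • 1) = -U := by
    rw [star_smul, hstar, smul_mul_assoc, ← mul_smul_comm, ← neg_neg (z⁻¹ • (U - z • 1)), ← hmul,
      mul_neg, ← mul_assoc, hadj, one_mul]
  rw [← mul_res_eq hU hz, ← neg_eq_iff_eq_neg, ← neg_mul, ← hreflect, mul_assoc, mul_res hU hz,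
    mul_one]

theorem smul_res_eq (hU : U ∈ unitary (H →L[ℂ] H)) (hz : ‖z‖ ≠ 1) (hz0 : z ≠ 0) :
    z • res U z = -Ring.inverse (1 - z⁻¹ • U) := by
  have hmul : (1 - z⁻¹ • U) * (z • res U z) = -1 := by
    rw [mul_smul_comm, ← smul_mul_assoc, smul_sub, smul_smul, mul_inv_cancel₀ hz0, one_smul,
      ← neg_sub, neg_mul, mul_res hU hz]
  have hunit : IsUnit (1 - z⁻¹ • U) := by
    have hfactor : 1 - z⁻¹ • U = -(z⁻¹ • (U - z • 1)) := by
      rw [smul_sub, smul_smul, inv_mul_cancel₀ hz0, one_smul, neg_sub]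
    rw [hfactor]
    exact ((isUnit_sub_smul hU hz).smul (Units.mk0 z⁻¹ (inv_ne_zero hz0))).neg
  rw [← mul_one (Ring.inverse _), ← mul_neg, ← hmul, Ring.inverse_mul_cancel_left _ _ hunit]

/-- The block of `z (U - z)⁻¹` from the range of `κ` to the range of `ι`. The factor `z` makes the
bounds for the blocks uniform in `z`, also near `z = 0`. -/
noncomputable def resBlock (U : H →L[ℂ] H) (z : ℂ) (ι κ : E →L[ℂ] H) : E →L[ℂ] E :=
  ι† ∘L (z • res U z) ∘L κ

theorem resBlock_apply (U : H →L[ℂ] H) (z : ℂ) (ι κ : E →L[ℂ] H) (a : E) :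
    resBlock U z ι κ a = z • (ι†) (res U z (κ a)) := by simp [resBlock]

theorem adjoint_comp_comp (ι κ : E →L[ℂ] H) (A : H →L[ℂ] H) :
    (ι† ∘L A ∘L κ)† = κ† ∘L star A ∘L ι := by
  rw [ContinuousLinearMap.adjoint_comp, ContinuousLinearMap.adjoint_comp,
    ContinuousLinearMap.adjoint_adjoint, ContinuousLinearMap.star_eq_adjoint]
  rfl

theorem comp_add_resBlock (hU : U ∈ unitary (H →L[ℂ] H)) (hz : ‖z‖ ≠ 1) (hz0 : z ≠ 0)
    (ι κ : E →L[ℂ] H) :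
    ι† ∘L κ + resBlock U z ι κ = -(resBlock U (star z)⁻¹ κ ι)† := by
  rw [resBlock, resBlock, adjoint_comp_comp, ← neg_eq_iff_eq_neg.mpr (one_add_smul_res hU hz hz0)]
  ext x
  simp

theorem resBlock_eq_of_one_lt (hU : U ∈ unitary (H →L[ℂ] H)) (hz : 1 < ‖z‖) (ι κ : E →L[ℂ] H) :
    resBlock U z ι κ = -(ι† ∘L Ring.inverse (1 - z⁻¹ • U) ∘L κ) := by
  have hz0 : z ≠ 0 := norm_pos_iff.mp (one_pos.trans hz)
  rw [resBlock, smul_res_eq hU hz.ne' hz0]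
  ext x
  simp

theorem exists_norm_resBlock_self_le {ι : E →L[ℂ] H} (hι : ι† ∘L ι = 1) (hz : ‖z‖ ≠ 1) :
    ∃ c : ℂ, ‖c‖ < 1 ∧ ∀ U ∈ unitary (H →L[ℂ] H),
      ‖resBlock U z ι ι‖ ≤ ‖ι† ∘L Ring.inverse (1 - c • U) ∘L ι‖ + 1 := by
  rcases lt_or_gt_of_ne hz with hlt | hgt
  · refine ⟨star z, by rwa [norm_star], fun U hU => ?_⟩
    rcases eq_or_ne z 0 with rfl | hz0
    · simp only [resBlock, zero_smul, ContinuousLinearMap.zero_comp,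
        ContinuousLinearMap.comp_zero, norm_zero]
      positivity
    have hζ : 1 < ‖(star z)⁻¹‖ := by
      rw [norm_inv, norm_star]
      exact (one_lt_inv₀ (norm_pos_iff.mpr hz0)).mpr hlt
    have hrefl := comp_add_resBlock hU hz hz0 ι ι
    rw [hι, ← eq_sub_iff_add_eq'] at hrefl
    calc ‖resBlock U z ι ι‖ ≤ ‖resBlock U (star z)⁻¹ ι ι‖ + ‖(1 : E →L[ℂ] E)‖ := by
          rw [hrefl]
          exact (norm_sub_le _ _).trans_eq (by rw [norm_neg, LinearIsometryEquiv.norm_map])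
      _ ≤ ‖ι† ∘L Ring.inverse (1 - star z • U) ∘L ι‖ + 1 := by
          rw [resBlock_eq_of_one_lt hU hζ, inv_inv, norm_neg]
          gcongr
          exact ContinuousLinearMap.norm_id_le
  · refine ⟨z⁻¹, by rw [norm_inv]; exact inv_lt_one_of_one_lt₀ hgt, fun U hU => ?_⟩
    rw [resBlock_eq_of_one_lt hU hgt, norm_neg]
    linarith

theorem continuousOn_res {X : Type*} [TopologicalSpace X] {V : X → H →L[ℂ] H} {S : Set X}
    (hV : ContinuousOn V S) (hmem : ∀ x ∈ S, V x ∈ unitary (H →L[ℂ] H)) (hz : ‖z‖ ≠ 1) :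
    ContinuousOn (fun x => res (V x) z) S := fun x hx => by
  obtain ⟨u, hu⟩ := isUnit_sub_smul (hmem x hx) hz
  have hinv : ContinuousAt Ring.inverse (V x - z • 1) := hu ▸ NormedRing.inverse_continuousAt u
  exact ContinuousAt.comp_continuousWithinAt (f := fun x => V x - z • 1) hinv
    ((hV x hx).sub continuousWithinAt_const)

theorem continuousOn_resBlock {X : Type*} [TopologicalSpace X] {V : X → H →L[ℂ] H} {S : Set X}
    (hV : ContinuousOn V S) (hmem : ∀ x ∈ S, V x ∈ unitary (H →L[ℂ] H)) (hz : ‖z‖ ≠ 1)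
    (ι κ : E →L[ℂ] H) : ContinuousOn (fun x => resBlock (V x) z ι κ) S := by
  have hres := continuousOn_res hV hmem hz
  unfold resBlock
  fun_prop

end Resolvent

section Polarization

variable {E d : Type*} [NormedAddCommGroup E] [InnerProductSpace ℂ E] [Fintype d]

theorem opNorm_le_sum_norm_inner (b : OrthonormalBasis d ℂ E) (M : E →L[ℂ] E) :
    ‖M‖ ≤ ∑ i, ∑ j, ‖⟪b i, M (b j)⟫_ℂ‖ := by
  refine ContinuousLinearMap.opNorm_le_bound _ (by positivity) fun x => ?_
  have hcoord : ∀ y : E, ‖y‖ ≤ ∑ i, ‖⟪b i, y⟫_ℂ‖ := fun y => by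
    conv_lhs => rw [← b.sum_repr' y]
    exact (norm_sum_le _ _).trans_eq (by simp [norm_smul])
  have hbx : ∀ j, ‖⟪b j, x⟫_ℂ‖ ≤ ‖x‖ := fun j =>
    (norm_inner_le_norm _ _).trans_eq (by simp)
  calc ‖M x‖ = ‖∑ j, ⟪b j, x⟫_ℂ • M (b j)‖ := by
        conv_lhs => rw [← b.sum_repr' x]
        simp only [map_sum, map_smul]
    _ ≤ ∑ j, ‖x‖ * ∑ i, ‖⟪b i, M (b j)⟫_ℂ‖ := by
        refine (norm_sum_le _ _).trans (Finset.sum_le_sum fun j _ => ?_)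
        rw [norm_smul]
        exact mul_le_mul (hbx j) (hcoord _) (norm_nonneg _) (norm_nonneg _)
    _ = (∑ i, ∑ j, ‖⟪b i, M (b j)⟫_ℂ‖) * ‖x‖ := by
        rw [← Finset.mul_sum, Finset.sum_comm, mul_comm]

/-- The vectors `b i + I ^ k • b j` from which the polarization identity recovers the matrix
entry `(i, j)` of an operator. -/
noncomputable def polVec (b : OrthonormalBasis d ℂ E) (t : d × d × Fin 4) : E :=
  b t.1 + Complex.I ^ (t.2.2 : ℕ) • b t.2.1

theorem norm_polVec_le (b : OrthonormalBasis d ℂ E) (t : d × d × Fin 4) : ‖polVec b t‖ ≤ 2 := by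
  refine (norm_add_le _ _).trans ?_
  rw [norm_smul]
  simp only [OrthonormalBasis.norm_eq_one, norm_pow, Complex.norm_I, one_pow]
  norm_num

theorem norm_inner_le_sum_polVec (b : OrthonormalBasis d ℂ E) (M : E →L[ℂ] E) (i j : d) :
    ‖⟪b i, M (b j)⟫_ℂ‖ ≤ ∑ k : Fin 4, ‖⟪polVec b (i, j, k), M (polVec b (i, j, k))⟫_ℂ‖ := by
  have hpol : 4 * ⟪b i, M (b j)⟫_ℂ = ∑ k : Fin 4,
      (-Complex.I) ^ (k : ℕ) * ⟪polVec b (i, j, k), M (polVec b (i, j, k))⟫_ℂ := by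
    simp only [polVec, Fin.sum_univ_four]
    simp [inner_add_left, inner_smul_left, inner_smul_right, pow_succ]
    ring_nf
    simp
    ring
  have hnorm : ‖(4 : ℂ) * ⟪b i, M (b j)⟫_ℂ‖ ≤
      ∑ k : Fin 4, ‖⟪polVec b (i, j, k), M (polVec b (i, j, k))⟫_ℂ‖ := by
    rw [hpol]
    exact (norm_sum_le _ _).trans_eq (by simp)
  rw [norm_mul, Complex.norm_ofNat] at hnorm
  linarith [norm_nonneg ⟪b i, M (b j)⟫_ℂ]

theorem opNorm_le_sum_polVec (b : OrthonormalBasis d ℂ E) (M : E →L[ℂ] E) :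
    ‖M‖ ≤ ∑ t, ‖⟪polVec b t, M (polVec b t)⟫_ℂ‖ := by
  simp only [Fintype.sum_prod_type]
  refine (opNorm_le_sum_norm_inner b M).trans ?_
  gcongr with i _ j
  exact norm_inner_le_sum_polVec b M i j

end Polarization

section FractionalMoment

variable {H E : Type*} [NormedAddCommGroup H] [InnerProductSpace ℂ H] [CompleteSpace H]
  [NormedAddCommGroup E] [InnerProductSpace ℂ E] [FiniteDimensional ℂ E]

/-- The bound for the circle average of the `s`-th power of the norm of a block of dimension `n`;
there are `4 n ^ 2` polarization vectors. -/
noncomputable def fracConst (n : ℕ) (s : ℝ) : ℝ :=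
  4 * n ^ 2 * (((Real.cos (Real.pi * s / 2))⁻¹ + 1) * 2 ^ s) + 1

theorem fracConst_nonneg (n : ℕ) {s : ℝ} (hs0 : 0 < s) (hs1 : s < 1) : 0 ≤ fracConst n s := by
  have := cos_pi_mul_div_two_pos (abs_lt.mpr ⟨by linarith, hs1⟩)
  unfold fracConst
  positivity

theorem norm_block_rpow_le_sum_polVec {d : Type*} [Fintype d] (b : OrthonormalBasis d ℂ E)
    {ι : E →L[ℂ] H} {R A : H →L[ℂ] H} (h : ‖ι† ∘L R ∘L ι‖ ≤ ‖ι† ∘L A ∘L ι‖ + 1)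
    {s : ℝ} (hs0 : 0 < s) (hs1 : s ≤ 1) :
    ‖ι† ∘L R ∘L ι‖ ^ s ≤ ∑ t, ‖⟪ι (polVec b t), A (ι (polVec b t))⟫_ℂ‖ ^ s + 1 := by
  calc ‖ι† ∘L R ∘L ι‖ ^ s ≤ (‖ι† ∘L A ∘L ι‖ + 1) ^ s := by gcongr
    _ ≤ ‖ι† ∘L A ∘L ι‖ ^ s + 1 := by
        simpa using Real.rpow_add_le_add_rpow (norm_nonneg _) zero_le_one hs0.le hs1
    _ ≤ (∑ t, ‖⟪polVec b t, (ι† ∘L A ∘L ι) (polVec b t)⟫_ℂ‖) ^ s + 1 := by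
        gcongr
        exact opNorm_le_sum_polVec b _
    _ ≤ ∑ t, ‖⟪polVec b t, (ι† ∘L A ∘L ι) (polVec b t)⟫_ℂ‖ ^ s + 1 := by
        gcongr
        exact sum_rpow_le _ (fun _ _ => norm_nonneg _) hs0 hs1
    _ = _ := by simp only [ContinuousLinearMap.comp_apply, ContinuousLinearMap.adjoint_inner_right]

theorem circleIntegrable_norm_inner_inverse_rpow {ι : E →L[ℂ] H} (hι : ι† ∘L ι = 1)
    {K : H →L[ℂ] H} (hK : ‖K‖ < 1) {s : ℝ} (hs : 0 ≤ s) (a : E) :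
    CircleIntegrable (fun w => ‖⟪ι a, Ring.inverse (1 - rot ι w * K) (ι a)⟫_ℂ‖ ^ s) 0 1 := by
  refine circleIntegrable_norm_rpow (fun w hw => ContinuousAt.continuousWithinAt ?_) hs
  have hinv := differentiableAt_inverse_one_sub_rot_mul hι hK (w := w) (by simp_all)
  exact continuousAt_const.inner (hinv.continuousAt.clm_apply continuousAt_const)

theorem circleAverage_norm_resBlock_self_rpow_le {ι : E →L[ℂ] H} (hι : ι† ∘L ι = 1)
    {U : H →L[ℂ] H} (hU : U ∈ unitary (H →L[ℂ] H)) {z : ℂ} (hz : ‖z‖ ≠ 1) {s : ℝ} (hs0 : 0 < s)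
    (hs1 : s < 1) :
    Real.circleAverage (fun w => ‖resBlock (rot ι w * U) z ι ι‖ ^ s) 0 1 ≤
      fracConst (Module.finrank ℂ E) s := by
  have hcos := cos_pi_mul_div_two_pos (abs_lt.mpr ⟨by linarith, hs1⟩)
  obtain ⟨c, hc, hle⟩ := exists_norm_resBlock_self_le hι hz
  set b := stdOrthonormalBasis ℂ E
  have hK : ‖c • U‖ < 1 := by
    rw [norm_smul]
    exact (mul_le_of_le_one_right (norm_nonneg c) (norm_le_one_of_mem_unitary hU)).trans_lt hc
  set f := fun t w => ⟪ι (polVec b t), Ring.inverse (1 - rot ι w * c • U) (ι (polVec b t))⟫_ℂ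
  have hf : ∀ t, CircleIntegrable (fun w => ‖f t w‖ ^ s) 0 1 := fun t =>
    circleIntegrable_norm_inner_inverse_rpow hι hK hs0.le _
  have hmem : ∀ w ∈ sphere (0 : ℂ) |1|, rot ι w * U ∈ unitary (H →L[ℂ] H) := fun w hw =>
    mul_mem (rot_mem_unitary hι (by simpa using hw)) hU
  have hcont : ContinuousOn (fun w => rot ι w * U) (sphere 0 |1|) :=
    ((differentiable_rot ι).continuous.mul continuous_const).continuousOn
  have hpoint : ∀ w ∈ sphere (0 : ℂ) |1|, ‖resBlock (rot ι w * U) z ι ι‖ ^ s ≤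
      ∑ t, ‖f t w‖ ^ s + 1 := fun w hw => by
    have hcontr := hle _ (hmem w hw)
    rw [← mul_smul_comm] at hcontr
    exact norm_block_rpow_le_sum_polVec b hcontr hs0 hs1.le
  have hsum : CircleIntegrable (fun w => ∑ t, ‖f t w‖ ^ s) 0 1 :=
    CircleIntegrable.fun_sum _ fun t _ => hf t
  calc Real.circleAverage (fun w => ‖resBlock (rot ι w * U) z ι ι‖ ^ s) 0 1
      ≤ Real.circleAverage (fun w => ∑ t, ‖f t w‖ ^ s + 1) 0 1 :=
        Real.circleAverage_mono
          (circleIntegrable_norm_rpow (continuousOn_resBlock hcont hmem hz ι ι) hs0.le)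
          (hsum.add (circleIntegrable_const _ _ _)) hpoint
    _ = ∑ t, Real.circleAverage (fun w => ‖f t w‖ ^ s) 0 1 + 1 := by
        rw [Real.circleAverage_fun_add hsum (circleIntegrable_const _ _ _),
          Real.circleAverage_fun_sum fun t _ => hf t, Real.circleAverage_const]
    _ ≤ ∑ _t : Fin (Module.finrank ℂ E) × Fin (Module.finrank ℂ E) × Fin 4,
          (((Real.cos (Real.pi * s / 2))⁻¹ + 1) * 2 ^ s) + 1 := by
        gcongr with t
        refine (circleAverage_norm_inner_inverse_rpow_le hι hK hs0 hs1 _).trans ?_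
        gcongr
        nlinarith [norm_nonneg (polVec b t), norm_polVec_le b t]
    _ = fracConst (Module.finrank ℂ E) s := by
        simp only [fracConst, Finset.sum_const, Finset.card_univ, Fintype.card_prod,
          Fintype.card_fin, nsmul_eq_mul]
        push_cast
        ring

end FractionalMoment

section Pair

variable {H E : Type*} [NormedAddCommGroup H] [InnerProductSpace ℂ H] [CompleteSpace H]
  [NormedAddCommGroup E] [InnerProductSpace ℂ E] [CompleteSpace E]

theorem star_mul_apply {D : H →L[ℂ] H} (hD : D ∈ unitary (H →L[ℂ] H)) (x : H) :
    star D (D x) = x := by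
  simpa using DFunLike.congr_fun (Unitary.mem_iff.mp hD).1 x

theorem mul_star_apply {D : H →L[ℂ] H} (hD : D ∈ unitary (H →L[ℂ] H)) (x : H) :
    D (star D x) = x := by
  simpa using DFunLike.congr_fun (Unitary.mem_iff.mp hD).2 x

theorem norm_adjoint_map_apply_le {ι κ : E →L[ℂ] H} (hι : ι† ∘L ι = 1) (hκ : κ† ∘L κ = 1)
    {D : H →L[ℂ] H} (hD : D ∈ unitary (H →L[ℂ] H)) (a : E) : ‖(ι†) (D (κ a))‖ ≤ ‖a‖ := by
  refine (norm_adjoint_apply_le hι _).trans_eq ?_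
  rw [norm_apply_of_mem_unitary hD, norm_isometry_apply hκ]

/-- Two isometries with orthogonal ranges: the embeddings of two sites. -/
structure IsPair (ι κ : E →L[ℂ] H) : Prop where
  left : ι† ∘L ι = 1
  right : κ† ∘L κ = 1
  orth : ι† ∘L κ = 0

namespace IsPair

variable {ι κ : E →L[ℂ] H}

theorem symm (hp : IsPair ι κ) : IsPair κ ι := by
  refine ⟨hp.right, hp.left, ?_⟩
  have horth := congrArg (fun A : E →L[ℂ] E => A†) hp.orth
  simpa [ContinuousLinearMap.adjoint_comp] using horth

theorem left_left (hp : IsPair ι κ) (a : E) : (ι†) (ι a) = a := adjoint_apply_self hp.left a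

theorem left_right (hp : IsPair ι κ) (a : E) : (ι†) (κ a) = 0 := by
  simpa using DFunLike.congr_fun hp.orth a

theorem right_left (hp : IsPair ι κ) (a : E) : (κ†) (ι a) = 0 := hp.symm.left_right a

theorem right_right (hp : IsPair ι κ) (a : E) : (κ†) (κ a) = a := hp.symm.left_left a

end IsPair

/-- The operator `D` acts only on the sites `ι` and `κ`: it preserves the sum of the ranges of `ι`
and `κ` and is the identity on its orthogonal complement. -/
structure IsLocal (ι κ : E →L[ℂ] H) (D : H →L[ℂ] H) : Prop where
  range : ∀ x, D x - x = ι ((ι†) (D x - x)) + κ ((κ†) (D x - x))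
  ker : ∀ x, (ι†) x = 0 → (κ†) x = 0 → D x = x

namespace IsLocal

variable {ι κ : E →L[ℂ] H} {D D' : H →L[ℂ] H}

theorem symm (h : IsLocal ι κ D) : IsLocal κ ι D :=
  ⟨fun x => by rw [add_comm]; exact h.range x, fun x hκ hι => h.ker x hι hκ⟩

theorem star (h : IsLocal ι κ D) (hD : D ∈ unitary (H →L[ℂ] H)) : IsLocal ι κ (star D) := by
  refine ⟨fun x => ?_, fun x hι hκ => ?_⟩
  · have hrange := h.range (Star.star D x)
    rw [mul_star_apply hD] at hrange
    rw [← neg_sub x, map_neg, map_neg, map_neg, map_neg, ← neg_add, ← hrange]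
  · conv_lhs => rw [← h.ker x hι hκ, star_mul_apply hD]

theorem mul (h : IsLocal ι κ D) (h' : IsLocal ι κ D') : IsLocal ι κ (D * D') := by
  refine ⟨fun x => ?_, fun x hι hκ => ?_⟩
  · have hsplit : (D * D') x - x = (D (D' x) - D' x) + (D' x - x) := by
      rw [mul_apply_eq_comp]; abel
    rw [hsplit]
    conv_lhs => rw [h.range, h'.range x]
    simp only [map_add]
    abel
  · rw [mul_apply_eq_comp, h'.ker x hι hκ, h.ker x hι hκ]

theorem adjoint_apply (h : IsLocal ι κ D) (hp : IsPair ι κ) (x : H) :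
    (ι†) (D x) = (ι†) (D (ι ((ι†) x))) + (ι†) (D (κ ((κ†) x))) := by
  have hfix := h.ker (x - ι ((ι†) x) - κ ((κ†) x))
    (by simp only [map_sub, hp.left_left, hp.left_right, sub_self])
    (by simp only [map_sub, hp.right_left, hp.right_right, sub_zero, sub_self])
  have hzero := congrArg (ι†) hfix
  simp only [map_sub, hp.left_left, hp.left_right, sub_self] at hzero
  rwa [sub_sub, sub_eq_zero] at hzero

theorem apply_left (h : IsLocal ι κ D) (hp : IsPair ι κ) (a : E) :
    D (ι a) = ι ((ι†) (D (ι a))) + κ ((κ†) (D (ι a))) := by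
  have hrange := h.range (ι a)
  simp only [map_sub, hp.left_left, hp.right_left, sub_zero] at hrange
  rw [eq_comm, ← sub_eq_zero, ← sub_eq_zero.mpr hrange.symm]
  abel

theorem sub_self_apply (h : IsLocal ι κ D) (hp : IsPair ι κ) {x : H} (hx : (κ†) x = 0) :
    D x - x = D (ι ((ι†) x)) - ι ((ι†) x) := by
  have hfix := h.ker (x - ι ((ι†) x)) (by rw [map_sub, hp.left_left, sub_self])
    (by rw [map_sub, hx, hp.right_left, sub_self])
  rw [map_sub] at hfix
  rwa [sub_eq_sub_iff_sub_eq_sub]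

end IsLocal

theorem IsPair.isLocal_rot {ι κ : E →L[ℂ] H} (hp : IsPair ι κ) (w : ℂ) :
    IsLocal ι κ (rot κ w) := by
  refine ⟨fun x => ?_, fun x _ hκ => ?_⟩
  · have hsub : rot κ w x - x = (w - 1) • κ ((κ†) x) := by rw [rot_apply]; abel
    rw [hsub]
    simp only [map_smul, hp.left_right, hp.right_right, map_zero, smul_zero, zero_add]
  · rw [rot_apply, hκ]; simp

/-- `q v` is the energy of the part of the vector `v` that lies on the side of the site `ι`, the
site itself excluded; `T` does not transport energy between the two sides. -/
structure IsSideEnergy (ι κ : E →L[ℂ] H) (T : H →L[ℂ] H) (q : H → ℝ) : Prop where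
  nonneg : ∀ v, 0 ≤ q v
  add_left : ∀ v a, q (v + ι a) = q v
  add_right : ∀ v a, q (v + κ a) = q v
  smul : ∀ (c : ℂ) v, q (c • v) = ‖c‖ ^ 2 * q v
  energy : ∀ v, q (T v) + ‖(ι†) (T v)‖ ^ 2 = q v + ‖(ι†) v‖ ^ 2

namespace IsSideEnergy

variable {ι κ : E →L[ℂ] H} {D T : H →L[ℂ] H} {q : H → ℝ} {z : ℂ} {ψ : H} {a b : E}

theorem flux (hq : IsSideEnergy ι κ T q) (hD : IsLocal ι κ D)
    (hψ : D (T ψ) = z • ψ + ι a + κ b) :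
    (‖z‖ ^ 2 - 1) * q ψ = ‖(ι†) ψ‖ ^ 2 - ‖(ι†) (T ψ)‖ ^ 2 := by
  have hlocal : q (D (T ψ)) = q (T ψ) := by
    have hsplit : D (T ψ) = T ψ + ι ((ι†) (D (T ψ) - T ψ)) + κ ((κ†) (D (T ψ) - T ψ)) := by
      rw [add_assoc, ← hD.range]; abel
    rw [hsplit, hq.add_right, hq.add_left]
  rw [hψ, hq.add_right, hq.add_left, hq.smul] at hlocal
  linarith [hq.energy ψ]

theorem norm_adjoint_le_map (hq : IsSideEnergy ι κ T q) (hD : IsLocal ι κ D) (hz : ‖z‖ < 1)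
    (hψ : D (T ψ) = z • ψ + ι a + κ b) : ‖(ι†) ψ‖ ≤ ‖(ι†) (T ψ)‖ := by
  have hflux := hq.flux hD hψ
  have hfactor : ‖z‖ ^ 2 - 1 ≤ 0 := by nlinarith [norm_nonneg z]
  exact le_of_sq_le_sq (by linarith [mul_nonpos_of_nonpos_of_nonneg hfactor (hq.nonneg ψ)])
    (norm_nonneg _)

theorem norm_adjoint_map_le (hq : IsSideEnergy ι κ T q) (hD : IsLocal ι κ D) (hz : 1 < ‖z‖)
    (hψ : D (T ψ) = z • ψ + ι a + κ b) : ‖(ι†) (T ψ)‖ ≤ ‖z • (ι†) ψ‖ := by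
  have hflux := hq.flux hD hψ
  have hfactor : 0 ≤ ‖z‖ ^ 2 - 1 := by nlinarith
  have hle : ‖(ι†) (T ψ)‖ ≤ ‖(ι†) ψ‖ :=
    le_of_sq_le_sq (by linarith [mul_nonneg hfactor (hq.nonneg ψ)]) (norm_nonneg _)
  rw [norm_smul]
  exact hle.trans (le_mul_of_one_le_left (norm_nonneg _) hz.le)

end IsSideEnergy

/-- A unitary `D` that acts on the sites `ι` and `κ`, together with a unitary `T` that does not
transport energy between the two sides of this pair. The reflection coefficient of `D` at `ι` is at
most `c < 1`, so that `D` couples the two sites. -/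
structure IsCoupling (ι κ : E →L[ℂ] H) (D T : H →L[ℂ] H) (c : ℝ) : Prop where
  pair : IsPair ι κ
  isLocal : IsLocal ι κ D
  mem_unitary : D ∈ unitary (H →L[ℂ] H)
  mem_unitary' : T ∈ unitary (H →L[ℂ] H)
  energy_left : ∃ q, IsSideEnergy ι κ T q
  energy_right : ∃ q, IsSideEnergy κ ι T q
  norm_le : ‖ι† ∘L D ∘L ι‖ ≤ c
  lt_one : c < 1

namespace IsCoupling

variable {ι κ : E →L[ℂ] H} {D T : H →L[ℂ] H} {c : ℝ} {z : ℂ} {ψ : H} {a b : E}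

theorem one_le_inv (h : IsCoupling ι κ D T c) : 1 ≤ (1 - c)⁻¹ :=
  (one_le_inv₀ (by linarith [h.lt_one])).mpr (by linarith [(norm_nonneg _).trans h.norm_le])

theorem norm_reflection_le (h : IsCoupling ι κ D T c) (x : E) :
    ‖(ι†) (D (ι x))‖ ≤ c * ‖x‖ :=
  (ι† ∘L D ∘L ι).le_of_opNorm_le h.norm_le x

theorem norm_star_reflection_le (h : IsCoupling ι κ D T c) (x : E) :
    ‖(ι†) (star D (ι x))‖ ≤ c * ‖x‖ :=
  (ι† ∘L star D ∘L ι).le_of_opNorm_le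
    (by rw [← adjoint_comp_comp, LinearIsometryEquiv.norm_map]; exact h.norm_le) x

theorem one_sub_mul_norm_left_le_of_norm_lt_one (h : IsCoupling ι κ D T c) (hz : ‖z‖ < 1)
    (hψ : D (T ψ) = z • ψ + ι a + κ b) :
    (1 - c) * ‖z • (ι†) ψ‖ ≤ ‖z • (κ†) ψ‖ + (‖a‖ + ‖b‖) := by
  obtain ⟨q, hq⟩ := h.energy_left
  have hp := h.pair
  have hinv : T ψ = star D (z • ψ + ι a + κ b) := by rw [← hψ, star_mul_apply h.mem_unitary]
  have hblocks := (h.isLocal.star h.mem_unitary).adjoint_apply hp (z • ψ + ι a + κ b)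
  simp only [← hinv, map_add, hp.left_left, hp.left_right, hp.right_left, hp.right_right,
    map_smul, add_zero] at hblocks
  have hreflect := h.norm_star_reflection_le (z • (ι†) ψ + a)
  have htransmit := norm_adjoint_map_apply_le hp.left hp.right
    (Unitary.star_mem h.mem_unitary) (z • (κ†) ψ + b)
  simp only [map_add, map_smul] at hreflect htransmit
  have hmap : ‖(ι†) (T ψ)‖ ≤ c * (‖z • (ι†) ψ‖ + ‖a‖) + (‖z • (κ†) ψ‖ + ‖b‖) := by
    rw [hblocks]
    have hc : 0 ≤ c := (norm_nonneg _).trans h.norm_le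
    refine (norm_add_le _ _).trans (add_le_add (hreflect.trans ?_) (htransmit.trans ?_))
    · gcongr
      exact norm_add_le _ _
    · simpa using norm_add_le (z • (κ†) ψ) b
  have hle : ‖z • (ι†) ψ‖ ≤ ‖(ι†) (T ψ)‖ := by
    rw [norm_smul]
    exact (mul_le_of_le_one_left (norm_nonneg _) hz.le).trans
      (hq.norm_adjoint_le_map h.isLocal hz hψ)
  nlinarith [norm_nonneg a, h.lt_one]

theorem one_sub_mul_norm_left_le_of_one_lt_norm (h : IsCoupling ι κ D T c) (hz : 1 < ‖z‖)
    (hψ : D (T ψ) = z • ψ + ι a + κ b) :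
    (1 - c) * ‖z • (ι†) ψ‖ ≤ ‖z • (κ†) ψ‖ + (‖a‖ + ‖b‖) := by
  obtain ⟨q, hq⟩ := h.energy_left
  obtain ⟨q', hq'⟩ := h.energy_right
  have hp := h.pair
  have hleft := hq.norm_adjoint_map_le h.isLocal hz hψ
  have hright := hq'.norm_adjoint_map_le h.isLocal.symm hz (a := b) (b := a) (by rw [hψ]; abel)
  have hblocks := h.isLocal.adjoint_apply hp (T ψ)
  simp only [hψ, map_add, hp.left_left, hp.left_right, map_smul, add_zero] at hblocks
  have hmap : ‖z • (ι†) ψ‖ ≤ c * ‖(ι†) (T ψ)‖ + ‖(κ†) (T ψ)‖ + ‖a‖ := by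
    conv_lhs => rw [eq_sub_of_add_eq hblocks]
    exact (norm_sub_le _ _).trans (add_le_add_left ((norm_add_le _ _).trans
      (add_le_add (h.norm_reflection_le _)
        (norm_adjoint_map_apply_le hp.left hp.right h.mem_unitary _))) _)
  nlinarith [norm_nonneg b, (norm_nonneg _).trans h.norm_le]

theorem norm_left_le (h : IsCoupling ι κ D T c) (hz : ‖z‖ ≠ 1)
    (hψ : D (T ψ) = z • ψ + ι a + κ b) :
    ‖z • (ι†) ψ‖ ≤ (1 - c)⁻¹ * (‖z • (κ†) ψ‖ + (‖a‖ + ‖b‖)) := by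
  rw [inv_mul_eq_div, le_div_iff₀' (sub_pos.mpr h.lt_one)]
  exact hz.lt_or_gt.elim (h.one_sub_mul_norm_left_le_of_norm_lt_one · hψ)
    (h.one_sub_mul_norm_left_le_of_one_lt_norm · hψ)

theorem norm_resBlock_left_left_le (h : IsCoupling ι κ D T c) (hz : ‖z‖ ≠ 1) :
    ‖resBlock (D * T) z ι ι‖ ≤ (1 - c)⁻¹ * (‖resBlock (D * T) z κ ι‖ + 1) := by
  have hk := zero_le_one.trans h.one_le_inv
  refine ContinuousLinearMap.opNorm_le_bound _ (by positivity) fun a => ?_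
  have hψ := map_res_apply (mul_mem h.mem_unitary h.mem_unitary') hz (ι a)
  have hle := h.norm_left_le hz (a := a) (b := 0) (by simpa using hψ)
  rw [← resBlock_apply, ← resBlock_apply, norm_zero, add_zero] at hle
  rw [mul_assoc, add_mul, one_mul]
  exact hle.trans (by gcongr; exact ContinuousLinearMap.le_opNorm _ _)

theorem norm_resBlock_left_right_le (h : IsCoupling ι κ D T c) (hz : ‖z‖ ≠ 1) :
    ‖resBlock (D * T) z ι κ‖ ≤ (1 - c)⁻¹ * (‖resBlock (D * T) z κ κ‖ + 1) := by
  have hk := zero_le_one.trans h.one_le_inv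
  refine ContinuousLinearMap.opNorm_le_bound _ (by positivity) fun a => ?_
  have hψ := map_res_apply (mul_mem h.mem_unitary h.mem_unitary') hz (κ a)
  have hle := h.norm_left_le hz (a := 0) (b := a) (by simpa using hψ)
  rw [← resBlock_apply, ← resBlock_apply, norm_zero, zero_add] at hle
  rw [mul_assoc, add_mul, one_mul]
  exact hle.trans (by gcongr; exact ContinuousLinearMap.le_opNorm _ _)

end IsCoupling

end Pair

section PairSum

variable {H E : Type*} [NormedAddCommGroup H] [InnerProductSpace ℂ H] [CompleteSpace H]
  [NormedAddCommGroup E] [InnerProductSpace ℂ E] [CompleteSpace E]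

/-- The sum of the norms of the four blocks of `z (U - z)⁻¹` on a pair of sites. -/
noncomputable def pairSum (U : H →L[ℂ] H) (z : ℂ) (ι κ : E →L[ℂ] H) : ℝ :=
  ‖resBlock U z ι ι‖ + ‖resBlock U z ι κ‖ + ‖resBlock U z κ ι‖ + ‖resBlock U z κ κ‖

theorem pairSum_comm (U : H →L[ℂ] H) (z : ℂ) (ι κ : E →L[ℂ] H) :
    pairSum U z ι κ = pairSum U z κ ι := by unfold pairSum; ring

theorem pairSum_nonneg (U : H →L[ℂ] H) (z : ℂ) (ι κ : E →L[ℂ] H) : 0 ≤ pairSum U z ι κ := by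
  unfold pairSum; positivity

variable {ι κ : E →L[ℂ] H} {U D T : H →L[ℂ] H} {z : ℂ}

theorem pairSum_star (hU : U ∈ unitary (H →L[ℂ] H)) (hz : ‖z‖ ≠ 1) (ι κ : E →L[ℂ] H) :
    pairSum (star U) (star z) ι κ = pairSum U z ι κ := by
  have hblock : ∀ ι κ : E →L[ℂ] H, ‖resBlock (star U) (star z) ι κ‖ = ‖resBlock U z κ ι‖ := by
    intro ι κ
    rw [← LinearIsometryEquiv.norm_map ContinuousLinearMap.adjoint (resBlock U z κ ι), resBlock,
      resBlock, adjoint_comp_comp, star_smul, star_res hU hz]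
  simp only [pairSum, hblock]
  ring

theorem continuousOn_pairSum {X : Type*} [TopologicalSpace X] {V : X → H →L[ℂ] H} {S : Set X}
    (hV : ContinuousOn V S) (hmem : ∀ x ∈ S, V x ∈ unitary (H →L[ℂ] H)) (hz : ‖z‖ ≠ 1)
    (ι κ : E →L[ℂ] H) : ContinuousOn (fun x => pairSum (V x) z ι κ) S := by
  have hblock := continuousOn_resBlock (E := E) hV hmem hz
  unfold pairSum
  fun_prop

theorem IsCoupling.pairSum_le {c : ℝ} (h : IsCoupling ι κ D T c) (hz : ‖z‖ ≠ 1) :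
    pairSum (D * T) z ι κ ≤ 10 * (1 - c)⁻¹ ^ 2 * (‖resBlock (D * T) z κ κ‖ + 1) := by
  have hU : D * T ∈ unitary (H →L[ℂ] H) := mul_mem h.mem_unitary h.mem_unitary'
  rcases eq_or_ne z 0 with rfl | hz0
  · simp only [pairSum, resBlock, zero_smul, ContinuousLinearMap.zero_comp,
      ContinuousLinearMap.comp_zero, norm_zero, add_zero, zero_add]
    positivity
  set k := (1 - c)⁻¹
  set X := ‖resBlock (D * T) z κ κ‖
  have hk := h.one_le_inv
  have hX : 0 ≤ X := norm_nonneg _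
  have hll := h.norm_resBlock_left_left_le hz
  have hlr := h.norm_resBlock_left_right_le hz
  -- The block from `ι` to `κ` is, up to sign, the adjoint of the block from `κ` to `ι` at the
  -- reflected spectral parameter.
  have hrl : ‖resBlock (D * T) z κ ι‖ ≤ k * (X + 2) := by
    have hreflect := congrArg norm (comp_add_resBlock hU hz hz0 κ ι)
    rw [h.pair.symm.orth, zero_add, norm_neg, LinearIsometryEquiv.norm_map] at hreflect
    have hrr : ‖resBlock (D * T) (star z)⁻¹ κ κ‖ ≤ 1 + X := by
      have hself := congrArg norm (comp_add_resBlock hU hz hz0 κ κ)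
      rw [h.pair.right, norm_neg, LinearIsometryEquiv.norm_map] at hself
      rw [← hself]
      exact (norm_add_le _ _).trans (add_le_add_left ContinuousLinearMap.norm_id_le _)
    rw [hreflect]
    exact (h.norm_resBlock_left_right_le (norm_inv_star_ne_one hz)).trans
      (mul_le_mul_of_nonneg_left (by linarith) (by linarith))
  have hll' : ‖resBlock (D * T) z ι ι‖ ≤ k * (k * (X + 2) + 1) :=
    hll.trans (by gcongr)
  unfold pairSum
  have hk2 : k ≤ k ^ 2 := by nlinarith
  have hkX : k * X ≤ k ^ 2 * X := by gcongr
  have hX2 : X ≤ k ^ 2 * X := by nlinarith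
  nlinarith

theorem norm_smul_adjoint_res_add_le (U : H →L[ℂ] H) (z : ℂ) (σ ι κ : E →L[ℂ] H) {b b' : E}
    {t : ℝ} (hb : ‖b‖ ≤ t) (hb' : ‖b'‖ ≤ t) :
    ‖z • (σ†) (res U z (ι b + κ b'))‖ ≤ (‖resBlock U z σ ι‖ + ‖resBlock U z σ κ‖) * t := by
  rw [map_add, map_add, smul_add, ← resBlock_apply, ← resBlock_apply, add_mul]
  exact (norm_add_le _ _).trans (add_le_add (ContinuousLinearMap.le_opNorm_of_le _ hb)
    (ContinuousLinearMap.le_opNorm_of_le _ hb'))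

theorem res_mul_comm (hD : D ∈ unitary (H →L[ℂ] H)) (hT : T ∈ unitary (H →L[ℂ] H))
    (hz : ‖z‖ ≠ 1) : res (T * D) z = star D * res (D * T) z * D := by
  have hDD := (Unitary.mem_iff.mp hD).1
  refine (eq_res_of_mul (mul_mem hT hD) hz ?_).symm
  have hconj : T * D - z • 1 = star D * (D * T - z • 1) * D := by
    rw [mul_sub, sub_mul, ← mul_assoc, hDD, one_mul, mul_smul_comm, mul_one, smul_mul_assoc, hDD]
  calc (T * D - z • 1) * (star D * res (D * T) z * D)
      = star D * (D * T - z • 1) * (D * star D) * res (D * T) z * D := by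
        rw [hconj]; simp only [mul_assoc]
    _ = 1 := by
        rw [(Unitary.mem_iff.mp hD).2, mul_one, mul_assoc (star D), mul_res (mul_mem hD hT) hz,
          mul_one, hDD]

theorem norm_resBlock_mul_comm_le {σ : E →L[ℂ] H} (hp : IsPair ι κ) (hσ : σ† ∘L σ = 1)
    (hD : IsLocal ι κ D) (hDu : D ∈ unitary (H →L[ℂ] H)) (hTu : T ∈ unitary (H →L[ℂ] H))
    (hz : ‖z‖ ≠ 1) (hDσ : ∀ a, D (σ a) = ι ((ι†) (D (σ a))) + κ ((κ†) (D (σ a)))) :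
    ‖resBlock (T * D) z ι σ‖ ≤ pairSum (D * T) z ι κ := by
  have hDs := Unitary.star_mem hDu
  refine ContinuousLinearMap.opNorm_le_bound _ (pairSum_nonneg _ _ _ _) fun a => ?_
  set x := res (D * T) z (D (σ a)) with hx
  have hentry : ∀ τ : E →L[ℂ] H, ‖z • (τ†) x‖ ≤
      (‖resBlock (D * T) z τ ι‖ + ‖resBlock (D * T) z τ κ‖) * ‖a‖ := fun τ => by
    rw [hx, hDσ]
    exact norm_smul_adjoint_res_add_le _ _ _ _ _ (norm_adjoint_map_apply_le hp.left hσ hDu a)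
      (norm_adjoint_map_apply_le hp.right hσ hDu a)
  calc ‖resBlock (T * D) z ι σ a‖
      = ‖(ι†) (star D (ι (z • (ι†) x))) + (ι†) (star D (κ (z • (κ†) x)))‖ := by
        rw [resBlock_apply, res_mul_comm hDu hTu hz, mul_apply_eq_comp, mul_apply_eq_comp, ← hx,
          (hD.star hDu).adjoint_apply hp, smul_add]
        simp only [map_smul]
    _ ≤ ‖z • (ι†) x‖ + ‖z • (κ†) x‖ :=
        (norm_add_le _ _).trans (add_le_add (norm_adjoint_map_apply_le hp.left hp.left hDs _)
          (norm_adjoint_map_apply_le hp.left hp.right hDs _))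
    _ ≤ pairSum (D * T) z ι κ * ‖a‖ := by
        unfold pairSum
        linarith [hentry ι, hentry κ]

theorem pairSum_mul_comm_le (hp : IsPair ι κ) (hD : IsLocal ι κ D)
    (hDu : D ∈ unitary (H →L[ℂ] H)) (hTu : T ∈ unitary (H →L[ℂ] H)) (hz : ‖z‖ ≠ 1) :
    pairSum (T * D) z ι κ ≤ 4 * pairSum (D * T) z ι κ := by
  have hDι := hD.apply_left hp
  have hDκ := hD.symm.apply_left hp.symm
  have hll := norm_resBlock_mul_comm_le hp hp.left hD hDu hTu hz hDι
  have hrr := norm_resBlock_mul_comm_le hp.symm hp.right hD.symm hDu hTu hz hDκ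
  have hlr := norm_resBlock_mul_comm_le hp hp.right hD hDu hTu hz
    fun a => by rw [add_comm]; exact hDκ a
  have hrl := norm_resBlock_mul_comm_le hp.symm hp.left hD.symm hDu hTu hz
    fun a => by rw [add_comm]; exact hDι a
  rw [pairSum_comm] at hrr hrl
  rw [pairSum]
  linarith

end PairSum

section Decoupling

variable {H E : Type*} [NormedAddCommGroup H] [InnerProductSpace ℂ H] [CompleteSpace H]
  [NormedAddCommGroup E] [InnerProductSpace ℂ E] [CompleteSpace E]
  {ι κ σ : E →L[ℂ] H} {D T : H →L[ℂ] H} {z : ℂ}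

theorem norm_smul_adjoint_res_map_sub_le (hp : IsPair ι κ) (hD : IsLocal ι κ D)
    (hDu : D ∈ unitary (H →L[ℂ] H)) (U : H →L[ℂ] H) (z : ℂ) {y : H} (hy : (κ†) y = 0) :
    ‖z • (ι†) (res U z (D y - y))‖ ≤ 2 * pairSum U z ι κ * ‖(ι†) y‖ := by
  set b := (ι†) y
  have hleft : ‖(ι†) (D (ι b) - ι b)‖ ≤ 2 * ‖b‖ := by
    rw [map_sub, hp.left_left]
    linarith [norm_sub_le ((ι†) (D (ι b))) b, norm_adjoint_map_apply_le hp.left hp.left hDu b]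
  have hright : ‖(κ†) (D (ι b) - ι b)‖ ≤ 2 * ‖b‖ := by
    rw [map_sub, hp.right_left, sub_zero]
    linarith [norm_nonneg b, norm_adjoint_map_apply_le hp.right hp.left hDu b]
  rw [hD.sub_self_apply hp hy, hD.range]
  calc ‖z • (ι†) (res U z (ι ((ι†) (D (ι b) - ι b)) + κ ((κ†) (D (ι b) - ι b))))‖
      ≤ (‖resBlock U z ι ι‖ + ‖resBlock U z ι κ‖) * (2 * ‖b‖) :=
        norm_smul_adjoint_res_add_le U z ι ι κ hleft hright
    _ ≤ pairSum U z ι κ * (2 * ‖b‖) := by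
        gcongr
        unfold pairSum
        linarith [norm_nonneg (resBlock U z κ ι), norm_nonneg (resBlock U z κ κ)]
    _ = 2 * pairSum U z ι κ * ‖b‖ := by ring

theorem norm_adjoint_res_mul_left_le (hp : IsPair ι κ) (hD : IsLocal ι κ D)
    (hDu : D ∈ unitary (H →L[ℂ] H)) (hTu : T ∈ unitary (H →L[ℂ] H)) (hz : ‖z‖ ≠ 1)
    {h : H} (hι : (ι†) h = 0) (hκ : (κ†) h = 0) (hg : (κ†) (res T z h) = 0) :
    ‖(ι†) (res (D * T) z h)‖ ≤ (1 + 2 * pairSum (D * T) z ι κ) * ‖(ι†) (res T z h)‖ := by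
  set y := res T z h with hy
  have hmap : (D * T) y = z • D y + h := by
    rw [mul_apply_eq_comp, hy, map_res_apply hTu hz, map_add, map_smul, hD.ker h hι hκ]
  have hres := res_map_apply (mul_mem hDu hTu) hz y
  rw [hmap, map_add, map_smul, ← eq_sub_iff_add_eq'] at hres
  have hdiff : res (D * T) z h = y - z • res (D * T) z (D y - y) := by
    rw [hres, map_sub, smul_sub]; abel
  rw [hdiff, map_sub, map_smul, add_mul, one_mul]
  exact (norm_sub_le _ _).trans
    (add_le_add_right (norm_smul_adjoint_res_map_sub_le hp hD hDu _ z hg) _)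

theorem norm_adjoint_res_mul_right_le (hp : IsPair ι κ) (hD : IsLocal ι κ D)
    (hDu : D ∈ unitary (H →L[ℂ] H)) (hTu : T ∈ unitary (H →L[ℂ] H)) (hz : ‖z‖ ≠ 1)
    {h : H} (hg : (κ†) (res T z h) = 0) :
    ‖(ι†) (res (T * D) z h)‖ ≤ (1 + 2 * pairSum (T * D) z ι κ) * ‖(ι†) (res T z h)‖ := by
  set y := res T z h with hy
  have hDs := Unitary.star_mem hDu
  have hmap : (T * D) (star D y) = z • y + h := by
    rw [mul_apply_eq_comp, mul_star_apply hDu, hy, map_res_apply hTu hz]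
  have hres := res_map_apply (mul_mem hTu hDu) hz (star D y)
  rw [hmap, map_add, map_smul, ← eq_sub_iff_add_eq'] at hres
  have hdiff : res (T * D) z h = star D y + z • res (T * D) z (star D y - y) := by
    rw [hres, map_sub, smul_sub]; abel
  have hfirst : ‖(ι†) (star D y)‖ ≤ ‖(ι†) y‖ := by
    rw [(hD.star hDu).adjoint_apply hp, hg, map_zero, map_zero, map_zero, add_zero]
    exact norm_adjoint_map_apply_le hp.left hp.left hDs _
  rw [hdiff, map_add, map_smul, add_mul, one_mul]
  exact (norm_add_le _ _).trans (add_le_add hfirst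
    (norm_smul_adjoint_res_map_sub_le hp (hD.star hDu) hDs _ z hg))

theorem norm_row_mul_left_le (hp : IsPair ι κ) (hD : IsLocal ι κ D)
    (hDu : D ∈ unitary (H →L[ℂ] H)) (hTu : T ∈ unitary (H →L[ℂ] H)) (hz : ‖z‖ ≠ 1)
    (hισ : ι† ∘L σ = 0) (hκσ : κ† ∘L σ = 0) (hg : κ† ∘L res T z ∘L σ = 0) :
    ‖ι† ∘L res (D * T) z ∘L σ‖ ≤ (1 + 2 * pairSum (D * T) z ι κ) * ‖ι† ∘L res T z ∘L σ‖ := by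
  have hconst := pairSum_nonneg (D * T) z ι κ
  refine ContinuousLinearMap.opNorm_le_bound _ (by positivity) fun a => ?_
  rw [mul_assoc]
  exact (norm_adjoint_res_mul_left_le hp hD hDu hTu hz (DFunLike.congr_fun hισ a)
    (DFunLike.congr_fun hκσ a) (DFunLike.congr_fun hg a)).trans
    (by gcongr; exact (ι† ∘L res T z ∘L σ).le_opNorm a)

theorem norm_row_mul_right_le (hp : IsPair ι κ) (hD : IsLocal ι κ D)
    (hDu : D ∈ unitary (H →L[ℂ] H)) (hTu : T ∈ unitary (H →L[ℂ] H)) (hz : ‖z‖ ≠ 1)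
    (hg : κ† ∘L res T z ∘L σ = 0) :
    ‖ι† ∘L res (T * D) z ∘L σ‖ ≤ (1 + 2 * pairSum (T * D) z ι κ) * ‖ι† ∘L res T z ∘L σ‖ := by
  have hconst := pairSum_nonneg (T * D) z ι κ
  refine ContinuousLinearMap.opNorm_le_bound _ (by positivity) fun a => ?_
  rw [mul_assoc]
  exact (norm_adjoint_res_mul_right_le hp hD hDu hTu hz (DFunLike.congr_fun hg a)).trans
    (by gcongr; exact (ι† ∘L res T z ∘L σ).le_opNorm a)

theorem adjoint_comp_res_comp {U : H →L[ℂ] H} (hU : U ∈ unitary (H →L[ℂ] H)) (hz : ‖z‖ ≠ 1)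
    (ι κ : E →L[ℂ] H) : (ι† ∘L res U z ∘L κ)† = κ† ∘L res (star U) (star z) ∘L ι := by
  rw [adjoint_comp_comp, star_res hU hz]

theorem norm_col_mul_left_le (hp : IsPair ι κ) (hD : IsLocal ι κ D)
    (hDu : D ∈ unitary (H →L[ℂ] H)) (hTu : T ∈ unitary (H →L[ℂ] H)) (hz : ‖z‖ ≠ 1)
    (hg : σ† ∘L res T z ∘L κ = 0) :
    ‖σ† ∘L res (D * T) z ∘L ι‖ ≤ (1 + 2 * pairSum (D * T) z ι κ) * ‖σ† ∘L res T z ∘L ι‖ := by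
  have hg' := congrArg (fun A : E →L[ℂ] E => A†) hg
  rw [adjoint_comp_res_comp hTu hz, map_zero] at hg'
  have hrow := norm_row_mul_right_le hp (hD.star hDu) (Unitary.star_mem hDu)
    (Unitary.star_mem hTu) (by rwa [norm_star]) hg'
  rwa [← star_mul, pairSum_star (mul_mem hDu hTu) hz, ← adjoint_comp_res_comp (mul_mem hDu hTu) hz,
    ← adjoint_comp_res_comp hTu hz, LinearIsometryEquiv.norm_map, LinearIsometryEquiv.norm_map]
    at hrow

theorem norm_col_mul_right_le (hp : IsPair ι κ) (hD : IsLocal ι κ D)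
    (hDu : D ∈ unitary (H →L[ℂ] H)) (hTu : T ∈ unitary (H →L[ℂ] H)) (hz : ‖z‖ ≠ 1)
    (hισ : ι† ∘L σ = 0) (hκσ : κ† ∘L σ = 0) (hg : σ† ∘L res T z ∘L κ = 0) :
    ‖σ† ∘L res (T * D) z ∘L ι‖ ≤ (1 + 2 * pairSum (T * D) z ι κ) * ‖σ† ∘L res T z ∘L ι‖ := by
  have hg' := congrArg (fun A : E →L[ℂ] E => A†) hg
  rw [adjoint_comp_res_comp hTu hz, map_zero] at hg'
  have hrow := norm_row_mul_left_le hp (hD.star hDu) (Unitary.star_mem hDu)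
    (Unitary.star_mem hTu) (by rwa [norm_star]) hισ hκσ hg'
  rwa [← star_mul, pairSum_star (mul_mem hTu hDu) hz, ← adjoint_comp_res_comp (mul_mem hTu hDu) hz,
    ← adjoint_comp_res_comp hTu hz, LinearIsometryEquiv.norm_map, LinearIsometryEquiv.norm_map]
    at hrow

end Decoupling

section Average

variable {H E : Type*} [NormedAddCommGroup H] [InnerProductSpace ℂ H] [CompleteSpace H]
  [NormedAddCommGroup E] [InnerProductSpace ℂ E]

theorem IsCoupling.rot_mul [CompleteSpace E] {ι κ : E →L[ℂ] H} {D T : H →L[ℂ] H} {c : ℝ}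
    (h : IsCoupling ι κ D T c) {w : ℂ} (hw : ‖w‖ = 1) : IsCoupling ι κ (rot κ w * D) T c where
  pair := h.pair
  isLocal := (h.pair.isLocal_rot w).mul h.isLocal
  mem_unitary := mul_mem (rot_mem_unitary h.pair.right hw) h.mem_unitary
  mem_unitary' := h.mem_unitary'
  energy_left := h.energy_left
  energy_right := h.energy_right
  norm_le := by
    have hreflection : ι† ∘L (rot κ w * D) ∘L ι = ι† ∘L D ∘L ι := by
      ext1 x
      simp only [ContinuousLinearMap.comp_apply, mul_apply_eq_comp, rot_apply, map_add, map_smul,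
        h.pair.left_right, smul_zero, add_zero]
    exact hreflection ▸ h.norm_le
  lt_one := h.lt_one

variable [FiniteDimensional ℂ E] {ι κ : E →L[ℂ] H} {D T : H →L[ℂ] H} {c : ℝ} {z : ℂ}

theorem IsCoupling.one_add_pairSum_le (h : IsCoupling ι κ D T c) (hz : ‖z‖ ≠ 1) {U : H →L[ℂ] H}
    (hU : U = D * T ∨ U = T * D) :
    1 + 2 * pairSum U z ι κ ≤ 81 * (1 - c)⁻¹ ^ 2 * (‖resBlock (D * T) z κ κ‖ + 1) := by
  have hle := h.pairSum_le hz
  have hcomm := pairSum_mul_comm_le h.pair h.isLocal h.mem_unitary h.mem_unitary' hz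
  have hone : 1 ≤ (1 - c)⁻¹ ^ 2 * (‖resBlock (D * T) z κ κ‖ + 1) :=
    one_le_mul_of_one_le_of_one_le (one_le_pow₀ h.one_le_inv) (by simp)
  rcases hU with rfl | rfl <;> linarith [pairSum_nonneg (D * T) z ι κ]

/-- The bound for the averaged fractional moment of the blocks of the resolvent on a pair of sites
of dimension `n` that is coupled with reflection coefficient at most `c`. -/
noncomputable def avgConst (n : ℕ) (s c : ℝ) : ℝ :=
  (81 * (1 - c)⁻¹ ^ 2) ^ s * (fracConst n s + 1)

theorem avgConst_pos (n : ℕ) {s c : ℝ} (hs0 : 0 < s) (hs1 : s < 1) (hc : c < 1) :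
    0 < avgConst n s c := by
  have := fracConst_nonneg n hs0 hs1
  have := sub_pos.mpr hc
  unfold avgConst
  positivity

theorem IsCoupling.one_add_pairSum_rpow_le (h : IsCoupling ι κ D T c) (hz : ‖z‖ ≠ 1)
    {U : H →L[ℂ] H} (hU : U = D * T ∨ U = T * D) {s : ℝ} (hs0 : 0 < s) (hs1 : s ≤ 1) :
    (1 + 2 * pairSum U z ι κ) ^ s ≤
      (81 * (1 - c)⁻¹ ^ 2) ^ s * (‖resBlock (D * T) z κ κ‖ ^ s + 1) := by
  have hsum := pairSum_nonneg U z ι κ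
  calc (1 + 2 * pairSum U z ι κ) ^ s
      ≤ (81 * (1 - c)⁻¹ ^ 2 * (‖resBlock (D * T) z κ κ‖ + 1)) ^ s := by
        gcongr
        exact h.one_add_pairSum_le hz hU
    _ = (81 * (1 - c)⁻¹ ^ 2) ^ s * (‖resBlock (D * T) z κ κ‖ + 1) ^ s :=
        Real.mul_rpow (by positivity) (by positivity)
    _ ≤ (81 * (1 - c)⁻¹ ^ 2) ^ s * (‖resBlock (D * T) z κ κ‖ ^ s + 1) := by
        gcongr
        simpa using Real.rpow_add_le_add_rpow (norm_nonneg _) zero_le_one hs0.le hs1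

theorem IsCoupling.circleAverage_one_add_pairSum_rpow_le (h : IsCoupling ι κ D T c)
    (hz : ‖z‖ ≠ 1) {s : ℝ} (hs0 : 0 < s) (hs1 : s < 1) {U : ℂ → H →L[ℂ] H}
    (hU : (∀ w, U w = rot κ w * D * T) ∨ ∀ w, U w = T * (rot κ w * D)) :
    Real.circleAverage (fun w => (1 + 2 * pairSum (U w) z ι κ) ^ s) 0 1 ≤
      avgConst (Module.finrank ℂ E) s c := by
  set k := (81 * (1 - c)⁻¹ ^ 2) ^ s
  set R := fun w => ‖resBlock (rot κ w * (D * T)) z κ κ‖ ^ s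
  have hrot := (differentiable_rot κ).continuous
  have hDT := mul_mem h.mem_unitary h.mem_unitary'
  have hcoupling : ∀ w ∈ sphere (0 : ℂ) |1|, IsCoupling ι κ (rot κ w * D) T c := fun w hw =>
    h.rot_mul (by simpa using hw)
  have hR : CircleIntegrable R 0 1 :=
    circleIntegrable_norm_rpow (continuousOn_resBlock (by fun_prop)
      (fun w hw => mul_mem (rot_mem_unitary h.pair.right (by simpa using hw)) hDT) hz κ κ) hs0.le
  have hint : CircleIntegrable (fun w => (1 + 2 * pairSum (U w) z ι κ) ^ s) 0 1 := by
    have hcontU : Continuous U := by rcases hU with hU | hU <;> rw [funext hU] <;> fun_prop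
    have hmem : ∀ w ∈ sphere (0 : ℂ) |1|, U w ∈ unitary (H →L[ℂ] H) := fun w hw => by
      have hD := (hcoupling w hw).mem_unitary
      rcases hU with hU | hU <;> rw [hU]
      exacts [mul_mem hD h.mem_unitary', mul_mem h.mem_unitary' hD]
    have hsum := continuousOn_pairSum hcontU.continuousOn hmem hz ι κ
    exact ContinuousOn.circleIntegrable' (ContinuousOn.rpow_const
      (by fun_prop) fun _ _ => Or.inr hs0.le)
  calc Real.circleAverage (fun w => (1 + 2 * pairSum (U w) z ι κ) ^ s) 0 1
      ≤ Real.circleAverage (fun w => k • (R w + 1)) 0 1 := by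
        refine Real.circleAverage_mono hint
          ((hR.add (circleIntegrable_const 1 0 1)).const_smul) fun w hw => ?_
        have hle := (hcoupling w hw).one_add_pairSum_rpow_le hz (hU.imp (· w) (· w)) hs0 hs1.le
        rwa [mul_assoc (rot κ w)] at hle
    _ = k * (Real.circleAverage R 0 1 + 1) := by
        rw [Real.circleAverage_fun_smul,
          Real.circleAverage_fun_add hR (circleIntegrable_const _ _ _), Real.circleAverage_const,
          smul_eq_mul]
    _ ≤ avgConst (Module.finrank ℂ E) s c := by
        unfold avgConst
        gcongr
        exact circleAverage_norm_resBlock_self_rpow_le h.pair.right hDT hz hs0 hs1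

theorem IsCoupling.intervalAverage_one_add_pairSum_rpow_le (h : IsCoupling ι κ D T c)
    (hz : ‖z‖ ≠ 1) {s : ℝ} (hs0 : 0 < s) (hs1 : s < 1) {U : Circle → H →L[ℂ] H}
    (hU : (∀ w : Circle, U w = rot κ (w : ℂ) * D * T) ∨
      ∀ w : Circle, U w = T * (rot κ (w : ℂ) * D)) :
    ⨍ η in (0)..(2 * Real.pi), (1 + 2 * pairSum (U (Circle.exp η)) z ι κ) ^ s ≤
      avgConst (Module.finrank ℂ E) s c := by
  have hcircle : ∀ η, (Circle.exp η : ℂ) = circleMap 0 1 η := fun η => by simp [circleMap]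
  rcases hU with hU | hU
  · have hle := h.circleAverage_one_add_pairSum_rpow_le hz hs0 hs1 (Or.inl fun _ => rfl)
    rw [Real.circleAverage_eq_intervalAverage] at hle
    simpa only [hU, hcircle] using hle
  · have hle := h.circleAverage_one_add_pairSum_rpow_le hz hs0 hs1 (Or.inr fun _ => rfl)
    rw [Real.circleAverage_eq_intervalAverage] at hle
    simpa only [hU, hcircle] using hle

end Average

section Layers

variable {L : ℕ} {J : Set ℤ}

/-- The unitary group `U(2L)`, whose elements are regarded as matrices of four `L × L` blocks. -/
abbrev U2 (L : ℕ) : Type := Matrix.unitaryGroup (Fin L ⊕ Fin L) ℂ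

theorem norm_sq_toBlocks_apply (S : U2 L) (x y : EuclideanSpace ℂ (Fin L)) :
    ‖toEuclideanCLM (𝕜 := ℂ) S.1.toBlocks₁₁ x + toEuclideanCLM (𝕜 := ℂ) S.1.toBlocks₁₂ y‖ ^ 2 +
    ‖toEuclideanCLM (𝕜 := ℂ) S.1.toBlocks₂₁ x + toEuclideanCLM (𝕜 := ℂ) S.1.toBlocks₂₂ y‖ ^ 2 =
    ‖x‖ ^ 2 + ‖y‖ ^ 2 := by
  have hnorm := ContinuousLinearMap.norm_map_of_mem_unitary
    (Unitary.map_mem (toEuclideanCLM (n := Fin L ⊕ Fin L) (𝕜 := ℂ)) S.2)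
    (WithLp.toLp 2 (Sum.elim x.ofLp y.ofLp))
  have hsq := congrArg (· ^ 2) hnorm
  simp only [EuclideanSpace.norm_sq_eq, Fintype.sum_sum_type, toEuclideanCLM_toLp] at hsq ⊢
  conv at hsq =>
    lhs
    rw [← fromBlocks_toBlocks S.1, fromBlocks_mulVec]
  simpa using hsq

theorem specNorm_le_one {A : Matrix (Fin L) (Fin L) ℂ}
    (h : ∀ x, ‖toEuclideanCLM (𝕜 := ℂ) A x‖ ^ 2 ≤ ‖x‖ ^ 2) : specNorm A ≤ 1 :=
  ContinuousLinearMap.opNorm_le_bound _ zero_le_one fun x => by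
    rw [one_mul]
    exact le_of_sq_le_sq (h x) (norm_nonneg x)

theorem bddBlocks_unitary (S : ℤ → U2 L) : BddBlocks fun n => (S n).1 := by
  have hleft : ∀ n x, ‖toEuclideanCLM (𝕜 := ℂ) (S n).1.toBlocks₁₁ x‖ ^ 2 +
      ‖toEuclideanCLM (𝕜 := ℂ) (S n).1.toBlocks₂₁ x‖ ^ 2 = ‖x‖ ^ 2 := fun n x => by
    simpa using norm_sq_toBlocks_apply (S n) x 0
  have hright : ∀ n x, ‖toEuclideanCLM (𝕜 := ℂ) (S n).1.toBlocks₁₂ x‖ ^ 2 +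
      ‖toEuclideanCLM (𝕜 := ℂ) (S n).1.toBlocks₂₂ x‖ ^ 2 = ‖x‖ ^ 2 := fun n x => by
    simpa using norm_sq_toBlocks_apply (S n) 0 x
  exact ⟨1, fun n => ⟨specNorm_le_one fun x => (le_add_of_nonneg_right (sq_nonneg _)).trans_eq
      (hleft n x), specNorm_le_one fun x => (le_add_of_nonneg_right (sq_nonneg _)).trans_eq
      (hright n x), specNorm_le_one fun x => (le_add_of_nonneg_left (sq_nonneg _)).trans_eq
      (hleft n x), specNorm_le_one fun x => (le_add_of_nonneg_left (sq_nonneg _)).trans_eq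
      (hright n x)⟩⟩

/-- The layer of a family of unitary scattering matrices, for which the boundedness of the blocks
is automatic. -/
noncomputable def layerU (S : ℤ → U2 L) (Ub Vb : UL L) (J : Set ℤ) (e : ℤ) :
    Ell2 J L →L[ℂ] Ell2 J L :=
  layer (fun n => (S n).1) (bddBlocks_unitary S) Ub Vb J e

theorem layerU_apply (S : ℤ → U2 L) (Ub Vb : UL L) (J : Set ℤ) (e : ℤ) (v : Ell2 J L) (i : J) :
    layerU S Ub Vb J e v i = layerFun (fun n => (S n).1) Ub Vb J e v i := rfl

theorem even_add_one_sub (i e : ℤ) : Even (i + 1 - e) ↔ ¬ Even (i - e) := by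
  rw [add_sub_right_comm, Int.even_add_one]

theorem even_sub_one_sub (i e : ℤ) : Even (i - 1 - e) ↔ ¬ Even (i - e) := by
  rw [sub_right_comm, Int.even_sub_one]

theorem toBlocks_mul {n R : Type*} [Fintype n] [NonUnitalNonAssocSemiring R]
    (A B : Matrix (n ⊕ n) (n ⊕ n) R) :
    (A * B).toBlocks₁₁ = A.toBlocks₁₁ * B.toBlocks₁₁ + A.toBlocks₁₂ * B.toBlocks₂₁ ∧
    (A * B).toBlocks₁₂ = A.toBlocks₁₁ * B.toBlocks₁₂ + A.toBlocks₁₂ * B.toBlocks₂₂ ∧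
    (A * B).toBlocks₂₁ = A.toBlocks₂₁ * B.toBlocks₁₁ + A.toBlocks₂₂ * B.toBlocks₂₁ ∧
    (A * B).toBlocks₂₂ = A.toBlocks₂₁ * B.toBlocks₁₂ + A.toBlocks₂₂ * B.toBlocks₂₂ := by
  have hmul := fromBlocks_multiply A.toBlocks₁₁ A.toBlocks₁₂ A.toBlocks₂₁ A.toBlocks₂₂
    B.toBlocks₁₁ B.toBlocks₁₂ B.toBlocks₂₁ B.toBlocks₂₂
  rw [fromBlocks_toBlocks, fromBlocks_toBlocks] at hmul
  rw [hmul]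
  exact ⟨rfl, rfl, rfl, rfl⟩

theorem layerU_mul (S S' : ℤ → U2 L) (Ub Vb Ub' Vb' : UL L) (J : Set ℤ) (e : ℤ) :
    layerU S Ub Vb J e * layerU S' Ub' Vb' J e = layerU (S * S') (Ub * Ub') (Vb * Vb') J e := by
  ext1 v
  refine lp.ext (funext fun i => ?_)
  rw [mul_apply_eq_comp, layerU_apply, layerU_apply]
  obtain ⟨h11, h12, -, -⟩ := toBlocks_mul (S i).1 (S' i).1
  obtain ⟨-, -, h21, h22⟩ := toBlocks_mul (S (i - 1)).1 (S' (i - 1)).1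
  by_cases he : Even ((i : ℤ) - e)
  · by_cases hi : (i : ℤ) + 1 ∈ J
    · simp [layerFun, layerU_apply, he, hi, even_add_one_sub, h11, h12]
      abel
    · simp [layerFun, layerU_apply, he, hi]
  · by_cases hi : (i : ℤ) - 1 ∈ J
    · simp [layerFun, layerU_apply, he, hi, even_sub_one_sub, h21, h22]
      abel
    · simp [layerFun, layerU_apply, he, hi]

theorem toBlocks_one {n R : Type*} [DecidableEq n] [Zero R] [One R] :
    (1 : Matrix (n ⊕ n) (n ⊕ n) R).toBlocks₁₁ = 1 ∧ (1 : Matrix (n ⊕ n) (n ⊕ n) R).toBlocks₁₂ = 0 ∧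
    (1 : Matrix (n ⊕ n) (n ⊕ n) R).toBlocks₂₁ = 0 ∧
    (1 : Matrix (n ⊕ n) (n ⊕ n) R).toBlocks₂₂ = 1 := by
  rw [← fromBlocks_one]
  exact ⟨rfl, rfl, rfl, rfl⟩

theorem layerU_one (J : Set ℤ) (e : ℤ) : layerU (1 : ℤ → U2 L) 1 1 J e = 1 := by
  ext1 v
  refine lp.ext (funext fun i => ?_)
  rw [layerU_apply]
  obtain ⟨h11, h12, h21, h22⟩ := toBlocks_one (n := Fin L) (R := ℂ)
  by_cases he : Even ((i : ℤ) - e)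
  · by_cases hi : (i : ℤ) + 1 ∈ J
    · simp [layerFun, he, hi, h11, h12]
    · simp [layerFun, he, hi]
  · by_cases hi : (i : ℤ) - 1 ∈ J
    · simp [layerFun, he, hi, h21, h22]
    · simp [layerFun, he, hi]

theorem layerU_congr {S S' : ℤ → U2 L} (Ub Vb : UL L) {e : ℤ}
    (h : ∀ i, Even (i - e) → i ∈ J → i + 1 ∈ J → S i = S' i) :
    layerU S Ub Vb J e = layerU S' Ub Vb J e := by
  ext1 v
  refine lp.ext (funext fun i => ?_)
  rw [layerU_apply, layerU_apply]
  by_cases he : Even ((i : ℤ) - e)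
  · by_cases hi : (i : ℤ) + 1 ∈ J
    · simp [layerFun, he, hi, h i he i.2 hi]
    · simp [layerFun, he, hi]
  · by_cases hi : (i : ℤ) - 1 ∈ J
    · simp [layerFun, he, hi, h (i - 1) ((even_sub_one_sub _ _).mpr he) hi (by simp)]
    · simp [layerFun, he, hi]

theorem summable_norm_sq (v : Ell2 J L) : Summable fun i => ‖v i‖ ^ 2 := by
  simpa using (lp.memℓp v).summable (by norm_num)

theorem norm_sq_eq_tsum (v : Ell2 J L) : ‖v‖ ^ 2 = ∑' i, ‖v i‖ ^ 2 := by
  simpa using lp.norm_rpow_eq_tsum (by norm_num) v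

theorem tsum_eq_of_involutive {α : Type*} {σ : α → α} (hσ : Function.Involutive σ) {f g : α → ℝ}
    (hf : Summable f) (hg : Summable g) (h : ∀ i, f i + f (σ i) = g i + g (σ i)) :
    ∑' i, f i = ∑' i, g i := by
  have hdouble : ∀ {f : α → ℝ}, Summable f → ∑' i, (f i + f (σ i)) = 2 * ∑' i, f i := by
    intro f hf
    have hfσ : Summable fun i => f (σ i) := (hσ.toPerm.summable_iff (f := f)).mpr hf
    have htsum : ∑' i, f (σ i) = ∑' i, f i := hσ.toPerm.tsum_eq f
    rw [hf.tsum_add hfσ, htsum, two_mul]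
  have htwice := hdouble hf
  rw [tsum_congr h, hdouble hg] at htwice
  linarith

theorem norm_sq_layerU_add_partner (S : ℤ → U2 L) (Ub Vb : UL L) (J : Set ℤ) (e : ℤ)
    (v : Ell2 J L) (i : J) :
    ‖layerU S Ub Vb J e v i‖ ^ 2 + ‖layerU S Ub Vb J e v (partner J e i)‖ ^ 2 =
      ‖v i‖ ^ 2 + ‖v (partner J e i)‖ ^ 2 := by
  have hboundary : ∀ (U : UL L) x, ‖toEuclideanCLM (𝕜 := ℂ) U.1 x‖ = ‖x‖ := fun U =>
    ContinuousLinearMap.norm_map_of_mem_unitary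
      (Unitary.map_mem (toEuclideanCLM (n := Fin L) (𝕜 := ℂ)) U.2)
  simp only [layerU_apply]
  by_cases he : Even ((i : ℤ) - e)
  · by_cases hi : (i : ℤ) + 1 ∈ J
    · simpa [layerFun, partner, he, hi, even_add_one_sub] using
        norm_sq_toBlocks_apply (S i) (v i) (v ⟨i + 1, hi⟩)
    · simp [layerFun, partner, he, hi, hboundary]
  · by_cases hi : (i : ℤ) - 1 ∈ J
    · have hpair := norm_sq_toBlocks_apply (S (i - 1)) (v ⟨i - 1, hi⟩) (v i)
      rw [add_comm, add_comm (‖v ⟨i - 1, hi⟩‖ ^ 2)] at hpair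
      simpa [layerFun, partner, he, hi, even_sub_one_sub] using hpair
    · simp [layerFun, partner, he, hi, hboundary]

theorem norm_layerU_apply (S : ℤ → U2 L) (Ub Vb : UL L) (J : Set ℤ) (e : ℤ) (v : Ell2 J L) :
    ‖layerU S Ub Vb J e v‖ = ‖v‖ := by
  rw [← sq_eq_sq₀ (norm_nonneg _) (norm_nonneg _), norm_sq_eq_tsum, norm_sq_eq_tsum]
  exact tsum_eq_of_involutive (partner_involutive J e) (summable_norm_sq _) (summable_norm_sq _)
    (norm_sq_layerU_add_partner S Ub Vb J e v)

theorem layerU_mem_unitary (S : ℤ → U2 L) (Ub Vb : UL L) (J : Set ℤ) (e : ℤ) :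
    layerU S Ub Vb J e ∈ unitary (Ell2 J L →L[ℂ] Ell2 J L) := by
  have hright : layerU S Ub Vb J e * layerU S⁻¹ Ub⁻¹ Vb⁻¹ J e = 1 := by
    simp only [layerU_mul, mul_inv_cancel, layerU_one]
  have hleft : layerU S⁻¹ Ub⁻¹ Vb⁻¹ J e * layerU S Ub Vb J e = 1 := by
    simp only [layerU_mul, inv_mul_cancel, layerU_one]
  exact IsUnit.mem_unitary_of_star_mul_self ⟨⟨_, _, hright, hleft⟩, rfl⟩
    ((ContinuousLinearMap.norm_map_iff_adjoint_comp_self _).mp (norm_layerU_apply S Ub Vb J e))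

/-- The scattering zipper of a deterministic family of unitary scattering matrices. -/
noncomputable def zipU (S : ℤ → U2 L) (Ub Vb : UL L) (J : Set ℤ) : Ell2 J L →L[ℂ] Ell2 J L :=
  layerU S Ub Vb J 0 * layerU S Ub Vb J 1

theorem zipU_mem_unitary (S : ℤ → U2 L) (Ub Vb : UL L) (J : Set ℤ) :
    zipU S Ub Vb J ∈ unitary (Ell2 J L →L[ℂ] Ell2 J L) :=
  mul_mem (layerU_mem_unitary ..) (layerU_mem_unitary ..)

theorem zipU_congr {S S' : ℤ → U2 L} (Ub Vb : UL L)
    (h : ∀ i, i ∈ J → i + 1 ∈ J → S i = S' i) : zipU S Ub Vb J = zipU S' Ub Vb J := by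
  rw [zipU, zipU, layerU_congr Ub Vb fun i _ => h i, layerU_congr Ub Vb fun i _ => h i]

end Layers

section Sites

variable {L : ℕ} {J J' : Set ℤ}

/-- The inclusion of the fibre `ℂ^L` at the site `j` into `ℓ²(J, ℂ^L)`. -/
noncomputable def site (j : J) : EuclideanSpace ℂ (Fin L) →L[ℂ] Ell2 J L :=
  lp.singleContinuousLinearMap ℂ (fun _ : J => EuclideanSpace ℂ (Fin L)) 2 j

theorem site_apply (j : J) (a : EuclideanSpace ℂ (Fin L)) : site j a = lp.single 2 j a := rfl

theorem site_apply_self (j : J) (a : EuclideanSpace ℂ (Fin L)) : site j a j = a :=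
  lp.single_apply_self (E := fun _ : J => EuclideanSpace ℂ (Fin L)) 2 j a

theorem site_apply_ne {i j : J} (h : i ≠ j) (a : EuclideanSpace ℂ (Fin L)) : site j a i = 0 :=
  lp.single_apply_ne (E := fun _ : J => EuclideanSpace ℂ (Fin L)) 2 j a h

theorem adjoint_site_apply (j : J) (v : Ell2 J L) : ((site j)†) v = v j := by
  refine ext_inner_left ℂ fun a => ?_
  rw [ContinuousLinearMap.adjoint_inner_right, site_apply]
  exact lp.inner_single_left (𝕜 := ℂ) (G := fun _ : J => EuclideanSpace ℂ (Fin L)) j a v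

theorem adjoint_site_comp_site (j : J) : (site (L := L) j)† ∘L site j = 1 := by
  ext1 a
  rw [ContinuousLinearMap.comp_apply, adjoint_site_apply, site_apply_self, one_apply_eq_self]

theorem adjoint_site_comp_site_of_ne {i j : J} (h : i ≠ j) :
    (site (L := L) i)† ∘L site j = 0 := by
  ext1 a
  rw [ContinuousLinearMap.comp_apply, adjoint_site_apply, site_apply_ne h, _root_.zero_apply]

theorem isPair_site {i j : J} (h : i ≠ j) : IsPair (site (L := L) i) (site j) :=
  ⟨adjoint_site_comp_site i, adjoint_site_comp_site j, adjoint_site_comp_site_of_ne h⟩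

theorem eq_site_add_site {i j : J} (h : i ≠ j) {v : Ell2 J L}
    (hv : ∀ m, m ≠ i → m ≠ j → v m = 0) : v = site i (v i) + site j (v j) := by
  refine lp.ext (funext fun m => ?_)
  rw [lp.coeFn_add, Pi.add_apply]
  rcases eq_or_ne m i with rfl | hi
  · rw [site_apply_self, site_apply_ne h, add_zero]
  rcases eq_or_ne m j with rfl | hj
  · rw [site_apply_self, site_apply_ne hi, zero_add]
  · rw [hv m hi hj, site_apply_ne hi, site_apply_ne hj, add_zero]

/-- The restriction of a vector of `ℓ²(J, ℂ^L)` to a smaller set of sites. -/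
noncomputable def restr (h : J' ⊆ J) : Ell2 J L →L[ℂ] Ell2 J' L :=
  LinearMap.mkContinuous
    { toFun := fun v => ⟨fun i => v (Set.inclusion h i), memℓp_gen (by
        simpa [Function.comp_def] using
          (summable_norm_sq v).comp_injective (Set.inclusion_injective h))⟩
      map_add' := fun _ _ => by ext1; rfl
      map_smul' := fun _ _ => by ext1; rfl }
    1 (fun v => by
      rw [one_mul]
      refine le_of_sq_le_sq ?_ (norm_nonneg _)
      rw [norm_sq_eq_tsum, norm_sq_eq_tsum]
      exact tsum_comp_le_tsum_of_inj (summable_norm_sq v) (fun _ => by positivity)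
        (Set.inclusion_injective h))

theorem restr_apply (h : J' ⊆ J) (v : Ell2 J L) (i : J') : restr h v i = v (Set.inclusion h i) :=
  rfl

theorem restr_site (h : J' ⊆ J) (j : J') (a : EuclideanSpace ℂ (Fin L)) :
    restr h (site (Set.inclusion h j) a) = site j a := by
  refine lp.ext (funext fun i => ?_)
  rw [restr_apply]
  rcases eq_or_ne i j with rfl | hij
  · rw [site_apply_self, site_apply_self]
  · rw [site_apply_ne hij, site_apply_ne ((Set.inclusion_injective h).ne hij)]

theorem restr_site_of_notMem (h : J' ⊆ J) {j : J} (hj : (j : ℤ) ∉ J')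
    (a : EuclideanSpace ℂ (Fin L)) : restr h (site j a) = 0 := by
  refine lp.ext (funext fun i => ?_)
  rw [restr_apply, site_apply_ne (by rintro rfl; exact hj i.2)]
  rfl

end Sites

section Cut

variable {L : ℕ} {J J' : Set ℤ} {n : ℤ}

/-- The block-diagonal unitary matrix with blocks `A` and `B`. -/
def diagU (A B : UL L) : U2 L :=
  ⟨fromBlocks A.1 0 0 B.1, by
    have hA := mem_unitaryGroup_iff.mp A.2
    have hB := mem_unitaryGroup_iff.mp B.2
    rw [star_eq_conjTranspose] at hA hB
    rw [mem_unitaryGroup_iff, star_eq_conjTranspose, fromBlocks_conjTranspose,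
      fromBlocks_multiply]
    simp [hA, hB]⟩

/-- The family of scattering matrices in which the bond `(n, n + 1)` is cut: `S n` is replaced by
the two boundary conditions, which act separately on the sites `n` and `n + 1`. -/
def cut (S : ℤ → U2 L) (Ub Vb : UL L) (n : ℤ) : ℤ → U2 L := Function.update S n (diagU Vb Ub)

theorem cut_self (S : ℤ → U2 L) (Ub Vb : UL L) (n : ℤ) : cut S Ub Vb n n = diagU Vb Ub :=
  Function.update_self ..

theorem cut_of_ne (S : ℤ → U2 L) (Ub Vb : UL L) {i : ℤ} (h : i ≠ n) : cut S Ub Vb n i = S i :=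
  Function.update_of_ne h ..

/-- `J'` is one of the two sides of the bond `(n, n + 1)` of `J`, the other one being `J \ J'`: this
is the only bond of `J` that joins `J'` to its complement. -/
structure IsSide (J J' : Set ℤ) (n : ℤ) : Prop where
  subset : J' ⊆ J
  left_mem : n ∈ J
  right_mem : n + 1 ∈ J
  mem_iff : ∀ i ∈ J, i + 1 ∈ J → i ≠ n → (i ∈ J' ↔ i + 1 ∈ J')
  mem_iff_notMem : n ∈ J' ↔ n + 1 ∉ J'

theorem IsSide.diff (h : IsSide J J' n) : IsSide J (J \ J') n where
  subset := Set.sdiff_subset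
  left_mem := h.left_mem
  right_mem := h.right_mem
  mem_iff i hi hi' hin := by simp [hi, hi', h.mem_iff i hi hi' hin]
  mem_iff_notMem := by simp [h.left_mem, h.right_mem, h.mem_iff_notMem]

theorem isSide_inter_Iic (hn : n ∈ J) (hn' : n + 1 ∈ J) : IsSide J (J ∩ Set.Iic n) n where
  subset := Set.inter_subset_left
  left_mem := hn
  right_mem := hn'
  mem_iff i hi hi' hin := by
    simp only [Set.mem_inter_iff, hi, hi', Set.mem_Iic, true_and]
    omega
  mem_iff_notMem := by simp [hn]

theorem restr_layerU_cut (h : IsSide J J' n) (S : ℤ → U2 L) (Ub Vb : UL L) (e : ℤ)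
    (v : Ell2 J L) : restr h.subset (layerU (cut S Ub Vb n) Ub Vb J e v) =
      layerU (cut S Ub Vb n) Ub Vb J' e (restr h.subset v) := by
  refine lp.ext (funext fun i => ?_)
  rw [restr_apply, layerU_apply, layerU_apply]
  by_cases he : Even ((i : ℤ) - e)
  · by_cases hi' : (i : ℤ) + 1 ∈ J'
    · simp [layerFun, he, hi', h.subset hi', restr_apply, Set.inclusion]
    · by_cases hi : (i : ℤ) + 1 ∈ J
      · have hin : (i : ℤ) = n := by
          by_contra hin
          exact hi' ((h.mem_iff i (h.subset i.2) hi hin).mp i.2)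
        have hcut : cut S Ub Vb n (i : ℤ) = diagU Vb Ub := by rw [hin, cut_self]
        simp [layerFun, he, hi', hi, restr_apply, Set.inclusion, hcut, diagU]
      · simp [layerFun, he, hi', hi, restr_apply, Set.inclusion]
  · by_cases hi' : (i : ℤ) - 1 ∈ J'
    · simp [layerFun, he, hi', h.subset hi', restr_apply, Set.inclusion]
    · by_cases hi : (i : ℤ) - 1 ∈ J
      · have hin : (i : ℤ) - 1 = n := by
          by_contra hin
          exact hi' ((h.mem_iff _ hi (by simpa using h.subset i.2) hin).mpr (by simp))
        have hcut : cut S Ub Vb n ((i : ℤ) - 1) = diagU Vb Ub := by rw [hin, cut_self]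
        simp [layerFun, he, hi', hi, restr_apply, Set.inclusion, hcut, diagU]
      · simp [layerFun, he, hi', hi, restr_apply, Set.inclusion]

theorem IsSide.zipU_congr (h : IsSide J J' n) {S S' : ℤ → U2 L} (Ub Vb : UL L)
    (hS : ∀ i, i ≠ n → S i = S' i) : zipU S Ub Vb J' = zipU S' Ub Vb J' :=
  ScatteringZipper.zipU_congr Ub Vb fun i hi hi' =>
    hS i (by rintro rfl; exact h.mem_iff_notMem.mp hi hi')

theorem restr_zipU_cut (h : IsSide J J' n) (S : ℤ → U2 L) (Ub Vb : UL L) (v : Ell2 J L) :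
    restr h.subset (zipU (cut S Ub Vb n) Ub Vb J v) = zipU S Ub Vb J' (restr h.subset v) := by
  rw [← h.zipU_congr Ub Vb (S := cut S Ub Vb n) fun i hi => cut_of_ne S Ub Vb hi, zipU, zipU,
    mul_apply_eq_comp, mul_apply_eq_comp, restr_layerU_cut h, restr_layerU_cut h]

theorem restr_res_cut (h : IsSide J J' n) (S : ℤ → U2 L) (Ub Vb : UL L) {z : ℂ} (hz : ‖z‖ ≠ 1)
    (v : Ell2 J L) : restr h.subset (res (zipU (cut S Ub Vb n) Ub Vb J) z v) =
      res (zipU S Ub Vb J') z (restr h.subset v) := by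
  have hmap := congrArg (restr h.subset)
    (map_res_apply (zipU_mem_unitary (cut S Ub Vb n) Ub Vb J) hz v)
  rw [restr_zipU_cut h, map_add, map_smul] at hmap
  have hres := res_map_apply (zipU_mem_unitary S Ub Vb J') hz
    (restr h.subset (res (zipU (cut S Ub Vb n) Ub Vb J) z v))
  rw [hmap, map_add, map_smul] at hres
  exact (add_left_cancel hres).symm

theorem isSideEnergy_cut (h : IsSide J J' n) (S : ℤ → U2 L) (Ub Vb : UL L) (i : J') {j : J}
    (hj : (j : ℤ) ∉ J') :
    IsSideEnergy (site (Set.inclusion h.subset i)) (site j) (zipU (cut S Ub Vb n) Ub Vb J)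
      fun v => ‖restr h.subset v‖ ^ 2 - ‖restr h.subset v i‖ ^ 2 where
  nonneg v := sub_nonneg.mpr <| pow_le_pow_left₀ (norm_nonneg _)
    (lp.norm_apply_le_norm (p := 2) (by norm_num) (restr h.subset v) i) 2
  add_left v a := by
    rw [map_add, restr_site, lp.coeFn_add, Pi.add_apply, site_apply_self,
      norm_add_sq (𝕜 := ℂ), norm_add_sq (𝕜 := ℂ), ← ContinuousLinearMap.adjoint_inner_left,
      adjoint_site_apply, norm_isometry_apply (adjoint_site_comp_site i)]
    ring
  add_right v a := by rw [map_add, restr_site_of_notMem h.subset hj, add_zero]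
  smul c v := by
    simp only [map_smul, lp.coeFn_smul, Pi.smul_apply, norm_smul]
    ring
  energy v := by
    simp only [adjoint_site_apply, ← restr_apply, restr_zipU_cut h, sub_add_cancel,
      norm_apply_of_mem_unitary (zipU_mem_unitary S Ub Vb J')]

/-- The block `(k, l)` of the resolvent of a zipper of unitary scattering matrices, as an operator
on `ℂ^L`. -/
noncomputable def greenU (S : ℤ → U2 L) (Ub Vb : UL L) (J : Set ℤ) (z : ℂ) (k l : J) :
    EuclideanSpace ℂ (Fin L) →L[ℂ] EuclideanSpace ℂ (Fin L) :=
  (site k)† ∘L res (zipU S Ub Vb J) z ∘L site l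

theorem IsSide.greenU_congr (h : IsSide J J' n) {S S' : ℤ → U2 L} (Ub Vb : UL L)
    (hS : ∀ i, i ≠ n → S i = S' i) (z : ℂ) (k l : J') :
    greenU S Ub Vb J' z k l = greenU S' Ub Vb J' z k l := by
  rw [greenU, greenU, h.zipU_congr Ub Vb hS]

theorem IsSide.greenU_cut (h : IsSide J J' n) (S : ℤ → U2 L) (Ub Vb : UL L) {z : ℂ}
    (hz : ‖z‖ ≠ 1) (k l : J') :
    greenU (cut S Ub Vb n) Ub Vb J z (Set.inclusion h.subset k) (Set.inclusion h.subset l) =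
      greenU S Ub Vb J' z k l := by
  ext1 a
  simp only [greenU, ContinuousLinearMap.comp_apply, adjoint_site_apply]
  rw [← restr_apply, restr_res_cut h S Ub Vb hz, restr_site]

theorem IsSide.greenU_cut_eq_zero (h : IsSide J J' n) (S : ℤ → U2 L) (Ub Vb : UL L) {z : ℂ}
    (hz : ‖z‖ ≠ 1) (k : J') {l : J} (hl : (l : ℤ) ∉ J') :
    greenU (cut S Ub Vb n) Ub Vb J z (Set.inclusion h.subset k) l = 0 := by
  ext1 a
  simp only [greenU, ContinuousLinearMap.comp_apply, adjoint_site_apply]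
  rw [← restr_apply, restr_res_cut h S Ub Vb hz, restr_site_of_notMem h.subset hl, map_zero]
  rfl

end Cut

section Bond

variable {L : ℕ} {J : Set ℤ} {n : ℤ}

/-- The operator acting by `M` on the sites `n, n + 1` and trivially elsewhere. -/
noncomputable def bondOp (J : Set ℤ) (n : ℤ) (M : U2 L) (e : ℤ) : Ell2 J L →L[ℂ] Ell2 J L :=
  layerU (Function.update 1 n M) 1 1 J e

theorem bondOp_mul (n : ℤ) (M M' : U2 L) (e : ℤ) :
    bondOp J n M e * bondOp J n M' e = bondOp J n (M * M') e := by
  rw [bondOp, bondOp, layerU_mul, one_mul, bondOp]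
  congr 1
  funext i
  by_cases hi : i = n
  · subst hi; simp
  · simp [hi]

theorem bondOp_mem_unitary (n : ℤ) (M : U2 L) (e : ℤ) :
    bondOp J n M e ∈ unitary (Ell2 J L →L[ℂ] Ell2 J L) := layerU_mem_unitary ..

theorem bondOp_apply_left {e : ℤ} (hn : n ∈ J) (hn' : n + 1 ∈ J) (he : Even (n - e)) (M : U2 L)
    (v : Ell2 J L) : bondOp J n M e v ⟨n, hn⟩ =
      toEuclideanCLM (𝕜 := ℂ) M.1.toBlocks₁₁ (v ⟨n, hn⟩) +
      toEuclideanCLM (𝕜 := ℂ) M.1.toBlocks₁₂ (v ⟨n + 1, hn'⟩) := by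
  rw [bondOp, layerU_apply]
  simp [layerFun, he, hn']

theorem bondOp_apply_right {e : ℤ} (hn : n ∈ J) (hn' : n + 1 ∈ J) (he : Even (n - e)) (M : U2 L)
    (v : Ell2 J L) : bondOp J n M e v ⟨n + 1, hn'⟩ =
      toEuclideanCLM (𝕜 := ℂ) M.1.toBlocks₂₁ (v ⟨n, hn⟩) +
      toEuclideanCLM (𝕜 := ℂ) M.1.toBlocks₂₂ (v ⟨n + 1, hn'⟩) := by
  rw [bondOp, layerU_apply]
  simp [layerFun, he, hn, even_add_one_sub]

theorem bondOp_apply_of_ne {e : ℤ} (M : U2 L) (v : Ell2 J L) {i : J}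
    (hi : (i : ℤ) ≠ n) (hi' : (i : ℤ) ≠ n + 1) : bondOp J n M e v i = v i := by
  have hi'' : (i : ℤ) - 1 ≠ n := fun h => hi' (by linarith)
  have hone : bondOp J n M e v i = layerU (1 : ℤ → U2 L) 1 1 J e v i := by
    rw [bondOp, layerU_apply, layerU_apply]
    simp [layerFun, Function.update_of_ne hi, Function.update_of_ne hi'']
  rw [hone, layerU_one, one_apply_eq_self]

theorem left_ne_right (hn : n ∈ J) (hn' : n + 1 ∈ J) : (⟨n, hn⟩ : J) ≠ ⟨n + 1, hn'⟩ := by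
  simp

theorem isLocal_bondOp {e : ℤ} (hn : n ∈ J) (hn' : n + 1 ∈ J) (he : Even (n - e)) (M : U2 L) :
    IsLocal (site ⟨n, hn⟩) (site ⟨n + 1, hn'⟩) (bondOp J n M e) := by
  refine ⟨fun x => ?_, fun x hx hx' => ?_⟩
  · simp only [adjoint_site_apply]
    refine eq_site_add_site (left_ne_right hn hn') fun m hm hm' => ?_
    rw [lp.coeFn_sub, Pi.sub_apply, bondOp_apply_of_ne, sub_self]
    · exact fun h => hm (Subtype.ext h)
    · exact fun h => hm' (Subtype.ext h)
  · rw [adjoint_site_apply] at hx hx'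
    refine lp.ext (funext fun i => ?_)
    by_cases hi : (i : ℤ) = n
    · obtain rfl : i = ⟨n, hn⟩ := Subtype.ext hi
      rw [bondOp_apply_left hn hn' he, hx, hx', map_zero, map_zero, add_zero]
    by_cases hi' : (i : ℤ) = n + 1
    · obtain rfl : i = ⟨n + 1, hn'⟩ := Subtype.ext hi'
      rw [bondOp_apply_right hn hn' he, hx, hx', map_zero, map_zero, add_zero]
    · exact bondOp_apply_of_ne M x hi hi'

theorem norm_bondOp_block {e : ℤ} (hn : n ∈ J) (hn' : n + 1 ∈ J) (he : Even (n - e)) (M : U2 L) :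
    ‖(site ⟨n, hn⟩)† ∘L bondOp J n M e ∘L site ⟨n, hn⟩‖ = specNorm M.1.toBlocks₁₁ := by
  rw [specNorm]
  congr 1
  ext1 a
  rw [ContinuousLinearMap.comp_apply, ContinuousLinearMap.comp_apply, adjoint_site_apply,
    bondOp_apply_left hn hn' he, site_apply_self, site_apply_ne (left_ne_right hn hn').symm,
    map_zero, add_zero]

/-- The scalar unitary matrix `w`. -/
def scalarU (L : ℕ) (w : Circle) : UL L :=
  ⟨(w : ℂ) • 1, by
    rw [mem_unitaryGroup_iff, star_smul, star_one, smul_mul_smul_comm, one_mul, Complex.star_def,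
      Complex.mul_conj, Circle.normSq_coe, Complex.ofReal_one, one_smul]⟩

theorem scalarU_mul_comm (w : Circle) (A : UL L) : scalarU L w * A = A * scalarU L w := by
  apply Subtype.ext
  change ((w : ℂ) • (1 : Matrix (Fin L) (Fin L) ℂ)) * A.1 = A.1 * ((w : ℂ) • 1)
  simp

theorem bondOp_diagU_scalarU {e : ℤ} (hn : n ∈ J) (hn' : n + 1 ∈ J) (he : Even (n - e))
    (w : Circle) : bondOp J n (diagU 1 (scalarU L w)) e = rot (site ⟨n + 1, hn'⟩) (w : ℂ) := by
  ext1 v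
  refine lp.ext (funext fun i => ?_)
  rw [rot_apply, adjoint_site_apply, lp.coeFn_add, Pi.add_apply, lp.coeFn_smul, Pi.smul_apply]
  by_cases hi : (i : ℤ) = n
  · obtain rfl : i = ⟨n, hn⟩ := Subtype.ext hi
    rw [bondOp_apply_left hn hn' he, site_apply_ne (left_ne_right hn hn')]
    simp [diagU]
  by_cases hi' : (i : ℤ) = n + 1
  · obtain rfl : i = ⟨n + 1, hn'⟩ := Subtype.ext hi'
    rw [bondOp_apply_right hn hn' he, site_apply_self]
    simp [diagU, scalarU, sub_smul]
  · rw [bondOp_apply_of_ne _ v hi hi', site_apply_ne (by rintro rfl; exact hi' rfl), smul_zero,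
      add_zero]

theorem diagU_mul (A B A' B' : UL L) : diagU A B * diagU A' B' = diagU (A * A') (B * B') := by
  apply Subtype.ext
  change fromBlocks _ _ _ _ * fromBlocks _ _ _ _ = fromBlocks _ _ _ _
  rw [fromBlocks_multiply]
  simp

theorem diagU_inv (A B : UL L) : (diagU A B)⁻¹ = diagU A⁻¹ B⁻¹ := by
  rw [inv_eq_iff_mul_eq_one, diagU_mul, mul_inv_cancel, mul_inv_cancel]
  apply Subtype.ext
  change fromBlocks _ _ _ _ = _
  simp

theorem specNorm_toBlocks_mul_diagU_le (M : U2 L) (A B : UL L) :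
    specNorm (M * diagU A B).1.toBlocks₁₁ ≤ specNorm M.1.toBlocks₁₁ := by
  have hmul : (M * diagU A B).1.toBlocks₁₁ = M.1.toBlocks₁₁ * A.1 := by
    change (M.1 * (diagU A B).1).toBlocks₁₁ = _
    rw [(toBlocks_mul ..).1]
    simp [diagU]
  rw [hmul]
  exact (specNorm_mul_le _ _).trans (mul_le_of_le_one_right (norm_nonneg _) (specNorm_unitary_le A))

theorem specNorm_toBlocks_diagU_mul_le (M : U2 L) (A B : UL L) :
    specNorm (diagU A B * M).1.toBlocks₁₁ ≤ specNorm M.1.toBlocks₁₁ := by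
  have hmul : (diagU A B * M).1.toBlocks₁₁ = A.1 * M.1.toBlocks₁₁ := by
    change ((diagU A B).1 * M.1).toBlocks₁₁ = _
    rw [(toBlocks_mul ..).1]
    simp [diagU]
  rw [hmul]
  exact (specNorm_mul_le _ _).trans (mul_le_of_le_one_left (norm_nonneg _) (specNorm_unitary_le A))

theorem layerU_eq_bondOp_mul (S : ℤ → U2 L) (Ub Vb : UL L) (n e : ℤ) :
    layerU S Ub Vb J e =
      bondOp J n (S n * (diagU Vb Ub)⁻¹) e * layerU (cut S Ub Vb n) Ub Vb J e := by
  rw [bondOp, layerU_mul, one_mul, one_mul]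
  congr 1
  funext i
  by_cases hi : i = n
  · subst hi; simp [cut]
  · simp [hi, cut]

theorem layerU_eq_mul_bondOp (S : ℤ → U2 L) (Ub Vb : UL L) (n e : ℤ) :
    layerU S Ub Vb J e =
      layerU (cut S Ub Vb n) Ub Vb J e * bondOp J n ((diagU Vb Ub)⁻¹ * S n) e := by
  rw [bondOp, layerU_mul, mul_one, mul_one]
  congr 1
  funext i
  by_cases hi : i = n
  · subst hi; simp [cut]
  · simp [hi, cut]

theorem layerU_eq_cut (S : ℤ → U2 L) (Ub Vb : UL L) {e : ℤ} (he : ¬ Even (n - e)) :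
    layerU S Ub Vb J e = layerU (cut S Ub Vb n) Ub Vb J e :=
  layerU_congr Ub Vb fun i hi _ _ =>
    (cut_of_ne S Ub Vb (by rintro rfl; exact he hi)).symm

theorem zipU_of_even (S : ℤ → U2 L) (Ub Vb : UL L) (hn : Even n) :
    zipU S Ub Vb J =
      bondOp J n (S n * (diagU Vb Ub)⁻¹) 0 * zipU (cut S Ub Vb n) Ub Vb J := by
  have hn' : ¬ Even (n - 1) := by simpa [Int.even_sub_one] using hn
  rw [zipU, layerU_eq_bondOp_mul S Ub Vb n 0, layerU_eq_cut S Ub Vb hn', mul_assoc, zipU]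

theorem zipU_of_odd (S : ℤ → U2 L) (Ub Vb : UL L) (hn : ¬ Even n) :
    zipU S Ub Vb J =
      zipU (cut S Ub Vb n) Ub Vb J * bondOp J n ((diagU Vb Ub)⁻¹ * S n) 1 := by
  have hn' : ¬ Even (n - 0) := by simpa using hn
  rw [zipU, layerU_eq_mul_bondOp S Ub Vb n 1, layerU_eq_cut S Ub Vb hn', ← mul_assoc, zipU]

/-- The family of scattering matrices in which the phase of the lower row of `S n`, that is, of the
amplitude scattered to the site `n + 1`, is rotated. -/
def rotS (S : ℤ → U2 L) (n : ℤ) (w : Circle) : ℤ → U2 L :=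
  Function.update S n (diagU 1 (scalarU L w) * S n)

theorem rotS_of_ne (S : ℤ → U2 L) {i : ℤ} (h : i ≠ n) (w : Circle) : rotS S n w i = S i :=
  Function.update_of_ne h ..

theorem cut_rotS (S : ℤ → U2 L) (Ub Vb : UL L) (n : ℤ) (w : Circle) :
    cut (rotS S n w) Ub Vb n = cut S Ub Vb n := by
  simp [cut, rotS]

theorem zipU_rotS_of_even (S : ℤ → U2 L) (Ub Vb : UL L) (hn : n ∈ J) (hn' : n + 1 ∈ J)
    (heven : Even n) (w : Circle) : zipU (rotS S n w) Ub Vb J =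
      rot (site ⟨n + 1, hn'⟩) (w : ℂ) * bondOp J n (S n * (diagU Vb Ub)⁻¹) 0 *
        zipU (cut S Ub Vb n) Ub Vb J := by
  rw [zipU_of_even _ _ _ heven, cut_rotS,
    ← bondOp_diagU_scalarU hn hn' (e := 0) (by simpa using heven), bondOp_mul, rotS,
    Function.update_self, mul_assoc]

theorem zipU_rotS_of_odd (S : ℤ → U2 L) (Ub Vb : UL L) (hn : n ∈ J) (hn' : n + 1 ∈ J)
    (hodd : ¬ Even n) (w : Circle) : zipU (rotS S n w) Ub Vb J =
      zipU (cut S Ub Vb n) Ub Vb J *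
        (rot (site ⟨n + 1, hn'⟩) (w : ℂ) * bondOp J n ((diagU Vb Ub)⁻¹ * S n) 1) := by
  rw [zipU_of_odd _ _ _ hodd, cut_rotS,
    ← bondOp_diagU_scalarU hn hn' (e := 1) (by rwa [Int.even_sub_one]), bondOp_mul, rotS,
    Function.update_self, ← mul_assoc, ← mul_assoc, diagU_inv, diagU_mul, diagU_mul,
    scalarU_mul_comm, one_mul, mul_one]

theorem isCoupling_bondOp (S : ℤ → U2 L) (Ub Vb : UL L) (hn : n ∈ J) (hn' : n + 1 ∈ J) {M : U2 L}
    {e : ℤ} (he : Even (n - e)) {c : ℝ} (hM : specNorm M.1.toBlocks₁₁ ≤ c) (hc : c < 1) :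
    IsCoupling (site ⟨n, hn⟩) (site ⟨n + 1, hn'⟩) (bondOp J n M e)
      (zipU (cut S Ub Vb n) Ub Vb J) c where
  pair := isPair_site (left_ne_right hn hn')
  isLocal := isLocal_bondOp hn hn' he M
  mem_unitary := bondOp_mem_unitary ..
  mem_unitary' := zipU_mem_unitary ..
  energy_left := ⟨_, isSideEnergy_cut (isSide_inter_Iic hn hn') S Ub Vb ⟨n, by simpa using hn⟩
    (j := ⟨n + 1, hn'⟩) (by simp)⟩
  energy_right := ⟨_, isSideEnergy_cut (isSide_inter_Iic hn hn').diff S Ub Vb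
    ⟨n + 1, by simpa using hn'⟩ (j := ⟨n, hn⟩) (by simp [hn])⟩
  norm_le := (norm_bondOp_block hn hn' he M).trans_le hM
  lt_one := hc

theorem intervalAverage_pairSum_zipU_rotS_le (S : ℤ → U2 L) (Ub Vb : UL L) (hn : n ∈ J)
    (hn' : n + 1 ∈ J) {c : ℝ} (hS : specNorm (S n).1.toBlocks₁₁ ≤ c) (hc : c < 1) {z : ℂ}
    (hz : ‖z‖ ≠ 1) {s : ℝ} (hs0 : 0 < s) (hs1 : s < 1) :
    ⨍ η in (0)..(2 * Real.pi), (1 + 2 * pairSum (zipU (rotS S n (Circle.exp η)) Ub Vb J) z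
      (site ⟨n, hn⟩) (site ⟨n + 1, hn'⟩)) ^ s ≤ avgConst L s c := by
  by_cases heven : Even n
  · have hM := (specNorm_toBlocks_mul_diagU_le (S n) Vb⁻¹ Ub⁻¹).trans hS
    rw [← diagU_inv] at hM
    have hle := (isCoupling_bondOp S Ub Vb hn hn' (e := 0) (by simpa using heven) hM
      hc).intervalAverage_one_add_pairSum_rpow_le hz hs0 hs1
        (U := fun w => zipU (rotS S n w) Ub Vb J)
        (Or.inl (zipU_rotS_of_even S Ub Vb hn hn' heven))
    rwa [finrank_euclideanSpace_fin] at hle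
  · have hM := (specNorm_toBlocks_diagU_mul_le (S n) Vb⁻¹ Ub⁻¹).trans hS
    rw [← diagU_inv] at hM
    have hle := (isCoupling_bondOp S Ub Vb hn hn' (e := 1) (by rwa [Int.even_sub_one]) hM
      hc).intervalAverage_one_add_pairSum_rpow_le hz hs0 hs1
        (U := fun w => zipU (rotS S n w) Ub Vb J)
        (Or.inr (zipU_rotS_of_odd S Ub Vb hn hn' heven))
    rwa [finrank_euclideanSpace_fin] at hle

end Bond

section Decoupling

variable {L : ℕ} {J J' : Set ℤ} {n : ℤ} {z : ℂ}

theorem exists_isLocal_zipU_eq (S : ℤ → U2 L) (Ub Vb : UL L) (hn : n ∈ J) (hn' : n + 1 ∈ J) :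
    ∃ D : Ell2 J L →L[ℂ] Ell2 J L, IsLocal (site ⟨n, hn⟩) (site ⟨n + 1, hn'⟩) D ∧
      D ∈ unitary (Ell2 J L →L[ℂ] Ell2 J L) ∧
      (zipU S Ub Vb J = D * zipU (cut S Ub Vb n) Ub Vb J ∨
        zipU S Ub Vb J = zipU (cut S Ub Vb n) Ub Vb J * D) := by
  by_cases heven : Even n
  · exact ⟨_, isLocal_bondOp hn hn' (by simpa using heven) _, bondOp_mem_unitary _ _ _,
      Or.inl (zipU_of_even S Ub Vb heven)⟩
  · exact ⟨_, isLocal_bondOp hn hn' (by rwa [Int.even_sub_one]) _, bondOp_mem_unitary _ _ _,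
      Or.inr (zipU_of_odd S Ub Vb heven)⟩

theorem IsSide.exists_isLocal_zipU_eq (h : IsSide J J' n) (S : ℤ → U2 L) (Ub Vb : UL L) (z : ℂ)
    {i : J'} (hi : (i : ℤ) = n ∨ (i : ℤ) = n + 1) :
    ∃ (j : J) (D : Ell2 J L →L[ℂ] Ell2 J L), (j : ℤ) ∉ J' ∧
      IsLocal (site (Set.inclusion h.subset i)) (site j) D ∧
      D ∈ unitary (Ell2 J L →L[ℂ] Ell2 J L) ∧
      (zipU S Ub Vb J = D * zipU (cut S Ub Vb n) Ub Vb J ∨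
        zipU S Ub Vb J = zipU (cut S Ub Vb n) Ub Vb J * D) ∧
      pairSum (zipU S Ub Vb J) z (site (Set.inclusion h.subset i)) (site j) =
        pairSum (zipU S Ub Vb J) z (site ⟨n, h.left_mem⟩) (site ⟨n + 1, h.right_mem⟩) := by
  obtain ⟨D, hD, hDu, hDT⟩ :=
    ScatteringZipper.exists_isLocal_zipU_eq S Ub Vb h.left_mem h.right_mem
  rcases hi with hi | hi
  · have hincl : Set.inclusion h.subset i = ⟨n, h.left_mem⟩ := Subtype.ext hi
    refine ⟨⟨n + 1, h.right_mem⟩, D, h.mem_iff_notMem.mp (hi ▸ i.2), ?_, hDu, hDT, ?_⟩ <;>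
      rw [hincl]
    exact hD
  · have hincl : Set.inclusion h.subset i = ⟨n + 1, h.right_mem⟩ := Subtype.ext hi
    refine ⟨⟨n, h.left_mem⟩, D, fun hn => h.mem_iff_notMem.mp hn (hi ▸ i.2), ?_, hDu, hDT, ?_⟩ <;>
      rw [hincl]
    exacts [hD.symm, pairSum_comm ..]

theorem IsSide.norm_greenU_row_le (h : IsSide J J' n) (S : ℤ → U2 L) (Ub Vb : UL L)
    (hz : ‖z‖ ≠ 1) {i x : J'} (hi : (i : ℤ) = n ∨ (i : ℤ) = n + 1) (hx : x ≠ i) :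
    ‖greenU S Ub Vb J z (Set.inclusion h.subset i) (Set.inclusion h.subset x)‖ ≤
      (1 + 2 * pairSum (zipU S Ub Vb J) z (site ⟨n, h.left_mem⟩) (site ⟨n + 1, h.right_mem⟩)) *
        ‖greenU S Ub Vb J' z i x‖ := by
  obtain ⟨j, D, hj, hD, hDu, hDT, hsum⟩ := h.exists_isLocal_zipU_eq S Ub Vb z hi
  have hxi := (Set.inclusion_injective h.subset).ne hx
  have hij : Set.inclusion h.subset i ≠ j := by rintro rfl; exact hj i.2
  have hxj : Set.inclusion h.subset x ≠ j := by rintro rfl; exact hj x.2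
  have hzero : greenU (cut S Ub Vb n) Ub Vb J z j (Set.inclusion h.subset x) = 0 :=
    h.diff.greenU_cut_eq_zero S Ub Vb hz ⟨j, j.2, hj⟩ (by simp)
  have hTu := zipU_mem_unitary (cut S Ub Vb n) Ub Vb J
  rw [← hsum, ← h.greenU_cut S Ub Vb hz, greenU, greenU]
  rcases hDT with hDT | hDT <;> rw [hDT]
  · exact norm_row_mul_left_le (isPair_site hij) hD hDu hTu hz
      (adjoint_site_comp_site_of_ne hxi.symm) (adjoint_site_comp_site_of_ne hxj.symm) hzero
  · exact norm_row_mul_right_le (isPair_site hij) hD hDu hTu hz hzero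

theorem IsSide.norm_greenU_col_le (h : IsSide J J' n) (S : ℤ → U2 L) (Ub Vb : UL L)
    (hz : ‖z‖ ≠ 1) {i x : J'} (hi : (i : ℤ) = n ∨ (i : ℤ) = n + 1) (hx : x ≠ i) :
    ‖greenU S Ub Vb J z (Set.inclusion h.subset x) (Set.inclusion h.subset i)‖ ≤
      (1 + 2 * pairSum (zipU S Ub Vb J) z (site ⟨n, h.left_mem⟩) (site ⟨n + 1, h.right_mem⟩)) *
        ‖greenU S Ub Vb J' z x i‖ := by
  obtain ⟨j, D, hj, hD, hDu, hDT, hsum⟩ := h.exists_isLocal_zipU_eq S Ub Vb z hi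
  have hxi := (Set.inclusion_injective h.subset).ne hx
  have hij : Set.inclusion h.subset i ≠ j := by rintro rfl; exact hj i.2
  have hxj : Set.inclusion h.subset x ≠ j := by rintro rfl; exact hj x.2
  have hzero : greenU (cut S Ub Vb n) Ub Vb J z (Set.inclusion h.subset x) j = 0 :=
    h.greenU_cut_eq_zero S Ub Vb hz x hj
  have hTu := zipU_mem_unitary (cut S Ub Vb n) Ub Vb J
  rw [← hsum, ← h.greenU_cut S Ub Vb hz, greenU, greenU]
  rcases hDT with hDT | hDT <;> rw [hDT]
  · exact norm_col_mul_left_le (isPair_site hij) hD hDu hTu hz hzero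
  · exact norm_col_mul_right_le (isPair_site hij) hD hDu hTu hz
      (adjoint_site_comp_site_of_ne hxi.symm) (adjoint_site_comp_site_of_ne hxj.symm) hzero

theorem continuous_zipU_rotS (S : ℤ → U2 L) (Ub Vb : UL L) (hn : n ∈ J) (hn' : n + 1 ∈ J) :
    Continuous fun w => zipU (rotS S n w) Ub Vb J := by
  have hrot := (differentiable_rot (site (L := L) ⟨n + 1, hn'⟩)).continuous
  by_cases heven : Even n
  · simp only [zipU_rotS_of_even S Ub Vb hn hn' heven]
    fun_prop
  · simp only [zipU_rotS_of_odd S Ub Vb hn hn' heven]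
    fun_prop

theorem intervalAverage_rpow_le_of_le_pairSum (S : ℤ → U2 L) (Ub Vb : UL L) (hn : n ∈ J)
    (hn' : n + 1 ∈ J) {c : ℝ} (hS : specNorm (S n).1.toBlocks₁₁ ≤ c) (hc : c < 1) (hz : ‖z‖ ≠ 1)
    {s : ℝ} (hs0 : 0 < s) (hs1 : s < 1) {f : Circle → ℝ} (hf : Continuous f) (hf0 : ∀ w, 0 ≤ f w)
    {b : ℝ} (hb : 0 ≤ b) (hfb : ∀ w, f w ≤ (1 + 2 * pairSum (zipU (rotS S n w) Ub Vb J) z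
      (site ⟨n, hn⟩) (site ⟨n + 1, hn'⟩)) * b) :
    ⨍ η in (0)..(2 * Real.pi), f (Circle.exp η) ^ s ≤ avgConst L s c * b ^ s := by
  set P := fun w => 1 + 2 * pairSum (zipU (rotS S n w) Ub Vb J) z (site ⟨n, hn⟩)
    (site ⟨n + 1, hn'⟩)
  have hP0 : ∀ w, 0 ≤ P w := fun w => by
    have := pairSum_nonneg (zipU (rotS S n w) Ub Vb J) z (site ⟨n, hn⟩) (site ⟨n + 1, hn'⟩)
    positivity
  have hP : Continuous P := by
    have := continuousOn_univ.mp <| continuousOn_pairSum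
      (continuous_zipU_rotS S Ub Vb hn hn').continuousOn (fun _ _ => zipU_mem_unitary _ _ _ _) hz
      (site ⟨n, hn⟩) (site ⟨n + 1, hn'⟩)
    fun_prop
  have hfs : Continuous fun η => f (Circle.exp η) ^ s :=
    (hf.comp Circle.exp.continuous).rpow_const fun _ => Or.inr hs0.le
  have hPs : Continuous fun η => P (Circle.exp η) ^ s :=
    (hP.comp Circle.exp.continuous).rpow_const fun _ => Or.inr hs0.le
  calc ⨍ η in (0)..(2 * Real.pi), f (Circle.exp η) ^ s
      ≤ (⨍ η in (0)..(2 * Real.pi), P (Circle.exp η) ^ s) * b ^ s := by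
        rw [interval_average_eq, interval_average_eq, smul_mul_assoc,
          ← intervalIntegral.integral_mul_const]
        refine smul_le_smul_of_nonneg_left (intervalIntegral.integral_mono_on Real.two_pi_pos.le
          (hfs.intervalIntegrable _ _) ((hPs.mul_const _).intervalIntegrable _ _) fun η _ => ?_)
          (inv_nonneg.mpr (sub_nonneg.mpr Real.two_pi_pos.le))
        rw [← Real.mul_rpow (hP0 _) hb]
        exact Real.rpow_le_rpow (hf0 _) (hfb _) hs0.le
    _ ≤ avgConst L s c * b ^ s := by
        gcongr
        exact intervalAverage_pairSum_zipU_rotS_le S Ub Vb hn hn' hS hc hz hs0 hs1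

theorem continuous_greenU_rotS (S : ℤ → U2 L) (Ub Vb : UL L) (hn : n ∈ J) (hn' : n + 1 ∈ J)
    (hz : ‖z‖ ≠ 1) (k l : J) : Continuous fun w => greenU (rotS S n w) Ub Vb J z k l := by
  have := continuousOn_univ.mp <| continuousOn_res
    (continuous_zipU_rotS S Ub Vb hn hn').continuousOn (fun _ _ => zipU_mem_unitary _ _ _ _) hz
  unfold greenU
  fun_prop

theorem IsSide.intervalAverage_norm_greenU_row_le (h : IsSide J J' n) (S : ℤ → U2 L) (Ub Vb : UL L)
    {c : ℝ} (hS : specNorm (S n).1.toBlocks₁₁ ≤ c) (hc : c < 1) (hz : ‖z‖ ≠ 1)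
    {s : ℝ} (hs0 : 0 < s) (hs1 : s < 1) {i x : J'} (hi : (i : ℤ) = n ∨ (i : ℤ) = n + 1)
    (hx : x ≠ i) :
    ⨍ η in (0)..(2 * Real.pi), ‖greenU (rotS S n (Circle.exp η)) Ub Vb J z
        (Set.inclusion h.subset i) (Set.inclusion h.subset x)‖ ^ s ≤
      avgConst L s c * ‖greenU S Ub Vb J' z i x‖ ^ s := by
  refine intervalAverage_rpow_le_of_le_pairSum S Ub Vb h.left_mem h.right_mem hS hc hz hs0 hs1
    (continuous_greenU_rotS S Ub Vb h.left_mem h.right_mem hz _ _).norm (fun _ => norm_nonneg _)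
    (norm_nonneg _) fun w => ?_
  rw [← h.greenU_congr Ub Vb fun m hm => rotS_of_ne S hm w]
  exact h.norm_greenU_row_le _ Ub Vb hz hi hx

theorem IsSide.intervalAverage_norm_greenU_col_le (h : IsSide J J' n) (S : ℤ → U2 L) (Ub Vb : UL L)
    {c : ℝ} (hS : specNorm (S n).1.toBlocks₁₁ ≤ c) (hc : c < 1) (hz : ‖z‖ ≠ 1)
    {s : ℝ} (hs0 : 0 < s) (hs1 : s < 1) {i x : J'} (hi : (i : ℤ) = n ∨ (i : ℤ) = n + 1)
    (hx : x ≠ i) :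
    ⨍ η in (0)..(2 * Real.pi), ‖greenU (rotS S n (Circle.exp η)) Ub Vb J z
        (Set.inclusion h.subset x) (Set.inclusion h.subset i)‖ ^ s ≤
      avgConst L s c * ‖greenU S Ub Vb J' z x i‖ ^ s := by
  refine intervalAverage_rpow_le_of_le_pairSum S Ub Vb h.left_mem h.right_mem hS hc hz hs0 hs1
    (continuous_greenU_rotS S Ub Vb h.left_mem h.right_mem hz _ _).norm (fun _ => norm_nonneg _)
    (norm_nonneg _) fun w => ?_
  rw [← h.greenU_congr Ub Vb fun m hm => rotS_of_ne S hm w]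
  exact h.norm_greenU_col_le _ Ub Vb hz hi hx

end Decoupling

section Scattering

open scoped ComplexOrder

variable {L : ℕ} {α : Matrix (Fin L) (Fin L) ℂ}

theorem specNorm_conjTranspose (A : Matrix (Fin L) (Fin L) ℂ) : specNorm Aᴴ = specNorm A := by
  rw [specNorm, specNorm, ← star_eq_conjTranspose, map_star, norm_star]

theorem one_sub_conjTranspose_mul_self_nonneg (hα : specNorm α ≤ 1) : 0 ≤ 1 - αᴴ * α := by
  have dotProduct_star (y : Fin L → ℂ) : star y ⬝ᵥ y = ((‖WithLp.toLp 2 y‖ ^ 2 : ℝ) : ℂ) := by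
    rw [EuclideanSpace.norm_sq_eq]
    simp [dotProduct, Complex.conj_mul', ← Complex.ofReal_pow]
  rw [nonneg_iff_posSemidef]
  refine PosSemidef.of_dotProduct_mulVec_nonneg (by simp [IsHermitian, conjTranspose_mul])
    fun x => ?_
  have hle := toEuclideanCLM_le hα (WithLp.toLp 2 x)
  rw [one_mul, toEuclideanCLM_toLp] at hle
  rw [sub_mulVec, one_mulVec, dotProduct_sub, ← mulVec_mulVec, dotProduct_mulVec,
    ← star_mulVec, dotProduct_star, dotProduct_star, ← Complex.ofReal_sub]
  exact_mod_cast sub_nonneg.mpr (pow_le_pow_left₀ (norm_nonneg _) hle 2)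

theorem one_sub_mul_conjTranspose_self_nonneg (hα : specNorm α ≤ 1) : 0 ≤ 1 - α * αᴴ := by
  simpa using one_sub_conjTranspose_mul_self_nonneg (α := αᴴ) (by rwa [specNorm_conjTranspose])

theorem sqrt_mul_eq_mul_sqrt {A B M : Matrix (Fin L) (Fin L) ℂ} (hA : 0 ≤ A)
    (hB : 0 ≤ B) (h : A * M = M * B) : CFC.sqrt A * M = M * CFC.sqrt B := by
  have isHermitian_sqrt (C : Matrix (Fin L) (Fin L) ℂ) : (CFC.sqrt C)ᴴ = CFC.sqrt C :=
    (nonneg_iff_posSemidef.mp (CFC.sqrt_nonneg C)).1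
  set R := fromBlocks (CFC.sqrt A) 0 0 (CFC.sqrt B)
  have hR : 0 ≤ R := by
    set Q := fromBlocks (CFC.sqrt (CFC.sqrt A)) 0 0 (CFC.sqrt (CFC.sqrt B))
    have hRQ : R = Qᴴ * Q := by
      simp [R, Q, fromBlocks_conjTranspose, fromBlocks_multiply, isHermitian_sqrt,
        CFC.sqrt_mul_sqrt_self _ (CFC.sqrt_nonneg _)]
    rw [hRQ, nonneg_iff_posSemidef]
    exact posSemidef_conjTranspose_mul_self Q
  have hsqrt : CFC.sqrt (fromBlocks A 0 0 B) = R :=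
    CFC.sqrt_unique (by simp [R, fromBlocks_multiply, CFC.sqrt_mul_sqrt_self _ hA,
      CFC.sqrt_mul_sqrt_self _ hB]) hR
  have hcomm : Commute (fromBlocks A 0 0 B) (fromBlocks 0 M 0 0) := by
    simp [commute_iff_eq, fromBlocks_multiply, h]
  have hcommR : R * fromBlocks 0 M 0 0 = fromBlocks 0 M 0 0 * R :=
    hsqrt ▸ hcomm.cfcₙ_nnreal _
  simpa [R, fromBlocks_multiply] using congrArg toBlocks₁₂ hcommR

theorem rho_mul_self (hα : specNorm α ≤ 1) : rho α * rho α = 1 - α * αᴴ :=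
  CFC.sqrt_mul_sqrt_self _ (one_sub_mul_conjTranspose_self_nonneg hα)

theorem rhoTilde_mul_self (hα : specNorm α ≤ 1) : rhoTilde α * rhoTilde α = 1 - αᴴ * α :=
  CFC.sqrt_mul_sqrt_self _ (one_sub_conjTranspose_mul_self_nonneg hα)

theorem conjTranspose_rho (α : Matrix (Fin L) (Fin L) ℂ) : (rho α)ᴴ = rho α :=
  (nonneg_iff_posSemidef.mp (CFC.sqrt_nonneg _)).1

theorem conjTranspose_rhoTilde (α : Matrix (Fin L) (Fin L) ℂ) : (rhoTilde α)ᴴ = rhoTilde α :=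
  (nonneg_iff_posSemidef.mp (CFC.sqrt_nonneg _)).1

theorem rho_mul (hα : specNorm α ≤ 1) : rho α * α = α * rhoTilde α :=
  sqrt_mul_eq_mul_sqrt (one_sub_mul_conjTranspose_self_nonneg hα)
    (one_sub_conjTranspose_mul_self_nonneg hα) (by noncomm_ring)

theorem conjTranspose_mul_rho (hα : specNorm α ≤ 1) : αᴴ * rho α = rhoTilde α * αᴴ := by
  simpa [conjTranspose_rho, conjTranspose_rhoTilde] using congrArg conjTranspose (rho_mul hα)

theorem scat_one_one_mem_unitary (hα : specNorm α ≤ 1) :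
    scat α 1 1 ∈ unitaryGroup (Fin L ⊕ Fin L) ℂ := by
  rw [mem_unitaryGroup_iff, star_eq_conjTranspose, scat]
  simp [fromBlocks_conjTranspose, fromBlocks_multiply, ← fromBlocks_one, conjTranspose_rho,
    conjTranspose_rhoTilde, rho_mul_self hα, rhoTilde_mul_self hα, rho_mul hα,
    conjTranspose_mul_rho hα]

theorem scat_eq_mul (α : Matrix (Fin L) (Fin L) ℂ) (U V : UL L) :
    scat α U V = (diagU 1 V).1 * scat α 1 1 * (diagU 1 U).1 := by
  simp [scat, diagU, fromBlocks_multiply]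

theorem scat_mem_unitary (hα : specNorm α ≤ 1) (U V : UL L) :
    scat α U V ∈ unitaryGroup (Fin L ⊕ Fin L) ℂ := by
  rw [scat_eq_mul]
  exact mul_mem (mul_mem (diagU 1 V).2 (scat_one_one_mem_unitary hα)) (diagU 1 U).2

/-- The random scattering matrices `S^{(n)}_ω` as unitary matrices. -/
noncomputable def randomScatU (hα : specNorm α ≤ 1) (ω : Sample L) (n : ℤ) : U2 L :=
  ⟨randomScat α ω n, scat_mem_unitary hα _ _⟩

theorem toBlocks₁₁_randomScatU (hα : specNorm α ≤ 1) (ω : Sample L) (n : ℤ) :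
    (randomScatU hα ω n).1.toBlocks₁₁ = α := rfl

theorem toEuclideanCLM_green (hα : specNorm α ≤ 1) (Ub Vb : UL L) (ω : Sample L) (J : Set ℤ)
    (z : ℂ) (k l : J) : toEuclideanCLM (n := Fin L) (𝕜 := ℂ) (green α Ub Vb ω J z k l) =
      greenU (randomScatU hα ω) Ub Vb J z k l := by
  set A := greenU (randomScatU hα ω) Ub Vb J z k l with hA
  obtain ⟨M, hM⟩ : ∃ M, toEuclideanCLM (n := Fin L) (𝕜 := ℂ) M = A :=
    (toEuclideanCLM (n := Fin L) (𝕜 := ℂ)).surjective A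
  rw [← hM]
  refine congrArg _ (Matrix.ext fun p q => ?_)
  have hentry : A (EuclideanSpace.single q 1) p = M p q := by
    rw [← hM, ofLp_toEuclideanCLM]
    simp
  rw [← hentry, hA, greenU, ContinuousLinearMap.comp_apply, ContinuousLinearMap.comp_apply,
    adjoint_site_apply]
  rfl

end Scattering

section Continuity

variable {L : ℕ} {X : Type*} [TopologicalSpace X]

open Filter Topology

theorem continuous_mul_apply {H : Type*} [NormedAddCommGroup H] [InnerProductSpace ℂ H]
    [CompleteSpace H] {V W : X → H →L[ℂ] H} (hV : ∀ v, Continuous fun x => V x v)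
    (hW : ∀ v, Continuous fun x => W x v) (hmem : ∀ x, V x ∈ unitary (H →L[ℂ] H)) (v : H) :
    Continuous fun x => (V x * W x) v := by
  refine continuous_iff_continuousAt.mpr fun x₀ => tendsto_iff_norm_sub_tendsto_zero.mpr ?_
  have hW₀ := tendsto_iff_norm_sub_tendsto_zero.mp ((hW v).tendsto x₀)
  have hV₀ := tendsto_iff_norm_sub_tendsto_zero.mp ((hV (W x₀ v)).tendsto x₀)
  refine squeeze_zero (fun _ => norm_nonneg _) (fun x => ?_) (by simpa using hW₀.add hV₀)
  calc ‖(V x * W x) v - (V x₀ * W x₀) v‖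
      = ‖V x (W x v - W x₀ v) + (V x (W x₀ v) - V x₀ (W x₀ v))‖ := by
        simp only [mul_apply_eq_comp, map_sub, sub_add_sub_cancel]
    _ ≤ ‖W x v - W x₀ v‖ + ‖V x (W x₀ v) - V x₀ (W x₀ v)‖ := by
        rw [← norm_apply_of_mem_unitary (hmem x) (W x v - W x₀ v)]
        exact norm_add_le _ _

theorem continuous_res_apply {H : Type*} [NormedAddCommGroup H] [InnerProductSpace ℂ H]
    [CompleteSpace H] {V : X → H →L[ℂ] H} (hV : ∀ v, Continuous fun x => V x v)
    (hmem : ∀ x, V x ∈ unitary (H →L[ℂ] H)) {z : ℂ} (hz : ‖z‖ ≠ 1) (v : H) :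
    Continuous fun x => res (V x) z v := by
  refine continuous_iff_continuousAt.mpr fun x₀ => tendsto_iff_norm_sub_tendsto_zero.mpr ?_
  set u := res (V x₀) z v
  have hu := tendsto_iff_norm_sub_tendsto_zero.mp ((hV u).tendsto x₀)
  refine squeeze_zero (fun _ => norm_nonneg _) (fun x => ?_)
    (by simpa using hu.const_mul (|‖z‖ - 1|⁻¹))
  have hsub : u - res (V x) z v = res (V x) z (V x u - V x₀ u) := by
    rw [map_sub, res_map_apply (hmem x) hz u, map_res_apply (hmem x₀) hz v, map_add, map_smul]
    abel
  rw [norm_sub_rev, hsub]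
  exact norm_res_apply_le (hmem x) hz _

theorem continuous_toEuclideanCLM_apply {M : X → Matrix (Fin L) (Fin L) ℂ} (hM : Continuous M)
    (v : EuclideanSpace ℂ (Fin L)) :
    Continuous fun x => toEuclideanCLM (n := Fin L) (𝕜 := ℂ) (M x) v :=
  (PiLp.continuous_toLp 2 _).comp (hM.matrix_mulVec continuous_const)

theorem continuous_layerU_apply_apply {S : X → ℤ → U2 L} (hS : ∀ n, Continuous fun x => S x n)
    (Ub Vb : UL L) {J : Set ℤ} (e : ℤ) (v : Ell2 J L) (i : J) :
    Continuous fun x => layerU (S x) Ub Vb J e v i := by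
  have hblock (n : ℤ) (f g : Fin L → Fin L ⊕ Fin L) (u : EuclideanSpace ℂ (Fin L)) :
      Continuous fun x => toEuclideanCLM (n := Fin L) (𝕜 := ℂ) ((S x n).1.submatrix f g) u :=
    continuous_toEuclideanCLM_apply
      ((continuous_subtype_val.comp (hS n)).matrix_submatrix f g) u
  simp only [layerU_apply, layerFun]
  split_ifs
  · exact (hblock _ Sum.inl Sum.inl _).add (hblock _ Sum.inl Sum.inr _)
  · exact continuous_const
  · exact (hblock _ Sum.inr Sum.inl _).add (hblock _ Sum.inr Sum.inr _)
  · exact continuous_const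

theorem norm_sq_layerU_sub_le (S S' : ℤ → U2 L) (Ub Vb : UL L) {J : Set ℤ} (e : ℤ) (v : Ell2 J L)
    (i : J) : ‖(layerU S Ub Vb J e v - layerU S' Ub Vb J e v) i‖ ^ 2 ≤
      4 * (‖v i‖ ^ 2 + ‖v (partner J e i)‖ ^ 2) := by
  have hle (T : ℤ → U2 L) : ‖layerU T Ub Vb J e v i‖ ^ 2 ≤ ‖v i‖ ^ 2 + ‖v (partner J e i)‖ ^ 2 := by
    rw [← norm_sq_layerU_add_partner T]
    exact le_add_of_nonneg_right (sq_nonneg _)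
  calc ‖(layerU S Ub Vb J e v - layerU S' Ub Vb J e v) i‖ ^ 2
      ≤ (‖layerU S Ub Vb J e v i‖ + ‖layerU S' Ub Vb J e v i‖) ^ 2 := by
        rw [lp.coeFn_sub, Pi.sub_apply]
        gcongr
        exact norm_sub_le _ _
    _ ≤ 2 * (‖layerU S Ub Vb J e v i‖ ^ 2 + ‖layerU S' Ub Vb J e v i‖ ^ 2) := add_sq_le
    _ ≤ 4 * (‖v i‖ ^ 2 + ‖v (partner J e i)‖ ^ 2) := by linarith [hle S, hle S']

theorem continuous_layerU_apply {S : X → ℤ → U2 L} (hS : ∀ n, Continuous fun x => S x n)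
    (Ub Vb : UL L) {J : Set ℤ} (e : ℤ) (v : Ell2 J L) :
    Continuous fun x => layerU (S x) Ub Vb J e v := by
  refine continuous_iff_continuousAt.mpr fun x₀ => tendsto_iff_norm_sub_tendsto_zero.mpr ?_
  have hpartner : Summable fun i => ‖v (partner J e i)‖ ^ 2 :=
    ((partner_involutive J e).toPerm.summable_iff (f := fun i => ‖v i‖ ^ 2)).mpr
      (summable_norm_sq v)
  have hsq : Tendsto (fun x => ‖layerU (S x) Ub Vb J e v - layerU (S x₀) Ub Vb J e v‖ ^ 2)
      (𝓝 x₀) (𝓝 0) := by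
    simp_rw [norm_sq_eq_tsum]
    rw [← tsum_zero (α := ℝ) (β := J)]
    refine tendsto_tsum_of_dominated_convergence
      (((summable_norm_sq v).add hpartner).mul_left 4) (fun i => ?_)
      (Eventually.of_forall fun x i => ?_)
    · simpa using ((((continuous_layerU_apply_apply hS Ub Vb e v i).tendsto x₀).sub_const
        (layerU (S x₀) Ub Vb J e v i)).norm).pow 2
    · rw [Real.norm_of_nonneg (by positivity)]
      exact norm_sq_layerU_sub_le (S x) (S x₀) Ub Vb e v i
  simpa using hsq.sqrt

theorem continuous_greenU {S : X → ℤ → U2 L} (hS : ∀ n, Continuous fun x => S x n)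
    (Ub Vb : UL L) {J : Set ℤ} {z : ℂ} (hz : ‖z‖ ≠ 1) (k l : J) :
    Continuous fun x => greenU (S x) Ub Vb J z k l :=
  continuous_clm_apply.mpr fun a => ((site k)†).continuous.comp <|
    continuous_res_apply (fun v => continuous_mul_apply (continuous_layerU_apply hS Ub Vb 0)
      (continuous_layerU_apply hS Ub Vb 1) (fun x => layerU_mem_unitary (S x) Ub Vb J 0) v)
      (fun x => zipU_mem_unitary (S x) Ub Vb J) hz (site l a)

theorem norm_greenU_le (S : ℤ → U2 L) (Ub Vb : UL L) {J : Set ℤ} {z : ℂ} (hz : ‖z‖ ≠ 1) (k l : J) :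
    ‖greenU S Ub Vb J z k l‖ ≤ |‖z‖ - 1|⁻¹ := by
  refine ContinuousLinearMap.opNorm_le_bound _ (by positivity) fun a => ?_
  rw [greenU, ContinuousLinearMap.comp_apply, ContinuousLinearMap.comp_apply, adjoint_site_apply]
  refine (lp.norm_apply_le_norm (p := 2) (by norm_num) _ k).trans ?_
  refine (norm_res_apply_le (zipU_mem_unitary S Ub Vb J) hz _).trans_eq ?_
  rw [site_apply, lp.norm_single (by norm_num)]

theorem continuous_expDiag : Continuous (expDiag (L := L)) :=
  (Continuous.matrix_diagonal (by fun_prop)).subtype_mk _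

theorem continuous_signDiag : Continuous (signDiag (L := L)) :=
  (Continuous.matrix_diagonal (continuous_pi fun j =>
    (continuous_of_discreteTopology (f := fun t : ℤ => (t : ℂ))).comp
      (Units.continuous_val.comp (continuous_apply j)))).subtype_mk _

theorem continuous_phaseV : Continuous (phaseV (L := L)) := by
  have := continuous_expDiag (L := L)
  have := continuous_signDiag (L := L)
  unfold phaseV
  fun_prop

theorem continuous_phaseU : Continuous (phaseU (L := L)) := by
  have := continuous_expDiag (L := L)
  have := continuous_signDiag (L := L)
  unfold phaseU
  fun_prop

theorem continuous_randomScatU {α : Matrix (Fin L) (Fin L) ℂ} (hα : specNorm α ≤ 1) (n : ℤ) :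
    Continuous fun ω => randomScatU hα ω n := by
  have : Continuous fun ω : Sample L => (phaseV (ω n)).1 :=
    continuous_subtype_val.comp (continuous_phaseV.comp (continuous_apply n))
  have : Continuous fun ω : Sample L => (phaseU (ω n)).1 :=
    continuous_subtype_val.comp (continuous_phaseU.comp (continuous_apply n))
  refine Continuous.subtype_mk ?_ _
  unfold randomScat scat
  fun_prop

instance : BorelSpace ℤˣ := by
  have : MeasurableSingletonClass ℤˣ := ⟨fun u => by
    refine ⟨{(u : ℤ)}, measurableSet_singleton _, ?_⟩
    ext t
    simp [Units.ext_iff]⟩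
  infer_instance

instance : SecondCountableTopology ℤˣ := inferInstance

instance : SecondCountableTopology (Matrix (Fin L) (Fin L) ℂ) :=
  inferInstanceAs (SecondCountableTopology (Fin L → Fin L → ℂ))

instance : SecondCountableTopology (UL L) := TopologicalSpace.Subtype.secondCountableTopology _

instance : BorelSpace (PhaseData L) := inferInstance

instance : BorelSpace (SiteData L) := inferInstance

instance : BorelSpace (Sample L) := inferInstance

theorem continuous_greenU_randomScatU {α : Matrix (Fin L) (Fin L) ℂ} (hα : specNorm α ≤ 1)
    (Ub Vb : UL L) {J : Set ℤ} {z : ℂ} (hz : ‖z‖ ≠ 1) (k l : J) :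
    Continuous fun ω => greenU (randomScatU hα ω) Ub Vb J z k l :=
  continuous_greenU (continuous_randomScatU hα) Ub Vb hz k l

theorem integrable_norm_greenU {α : Matrix (Fin L) (Fin L) ℂ} (hα : specNorm α ≤ 1)
    (p : unitInterval) (Ub Vb : UL L) {J : Set ℤ} {z : ℂ} (hz : ‖z‖ ≠ 1) (k l : J) {s : ℝ}
    (hs : 0 ≤ s) :
    Integrable (fun ω => ‖greenU (randomScatU hα ω) Ub Vb J z k l‖ ^ s) (law L p) := by
  have hcont := (continuous_greenU_randomScatU hα Ub Vb hz k l).norm.rpow_const fun _ => Or.inr hs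
  refine Integrable.of_bound hcont.measurable.aestronglyMeasurable (|‖z‖ - 1|⁻¹ ^ s)
    (Eventually.of_forall fun ω => ?_)
  rw [Real.norm_of_nonneg (by positivity)]
  exact Real.rpow_le_rpow (norm_nonneg _) (norm_greenU_le _ Ub Vb hz k l) hs

end Continuity

section Rotation

variable {L : ℕ}

/-- The angle in `(0, 2π]` congruent to `θ + η` modulo `2π`. -/
noncomputable def rotAngle (η : ℝ) (θ : Angle) : Angle :=
  ⟨toIocMod Real.two_pi_pos 0 (θ + η), Set.Ioc_subset_Icc_self <| by
    simpa only [zero_add] using toIocMod_mem_Ioc Real.two_pi_pos 0 (θ + η)⟩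

theorem circle_exp_rotAngle (η : ℝ) (θ : Angle) :
    Circle.exp (rotAngle η θ : ℝ) = Circle.exp η * Circle.exp (θ : ℝ) := by
  change Circle.exp (toIocMod Real.two_pi_pos 0 (θ + η)) = _
  rw [← self_sub_toIocDiv_zsmul, Circle.periodic_exp.sub_zsmul_eq, add_comm, Circle.exp_add]

theorem measurePreserving_comap_subtype_val {X Y : Type*} [MeasurableSpace X] [MeasurableSpace Y]
    {μ : Measure X} {ν : Measure Y} {s : Set Y} (hs : MeasurableSet s) {f : X → s}
    (hf : MeasurePreserving (fun x => (f x : Y)) μ (ν.restrict s)) :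
    MeasurePreserving f μ (ν.comap Subtype.val) := by
  have hval : MeasurableEmbedding (Subtype.val : s → Y) := MeasurableEmbedding.subtype_coe hs
  have hmeas : Measurable f := hf.measurable.subtype_mk
  refine ⟨hmeas, ?_⟩
  rw [← hval.comap_map (μ.map f), Measure.map_map hval.measurable hmeas]
  refine (congrArg (Measure.comap Subtype.val) (hf.map_eq.trans ?_)).trans (hval.comap_map _)
  exact (map_comap_subtype_coe hs ν).symm

theorem measurePreserving_rotAngle (η : ℝ) :
    MeasurePreserving (rotAngle η) uniformAngle uniformAngle := by
  have : Fact (0 < 2 * Real.pi) := ⟨Real.two_pi_pos⟩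
  have restrict_eq : volume.restrict (Set.Ioc (0 : ℝ) (0 + 2 * Real.pi)) =
      volume.restrict (Set.Icc 0 (2 * Real.pi)) := by
    rw [zero_add, restrict_Ioc_eq_restrict_Icc]
  have toReal : MeasurePreserving (Subtype.val : Angle → ℝ) (Measure.comap Subtype.val volume)
      (volume.restrict (Set.Ioc 0 (0 + 2 * Real.pi))) :=
    restrict_eq ▸ measurePreserving_subtype_coe measurableSet_Icc
  have toCircle := (AddCircle.measurePreserving_mk (2 * Real.pi) 0).comp toReal
  have rotate := (measurePreserving_add_right volume ((η : ℝ) : AddCircle (2 * Real.pi))).comp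
    toCircle
  have toIoc := (AddCircle.measurePreserving_equivIoc (2 * Real.pi) (a := 0)).comp rotate
  have toIcc := (measurePreserving_subtype_coe measurableSet_Ioc).comp toIoc
  rw [restrict_eq] at toIcc
  exact (measurePreserving_comap_subtype_val measurableSet_Icc
    (f := rotAngle η) toIcc).smul_measure _

/-- Rotation by `η` of the angles `θ` (those entering `V`) at one site. -/
noncomputable def rotSite (η : ℝ) (x : SiteData L) : SiteData L :=
  ((x.1.1, x.1.2.1, fun j => rotAngle η (x.1.2.2 j)), x.2)

theorem measurePreserving_rotSite (η : ℝ) (p : unitInterval) :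
    MeasurePreserving (rotSite (L := L) η) (siteLaw L p) (siteLaw L p) := by
  have rotAngles := measurePreserving_pi (fun _ : Fin L => uniformAngle) (fun _ => uniformAngle)
    (fun _ => measurePreserving_rotAngle η)
  exact ((MeasurePreserving.id _).prod ((MeasurePreserving.id _).prod rotAngles)).prod
    (MeasurePreserving.id _)

/-- Rotation by `η` of the angles `θ` at the site `n`; it multiplies `V^{(n)}_ω` by `e^{iη}`. -/
noncomputable def rotSample (n : ℤ) (η : ℝ) (ω : Sample L) : Sample L :=
  fun m => if m = n then rotSite η (ω m) else ω m

theorem measurePreserving_rotSample (n : ℤ) (η : ℝ) (p : unitInterval) :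
    MeasurePreserving (rotSample (L := L) n η) (law L p) (law L p) := by
  set rotAt : ℤ → SiteData L → SiteData L := fun m x => if m = n then rotSite η x else x
  have hrot (m : ℤ) : MeasurePreserving (rotAt m) (siteLaw L p) (siteLaw L p) := by
    by_cases hm : m = n
    · simpa only [rotAt, hm, if_true] using measurePreserving_rotSite η p
    · simp only [rotAt, hm, if_false]
      exact MeasurePreserving.id _
  refine ⟨measurable_pi_lambda _ fun m => (hrot m).measurable.comp (measurable_pi_apply m), ?_⟩
  refine (Measure.infinitePi_map_pi (fun _ => siteLaw L p) fun m => (hrot m).measurable).trans ?_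
  simp only [(hrot _).map_eq]
  rfl

theorem expDiag_rotAngle (η : ℝ) (θ : Fin L → Angle) :
    expDiag (fun j => rotAngle η (θ j)) = scalarU L (Circle.exp η) * expDiag θ := by
  apply Subtype.ext
  change diagonal _ = ((Circle.exp η : ℂ) • (1 : Matrix (Fin L) (Fin L) ℂ)) * diagonal _
  rw [smul_mul_assoc, one_mul, ← diagonal_smul]
  congr 1
  funext j
  have hexp := congrArg (fun w : Circle => (w : ℂ)) (circle_exp_rotAngle η (θ j))
  simpa [Circle.coe_exp, mul_comm] using hexp

theorem randomScatU_rotSample {α : Matrix (Fin L) (Fin L) ℂ} (hα : specNorm α ≤ 1) (n : ℤ) (η : ℝ)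
    (ω : Sample L) :
    randomScatU hα (rotSample n η ω) = rotS (randomScatU hα ω) n (Circle.exp η) := by
  funext m
  apply Subtype.ext
  rcases eq_or_ne m n with rfl | hm
  · have hU : phaseU (rotSample m η ω m) = phaseU (ω m) := by simp [rotSample, rotSite, phaseU]
    have hV : phaseV (rotSample m η ω m) = scalarU L (Circle.exp η) * phaseV (ω m) := by
      simp only [rotSample, rotSite, phaseV, if_true, expDiag_rotAngle]
      rw [← mul_assoc, ← scalarU_mul_comm, mul_assoc]
    rw [rotS, Function.update_self]
    change scat α _ _ = fromBlocks _ _ _ _ * scat α _ _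
    rw [hU, hV, scat, scat, fromBlocks_multiply]
    simp [mul_assoc]
  · simp [rotS_of_ne _ hm, randomScatU, randomScat, rotSample, hm]

theorem integral_eq_integral_integral_of_measurePreserving {X Y : Type*} [MeasurableSpace X]
    [MeasurableSpace Y] {μ : Measure X} [SFinite μ] {ν : Measure Y} [IsProbabilityMeasure ν]
    {T : Y → X → X} (hT : ∀ y, MeasurePreserving (T y) μ μ) {f : X → ℝ}
    (hf : AEStronglyMeasurable f μ) (hfT : Integrable (fun q : Y × X => f (T q.1 q.2)) (ν.prod μ)) :
    ∫ x, f x ∂μ = ∫ x, ∫ y, f (T y x) ∂ν ∂μ := by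
  have integral_comp (y : Y) : ∫ x, f (T y x) ∂μ = ∫ x, f x ∂μ := by
    rw [← integral_map (hT y).aemeasurable ((hT y).map_eq.symm ▸ hf), (hT y).map_eq]
  rw [← integral_integral_swap hfT]
  simp only [integral_comp, integral_const, probReal_univ, one_smul]

variable {α : Matrix (Fin L) (Fin L) ℂ}

theorem continuous_greenU_rotS_randomScatU (hα : specNorm α ≤ 1) (Ub Vb : UL L) {J : Set ℤ} {z : ℂ}
    (hz : ‖z‖ ≠ 1) (k l : J) (n : ℤ) : Continuous fun q : ℝ × Sample L =>
      greenU (rotS (randomScatU hα q.2) n (Circle.exp q.1)) Ub Vb J z k l := by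
  refine continuous_greenU (fun m => ?_) Ub Vb hz k l
  have hscat : Continuous fun q : ℝ × Sample L => randomScatU hα q.2 m :=
    (continuous_randomScatU hα m).comp continuous_snd
  rcases eq_or_ne m n with rfl | hm
  · have hdiag : Continuous fun q : ℝ × Sample L => diagU 1 (scalarU L (Circle.exp q.1)) := by
      refine Continuous.subtype_mk (Continuous.matrix_fromBlocks continuous_const continuous_const
        continuous_const ?_) _
      simp only [scalarU]
      fun_prop
    simp only [rotS, Function.update_self]
    exact hdiag.mul hscat
  · simpa only [rotS_of_ne _ hm] using hscat

theorem integral_norm_greenU_eq_integral_intervalAverage (hα : specNorm α ≤ 1) (p : unitInterval)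
    (Ub Vb : UL L) {J : Set ℤ} {z : ℂ} (hz : ‖z‖ ≠ 1) (k l : J) (n : ℤ) {s : ℝ} (hs : 0 ≤ s) :
    ∫ ω, ‖greenU (randomScatU hα ω) Ub Vb J z k l‖ ^ s ∂(law L p) =
      ∫ ω, ⨍ η in (0)..(2 * Real.pi),
        ‖greenU (rotS (randomScatU hα ω) n (Circle.exp η)) Ub Vb J z k l‖ ^ s ∂(law L p) := by
  have : NeZero (volume.restrict (Set.uIoc 0 (2 * Real.pi))) := ⟨by
    simp [Set.uIoc_of_le Real.two_pi_pos.le, Real.pi_pos]⟩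
  have : IsFiniteMeasure (volume.restrict (Set.uIoc 0 (2 * Real.pi))) := by
    rw [Set.uIoc_of_le Real.two_pi_pos.le]
    infer_instance
  have hcont := (continuous_greenU_rotS_randomScatU hα Ub Vb hz k l n).norm.rpow_const
    (p := s) fun _ => Or.inr hs
  simp only [← randomScatU_rotSample] at hcont ⊢
  refine integral_eq_integral_integral_of_measurePreserving
    (fun η => measurePreserving_rotSample n η p)
    (integrable_norm_greenU hα p Ub Vb hz k l hs).aestronglyMeasurable
    (Integrable.of_bound hcont.measurable.aestronglyMeasurable (|‖z‖ - 1|⁻¹ ^ s)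
      (Filter.Eventually.of_forall fun q => ?_))
  rw [Real.norm_of_nonneg (by positivity)]
  exact Real.rpow_le_rpow (norm_nonneg _) (norm_greenU_le _ Ub Vb hz k l) hs

variable {J J' : Set ℤ} {n : ℤ}

theorem integral_norm_greenU_le_of_intervalAverage_le (hα : specNorm α ≤ 1) (p : unitInterval)
    (Ub Vb : UL L) {z : ℂ} (hz : ‖z‖ ≠ 1) {s : ℝ} (hs : 0 ≤ s) {k l : J} {k' l' : J'} {C : ℝ}
    (hle : ∀ ω, ⨍ η in (0)..(2 * Real.pi),
      ‖greenU (rotS (randomScatU hα ω) n (Circle.exp η)) Ub Vb J z k l‖ ^ s ≤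
        C * ‖greenU (randomScatU hα ω) Ub Vb J' z k' l'‖ ^ s) :
    ∫ ω, ‖greenU (randomScatU hα ω) Ub Vb J z k l‖ ^ s ∂(law L p) ≤
      C * ∫ ω, ‖greenU (randomScatU hα ω) Ub Vb J' z k' l'‖ ^ s ∂(law L p) := by
  rw [integral_norm_greenU_eq_integral_intervalAverage hα p Ub Vb hz k l n hs,
    ← integral_const_mul]
  exact integral_mono_of_nonneg
    (Filter.Eventually.of_forall fun ω => integral_nonneg fun _ => by positivity)
    ((integrable_norm_greenU hα p Ub Vb hz k' l' hs).const_mul C) (Filter.Eventually.of_forall hle)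

theorem IsSide.integral_norm_greenU_row_le (h : IsSide J J' n) (hα : specNorm α < 1)
    (p : unitInterval) (Ub Vb : UL L) {z : ℂ} (hz : ‖z‖ ≠ 1) {s : ℝ} (hs0 : 0 < s) (hs1 : s < 1)
    {i x : J'} (hi : (i : ℤ) = n ∨ (i : ℤ) = n + 1) (hx : x ≠ i) :
    ∫ ω, ‖greenU (randomScatU hα.le ω) Ub Vb J z (Set.inclusion h.subset i)
        (Set.inclusion h.subset x)‖ ^ s ∂(law L p) ≤
      avgConst L s (specNorm α) *
        ∫ ω, ‖greenU (randomScatU hα.le ω) Ub Vb J' z i x‖ ^ s ∂(law L p) :=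
  integral_norm_greenU_le_of_intervalAverage_le hα.le p Ub Vb hz hs0.le fun ω =>
    h.intervalAverage_norm_greenU_row_le (randomScatU hα.le ω) Ub Vb
      (congrArg specNorm (toBlocks₁₁_randomScatU hα.le ω n)).le hα hz hs0 hs1 hi hx

theorem IsSide.integral_norm_greenU_col_le (h : IsSide J J' n) (hα : specNorm α < 1)
    (p : unitInterval) (Ub Vb : UL L) {z : ℂ} (hz : ‖z‖ ≠ 1) {s : ℝ} (hs0 : 0 < s) (hs1 : s < 1)
    {i x : J'} (hi : (i : ℤ) = n ∨ (i : ℤ) = n + 1) (hx : x ≠ i) :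
    ∫ ω, ‖greenU (randomScatU hα.le ω) Ub Vb J z (Set.inclusion h.subset x)
        (Set.inclusion h.subset i)‖ ^ s ∂(law L p) ≤
      avgConst L s (specNorm α) *
        ∫ ω, ‖greenU (randomScatU hα.le ω) Ub Vb J' z x i‖ ^ s ∂(law L p) :=
  integral_norm_greenU_le_of_intervalAverage_le hα.le p Ub Vb hz hs0.le fun ω =>
    h.intervalAverage_norm_greenU_col_le (randomScatU hα.le ω) Ub Vb
      (congrArg specNorm (toBlocks₁₁_randomScatU hα.le ω n)).le hα hz hs0 hs1 hi hx

end Rotation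

section Intervals

variable {L : ℕ} {J : Set ℤ} {k l : ℤ}

theorem isSide_inter_Ici (hk : k - 1 ∈ J) (hk' : k ∈ J) : IsSide J (J ∩ Set.Ici k) (k - 1) where
  subset := Set.inter_subset_left
  left_mem := hk
  right_mem := by rwa [sub_add_cancel]
  mem_iff i hi hi' hik := by
    simp only [Set.mem_inter_iff, hi, hi', Set.mem_Ici, true_and]
    lia
  mem_iff_notMem := by simp [hk']

theorem isSide_uIcc (hJ : J.OrdConnected) (hk : k ∈ J) (hl : l + 1 ∈ J) (hkl : k ≤ l) :
    IsSide (J ∩ Set.Ici k) (Set.uIcc k l) l := by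
  have hmem (i : ℤ) (hi : k ≤ i) (hi' : i ≤ l + 1) : i ∈ J := hJ.out hk hl ⟨hi, hi'⟩
  rw [Set.uIcc_of_le hkl]
  exact {
    subset := fun i hi => ⟨hmem i hi.1 (by linarith [hi.2]), hi.1⟩
    left_mem := ⟨hmem l hkl (by lia), hkl⟩
    right_mem := ⟨hl, hkl.trans (by lia)⟩
    mem_iff := fun i hi _ hil => by
      have := hi.2
      simp only [Set.mem_Icc, Set.mem_Ici] at this ⊢
      lia
    mem_iff_notMem := by simp [hkl] }

theorem integral_norm_greenU_le_uIcc (hJ : J.OrdConnected) (hk : Set.Icc (k - 1) (k + 1) ⊆ J)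
    (hl : Set.Icc (l - 1) (l + 1) ⊆ J) (hkl : k ≠ l) {α : Matrix (Fin L) (Fin L) ℂ}
    (hα : specNorm α < 1) (p : unitInterval) (Ub Vb : UL L) {z : ℂ} (hz : ‖z‖ ≠ 1) {s : ℝ}
    (hs0 : 0 < s) (hs1 : s < 1) :
    ∫ ω, ‖greenU (randomScatU hα.le ω) Ub Vb J z ⟨k, hk (by simp)⟩ ⟨l, hl (by simp)⟩‖ ^ s
        ∂(law L p) ≤
      avgConst L s (specNorm α) ^ 2 *
        ∫ ω, ‖greenU (randomScatU hα.le ω) Ub Vb (Set.uIcc k l) z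
          ⟨k, Set.left_mem_uIcc⟩ ⟨l, Set.right_mem_uIcc⟩‖ ^ s ∂(law L p) := by
  have hconst : 0 ≤ avgConst L s (specNorm α) := (avgConst_pos L hs0 hs1 hα).le
  have hkJ : k ∈ J := hk (by simp)
  have hlJ : l ∈ J := hl (by simp)
  rw [sq, mul_assoc]
  rcases hkl.lt_or_gt with hlt | hgt
  · have cutLeft := isSide_inter_Ici (hk ⟨le_rfl, by lia⟩) hkJ
    have cutRight := isSide_uIcc hJ hkJ (hl ⟨by lia, le_rfl⟩) hlt.le
    refine (cutLeft.integral_norm_greenU_row_le hα p Ub Vb hz hs0 hs1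
      (i := ⟨k, hkJ, le_refl k⟩) (x := ⟨l, hlJ, hlt.le⟩) (Or.inr (by simp))
      (Subtype.coe_ne_coe.mp hkl.symm)).trans (mul_le_mul_of_nonneg_left ?_ hconst)
    exact cutRight.integral_norm_greenU_col_le hα p Ub Vb hz hs0 hs1
      (i := ⟨l, Set.right_mem_uIcc⟩) (x := ⟨k, Set.left_mem_uIcc⟩) (Or.inl rfl)
      (Subtype.coe_ne_coe.mp hkl)
  · have cutLeft := isSide_inter_Ici (hl ⟨le_rfl, by lia⟩) hlJ
    have cutRight := isSide_uIcc hJ hlJ (hk ⟨by lia, le_rfl⟩) hgt.le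
    rw [Set.uIcc_comm] at cutRight
    refine (cutLeft.integral_norm_greenU_col_le hα p Ub Vb hz hs0 hs1
      (i := ⟨l, hlJ, le_refl l⟩) (x := ⟨k, hkJ, hgt.le⟩) (Or.inr (by simp))
      (Subtype.coe_ne_coe.mp hkl)).trans (mul_le_mul_of_nonneg_left ?_ hconst)
    exact cutRight.integral_norm_greenU_row_le hα p Ub Vb hz hs0 hs1
      (i := ⟨k, Set.left_mem_uIcc⟩) (x := ⟨l, Set.right_mem_uIcc⟩) (Or.inl rfl)
      (Subtype.coe_ne_coe.mp hkl.symm)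

theorem ordConnected_interval (a : WithBot ℤ) (b : WithTop ℤ) : (interval a b).OrdConnected :=
  ⟨fun _ hi _ hj _ hm => ⟨hi.1.trans (WithBot.coe_le_coe.mpr hm.1),
    (WithTop.coe_le_coe.mpr hm.2).trans hj.2⟩⟩

theorem Icc_subset_interval {a : WithBot ℤ} {b : WithTop ℤ} (hak : a < (k : WithBot ℤ))
    (hkb : (k : WithTop ℤ) < b) : Set.Icc (k - 1) (k + 1) ⊆ interval a b := by
  have hleft : k - 1 ∈ interval a b := by
    refine ⟨?_, (WithTop.coe_le_coe.mpr (by lia)).trans hkb.le⟩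
    cases a with
    | bot => exact bot_le
    | coe a => exact WithBot.coe_le_coe.mpr (Int.le_sub_one_of_lt (WithBot.coe_lt_coe.mp hak))
  have hright : k + 1 ∈ interval a b := by
    refine ⟨hak.le.trans (WithBot.coe_le_coe.mpr (by lia)), ?_⟩
    cases b with
    | top => exact le_top
    | coe b => exact WithTop.coe_le_coe.mpr (Int.add_one_le_of_lt (WithTop.coe_lt_coe.mp hkb))
  exact (ordConnected_interval a b).out hleft hright

end Intervals

section SubordinateNorm

theorem exists_seminorm_le_mul {E : Type*} [AddCommGroup E] [Module ℂ E] [FiniteDimensional ℂ E]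
    {q : Seminorm ℂ E} (hq : ∀ v, q v = 0 → v = 0) (r : Seminorm ℂ E) :
    ∃ C : ℝ, 0 < C ∧ ∀ v, r v ≤ C * q v := by
  let _ : Norm E := ⟨q⟩
  have core : NormedSpace.Core ℂ E :=
    { norm_nonneg := apply_nonneg q
      norm_smul := map_smul_eq_mul q
      norm_triangle := map_add_le_add q
      norm_eq_zero_iff := fun v => ⟨hq v, fun hv => by rw [hv]; exact map_zero q⟩ }
  let _ := NormedAddCommGroup.ofCore core
  let _ := NormedSpace.ofCore core
  have := FiniteDimensional.complexToReal E
  have hr : ContinuousOn r (interior Set.univ) := r.convexOn.continuousOn_interior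
  rw [interior_univ, continuousOn_univ] at hr
  exact r.bound_of_continuous_normedSpace hr

variable {L : ℕ} {N : Seminorm ℂ (Fin L → ℂ)} (A B : Matrix (Fin L) (Fin L) ℂ)

theorem seminorm_mulVec_le_subordinateNorm (hN : ∀ v, N v = 0 → v = 0) {v : Fin L → ℂ}
    (hv : N v ≤ 1) : N (A *ᵥ v) ≤ subordinateNorm N A := by
  obtain ⟨C, hC, hle⟩ := exists_seminorm_le_mul hN (N.comp A.mulVecLin)
  refine le_csSup ⟨C, ?_⟩ ⟨v, hv, rfl⟩
  rintro _ ⟨w, hw, rfl⟩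
  exact (hle w).trans (mul_le_of_le_one_right hC.le hw)

theorem subordinateNorm_le {M : ℝ} (hM : ∀ v, N v ≤ 1 → N (A *ᵥ v) ≤ M) :
    subordinateNorm N A ≤ M := by
  refine csSup_le ⟨_, 0, by simp, rfl⟩ ?_
  rintro _ ⟨v, hv, rfl⟩
  exact hM v hv

/-- The subordinate norm, transported to operators on the Euclidean space along
`toEuclideanCLM`. -/
noncomputable def subordinateSeminorm (hN : ∀ v, N v = 0 → v = 0) :
    Seminorm ℂ (EuclideanSpace ℂ (Fin L) →L[ℂ] EuclideanSpace ℂ (Fin L)) :=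
  (Seminorm.ofSMulLE (subordinateNorm N)
    (le_antisymm (subordinateNorm_le 0 fun v _ => by simp)
      (Real.sSup_nonneg (by rintro _ ⟨v, -, rfl⟩; exact apply_nonneg N _)))
    (fun A B => subordinateNorm_le _ fun v hv => by
      rw [add_mulVec]
      exact (map_add_le_add N _ _).trans (add_le_add
        (seminorm_mulVec_le_subordinateNorm A hN hv) (seminorm_mulVec_le_subordinateNorm B hN hv)))
    (fun c A => subordinateNorm_le _ fun v hv => by
      rw [smul_mulVec, map_smul_eq_mul]
      gcongr
      exact seminorm_mulVec_le_subordinateNorm A hN hv)).comp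
    (toEuclideanCLM (n := Fin L) (𝕜 := ℂ)).symm.toAlgEquiv.toLinearMap

theorem subordinateSeminorm_toEuclideanCLM (hN : ∀ v, N v = 0 → v = 0) :
    subordinateSeminorm hN (toEuclideanCLM (n := Fin L) (𝕜 := ℂ) A) = subordinateNorm N A :=
  congrArg (subordinateNorm N) ((toEuclideanCLM (n := Fin L) (𝕜 := ℂ)).symm_apply_apply A)

theorem subordinateSeminorm_definite (hN : ∀ v, N v = 0 → v = 0)
    (T : EuclideanSpace ℂ (Fin L) →L[ℂ] EuclideanSpace ℂ (Fin L))
    (hT : subordinateSeminorm hN T = 0) : T = 0 := by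
  obtain ⟨A, rfl⟩ := EquivLike.surjective (toEuclideanCLM (n := Fin L) (𝕜 := ℂ)) T
  rw [subordinateSeminorm_toEuclideanCLM] at hT
  have hball : ∀ v, N v ≤ 1 → A *ᵥ v = 0 := fun v hv => hN _ <| le_antisymm
    ((seminorm_mulVec_le_subordinateNorm A hN hv).trans_eq hT) (apply_nonneg N _)
  suffices hA : A = 0 by rw [hA, map_zero]
  refine Matrix.ext_of_mulVec_single fun i => ?_
  rw [zero_mulVec]
  set v : Fin L → ℂ := Pi.single i 1
  have hv : N v ≠ 0 := fun h => by simpa [v] using congrFun (hN v h) i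
  have hscaled := hball (((N v)⁻¹ : ℂ) • v) (by
    rw [map_smul_eq_mul, norm_inv, Complex.norm_of_nonneg (apply_nonneg N v), inv_mul_cancel₀ hv])
  rw [mulVec_smul, smul_eq_zero] at hscaled
  exact hscaled.resolve_left (inv_ne_zero (Complex.ofReal_ne_zero.mpr hv))

end SubordinateNorm

section FractionalMoments

variable {L : ℕ} {α : Matrix (Fin L) (Fin L) ℂ}
  (q : Seminorm ℂ (EuclideanSpace ℂ (Fin L) →L[ℂ] EuclideanSpace ℂ (Fin L)))

theorem integrable_seminorm_greenU (hα : specNorm α ≤ 1) (p : unitInterval) (Ub Vb : UL L)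
    {J : Set ℤ} {z : ℂ} (hz : ‖z‖ ≠ 1) (k l : J) {s : ℝ} (hs : 0 ≤ s) :
    Integrable (fun ω => q (greenU (randomScatU hα ω) Ub Vb J z k l) ^ s) (law L p) := by
  obtain ⟨C, hC, hle⟩ := exists_seminorm_le_mul (q := normSeminorm ℂ _)
    (fun _ hT => norm_eq_zero.mp hT) q
  have hq : Continuous q := by
    have := FiniteDimensional.complexToReal
      (EuclideanSpace ℂ (Fin L) →L[ℂ] EuclideanSpace ℂ (Fin L))
    exact q.convexOn.locallyLipschitz.continuous
  refine ((integrable_norm_greenU hα p Ub Vb hz k l hs).const_mul (C ^ s)).mono'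
    ((hq.comp (continuous_greenU_randomScatU hα Ub Vb hz k l)).rpow_const fun _ =>
      Or.inr hs).aestronglyMeasurable (ae_of_all _ fun ω => ?_)
  rw [Real.norm_of_nonneg (Real.rpow_nonneg (apply_nonneg q _) s),
    ← Real.mul_rpow hC.le (norm_nonneg _)]
  exact Real.rpow_le_rpow (apply_nonneg q _) (hle _) hs

variable {q} (r : Seminorm ℂ (EuclideanSpace ℂ (Fin L) →L[ℂ] EuclideanSpace ℂ (Fin L))) in
theorem exists_integral_seminorm_greenU_le (hα : specNorm α ≤ 1) (hq : ∀ T, q T = 0 → T = 0)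
    {s : ℝ} (hs : 0 ≤ s) :
    ∃ C : ℝ, 0 < C ∧ ∀ (p : unitInterval) (Ub Vb : UL L) (J : Set ℤ) (z : ℂ), ‖z‖ ≠ 1 →
      ∀ k l : J, ∫ ω, r (greenU (randomScatU hα ω) Ub Vb J z k l) ^ s ∂(law L p) ≤
        C * ∫ ω, q (greenU (randomScatU hα ω) Ub Vb J z k l) ^ s ∂(law L p) := by
  obtain ⟨C, hC, hle⟩ := exists_seminorm_le_mul hq r
  refine ⟨C ^ s, Real.rpow_pos_of_pos hC s, fun p Ub Vb J z hz k l => ?_⟩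
  rw [← integral_const_mul]
  refine integral_mono (integrable_seminorm_greenU r hα p Ub Vb hz k l hs)
    ((integrable_seminorm_greenU q hα p Ub Vb hz k l hs).const_mul _) fun ω => ?_
  dsimp only
  rw [← Real.mul_rpow hC.le (apply_nonneg q _)]
  exact Real.rpow_le_rpow (apply_nonneg r _) (hle _) hs

theorem exists_integral_seminorm_greenU_le_uIcc (hα : specNorm α < 1)
    (hq : ∀ T, q T = 0 → T = 0) {s : ℝ} (hs0 : 0 < s) (hs1 : s < 1) :
    ∃ C : ℝ, 0 < C ∧ ∀ (p : unitInterval) (Ub Vb : UL L) (J : Set ℤ), J.OrdConnected →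
      ∀ z : ℂ, ‖z‖ ≠ 1 → ∀ (k l : ℤ) (hk : Set.Icc (k - 1) (k + 1) ⊆ J)
        (hl : Set.Icc (l - 1) (l + 1) ⊆ J), k ≠ l →
      ∫ ω, q (greenU (randomScatU hα.le ω) Ub Vb J z
          ⟨k, hk (by simp)⟩ ⟨l, hl (by simp)⟩) ^ s ∂(law L p) ≤
        C * ∫ ω, q (greenU (randomScatU hα.le ω) Ub Vb (Set.uIcc k l) z
          ⟨k, Set.left_mem_uIcc⟩ ⟨l, Set.right_mem_uIcc⟩) ^ s ∂(law L p) := by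
  obtain ⟨C₁, hC₁, hqle⟩ := exists_integral_seminorm_greenU_le (q := normSeminorm ℂ _) q hα.le
    (fun _ hT => norm_eq_zero.mp hT) hs0.le
  obtain ⟨C₂, hC₂, hleq⟩ := exists_integral_seminorm_greenU_le (normSeminorm ℂ _) hα.le hq hs0.le
  have hconst : 0 < avgConst L s (specNorm α) ^ 2 := pow_pos (avgConst_pos L hs0 hs1 hα) 2
  refine ⟨C₁ * avgConst L s (specNorm α) ^ 2 * C₂, by positivity,
    fun p Ub Vb J hJ z hz k l hk hl hkl => ?_⟩
  rw [mul_assoc, mul_assoc]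
  exact (hqle p Ub Vb J z hz _ _).trans <| mul_le_mul_of_nonneg_left
    ((integral_norm_greenU_le_uIcc hJ hk hl hkl hα p Ub Vb hz hs0 hs1).trans <|
      mul_le_mul_of_nonneg_left (hleq p Ub Vb _ z hz _ _) hconst.le) hC₁.le

theorem sq_integral_le_integral_sq {Ω : Type*} [MeasurableSpace Ω] {μ : Measure Ω}
    [IsProbabilityMeasure μ] {f : Ω → ℝ} (hf : Integrable f μ)
    (hf_sq : Integrable (fun x => f x ^ 2) μ) : (∫ x, f x ∂μ) ^ 2 ≤ ∫ x, f x ^ 2 ∂μ :=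
  even_two.convexOn_pow.map_integral_le (by fun_prop) isClosed_univ (by simp) hf hf_sq

end FractionalMoments

theorem mainTheorem9_general {L : ℕ} {α : Matrix (Fin L) (Fin L) ℂ} (hα : specNorm α < 1)
    {N : Seminorm ℂ (Fin L → ℂ)} (hN : ∀ v, N v = 0 → v = 0)
    {s : ℝ} (hs0 : 0 < s) (hs1 : s < 1) :
    ∃ C : ℝ, 0 < C ∧ ∀ (p : unitInterval) (z : ℂ), ‖z‖ ≠ 1 →
      ∀ (Ub Vb : UL L) (a : WithBot ℤ) (b : WithTop ℤ) (k l : ℤ)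
        (hak : a < (k : WithBot ℤ)) (hkb : (k : WithTop ℤ) < b)
        (hal : a < (l : WithBot ℤ)) (hlb : (l : WithTop ℤ) < b), k ≠ l →
      Integrable (fun ω => subordinateNorm N
        (green α Ub Vb ω (interval a b) z
          ⟨k, hak.le, hkb.le⟩ ⟨l, hal.le, hlb.le⟩) ^ s) (law L p) ∧
      Integrable (fun ω => subordinateNorm N
        (green α Ub Vb ω (Set.uIcc k l) z
          ⟨k, Set.left_mem_uIcc⟩ ⟨l, Set.right_mem_uIcc⟩) ^ (2 * s)) (law L p) ∧
      (∫ ω, subordinateNorm N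
        (green α Ub Vb ω (interval a b) z
          ⟨k, hak.le, hkb.le⟩ ⟨l, hal.le, hlb.le⟩) ^ s ∂(law L p)) ^ 2 ≤
        C * ∫ ω, subordinateNorm N
          (green α Ub Vb ω (Set.uIcc k l) z
            ⟨k, Set.left_mem_uIcc⟩ ⟨l, Set.right_mem_uIcc⟩) ^ (2 * s) ∂(law L p) := by
  set q := subordinateSeminorm hN
  obtain ⟨C, hC, hle⟩ := exists_integral_seminorm_greenU_le_uIcc q hα
    (subordinateSeminorm_definite hN) hs0 hs1
  refine ⟨C ^ 2, by positivity, fun p z hz Ub Vb a b k l hak hkb hal hlb hkl => ?_⟩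
  simp only [← subordinateSeminorm_toEuclideanCLM _ hN, toEuclideanCLM_green hα.le]
  have hint := fun J (k l : (J : Set ℤ)) (t : ℝ) (ht : 0 ≤ t) =>
    integrable_seminorm_greenU q hα.le p Ub Vb hz k l ht
  refine ⟨hint _ _ _ s hs0.le, hint _ _ _ (2 * s) (by positivity), ?_⟩
  have hsq : ∀ T, q T ^ (2 * s) = (q T ^ s) ^ 2 := fun T => by
    rw [mul_comm, Real.rpow_mul (apply_nonneg q T), Real.rpow_two]
  have hbound := pow_le_pow_left₀ (integral_nonneg fun ω => Real.rpow_nonneg (apply_nonneg q _) s)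
    (hle p Ub Vb _ (ordConnected_interval a b) z hz k l (Icc_subset_interval hak hkb)
      (Icc_subset_interval hal hlb) hkl) 2
  rw [mul_pow] at hbound
  refine hbound.trans (mul_le_mul_of_nonneg_left ?_ (by positivity))
  simp only [q, hsq]
  exact sq_integral_le_integral_sq (hint _ _ _ s hs0.le)
    (by simpa only [hsq] using hint _ _ _ (2 * s) (by positivity))

end ScatteringZipper


open MeasureTheory ScatteringZipper in
theorem mainTheorem9 (L : ℕ) (hL : 1 ≤ L) (p : unitInterval) (hp0 : 0 < p) (hp1 : p < 1)
    (α : Matrix (Fin L) (Fin L) ℂ) (hα : specNorm α < 1)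
    (N : Seminorm ℂ (Fin L → ℂ)) (hN : ∀ v, N v = 0 → v = 0)
    (s : ℝ) (hs0 : 0 < s) (hs1 : s < 1 / 2) :
    ∃ C : ℝ, 0 < C ∧ ∀ ε : ℝ, 0 < ε → ∀ z ∈ annulus ε, ‖z‖ ≠ 1 →
      ∀ (Ub Vb : UL L) (a : WithBot ℤ) (b : WithTop ℤ) (k l : ℤ)
        (hak : a < (k : WithBot ℤ)) (hkb : (k : WithTop ℤ) < b)
        (hal : a < (l : WithBot ℤ)) (hlb : (l : WithTop ℤ) < b), 4 < |k - l| →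
      Integrable (fun ω => subordinateNorm N
        (green α Ub Vb ω (interval a b) z
          ⟨k, hak.le, hkb.le⟩ ⟨l, hal.le, hlb.le⟩) ^ s) (law L p) ∧
      Integrable (fun ω => subordinateNorm N
        (green α Ub Vb ω (Set.uIcc k l) z
          ⟨k, Set.left_mem_uIcc⟩ ⟨l, Set.right_mem_uIcc⟩) ^ (2 * s)) (law L p) ∧
      (∫ ω, subordinateNorm N
        (green α Ub Vb ω (interval a b) z
          ⟨k, hak.le, hkb.le⟩ ⟨l, hal.le, hlb.le⟩) ^ s ∂(law L p)) ^ 2 ≤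
        C * ∫ ω, subordinateNorm N
          (green α Ub Vb ω (Set.uIcc k l) z
            ⟨k, Set.left_mem_uIcc⟩ ⟨l, Set.right_mem_uIcc⟩) ^ (2 * s) ∂(law L p) := by
  obtain ⟨C, hC, hle⟩ := mainTheorem9_general hα hN hs0 (hs1.trans (by norm_num))
  exact ⟨C, hC, fun _ _ z _ hz Ub Vb a b k l hak hkb hal hlb hkl =>
    hle p z hz Ub Vb a b k l hak hkb hal hlb fun h => by simp [h] at hkl⟩
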